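/- For $i,j\in\{1,2\}$ put $$\nu_{i,j}=-13+(-1)^i\,5\sqrt7-(-1)^j\,8\sqrt{13}+(-1)^{i+j}\,3\sqrt7\sqrt{13};$$ these are the four (distinct) conjugates over $\mathbb Q$ of $\nu_{1,1}=-13-5\sqrt7+8\sqrt{13}+3\sqrt{91}$. Let $$C=\Big\{7,\ 13,\ -1,\ \tfrac{3+\sqrt{13}}2\Big\}\cup\{\nu_{i,j}\}_{1\le i,j\le 2},$$ let $N'\subset\mathbb C$ be the field obtained by adjoining to $\mathbb Q$ all square roots of all elements of $C$, and let $F=\mathbb Q(\sqrt7,\sqrt{13})\subset N'$. Write $D_{N'}$ for the absolute value of the discriminant of $N'$. Then $$[N':\mathbb Q]=256\quad\text{and}\quad D_{N'}^{1/[N':\mathbb Q]}=2^{7/4}\cdot\sqrt{3\cdot7\cdot13}\approx 55.5756$$ (correctly rounded to four decimal places). Moreover, $N'$ is the narrow ray class field of $F$ of conductor (that is, modulus) $6\infty$, where $\infty$ is the product of all the infinite places of $F$: the extension $N'/F$ is finite abelian and unramified at every prime ideal of $F$ not dividing $6$, and the kernel of its Artin map, from the group of fractional ideals of $F$ prime to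 $6$ to $\mathrm{Gal}(N'/F)$, is exactly the group of principal ideals $(\alpha)$ with $\alpha\in F^\times$ totally positive and $\alpha\equiv1 \bmod^{*} 6$ (i.e. $\alpha=a/b$ with $a,b\in O_F$ nonzero, prime to $6$, and $a\equiv b \bmod 6O_F$). -/

import Mathlib

open NumberField IsDedekindDomain
open scoped nonZeroDivisors

noncomputable section

/-! ### Narrow ray class fields -/

namespace RayClass

variable {K : Type*} [Field K] [NumberField K]

/-- The group of the fractional ideals of `K` that are prime to the nonzero integral ideal `m`:
no prime ideal dividing `m` occurs in their factorization. -/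
def idealsPrimeTo (m : Ideal (𝓞 K)) : Subgroup (FractionalIdeal (𝓞 K)⁰ K)ˣ where
  carrier := {I | ∀ v : HeightOneSpectrum (𝓞 K), v.asIdeal ∣ m →
    FractionalIdeal.count K v (I : FractionalIdeal (𝓞 K)⁰ K) = 0}
  one_mem' := fun v _ => by simpa using FractionalIdeal.count_one K v
  mul_mem' := fun {I J} hI hJ v hv => by
    rw [Units.val_mul, FractionalIdeal.count_mul K v I.ne_zero J.ne_zero, hI v hv, hJ v hv,
      add_zero]
  inv_mem' := fun {I} hI v hv => by
    rw [Units.val_inv_eq_inv_val, FractionalIdeal.count_inv, hI v hv, neg_zero]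

/-- `α ≡ 1 mod* m`: the number `α` is a quotient `a / b` of algebraic integers that are prime
to `m` and congruent to each other modulo `m`. -/
def IsOneMod (m : Ideal (𝓞 K)) (α : Kˣ) : Prop :=
  ∃ a b : 𝓞 K, b ≠ 0 ∧ Ideal.span {a} ⊔ m = ⊤ ∧ Ideal.span {b} ⊔ m = ⊤ ∧
    a - b ∈ m ∧ (α : K) = (a : K) / (b : K)

/-- `α` is positive at every real place of `K`. -/
def IsTotallyPositive (α : Kˣ) : Prop :=
  ∀ φ : K →+* ℝ, 0 < φ (α : K)

/-- `L` is the narrow ray class field of `K` of conductor (modulus) `m∞`, where `∞` is the product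
of all the infinite places: `L / K` is a finite abelian extension, unramified at all prime ideals
of `K` not dividing `m`, and the kernel of its Artin map `ψ`, the homomorphism from the fractional
ideals prime to `m` to `Gal(L/K)` that sends each prime ideal to its Frobenius, is precisely the
ray modulo `m∞`, the group of the principal ideals `(α)` with `α ≡ 1 mod* m` and `α` totally
positive. -/
def IsNarrowRayClassField (K L : Type*) [Field K] [NumberField K] [Field L] [NumberField L]
    [Algebra K L] (m : Ideal (𝓞 K)) : Prop :=
  m ≠ ⊥ ∧ IsAbelianGalois K L ∧
  (∀ v : HeightOneSpectrum (𝓞 K), ¬ v.asIdeal ∣ m →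
    ∀ (P : Ideal (𝓞 L)) [P.IsPrime], P.LiesOver v.asIdeal → Algebra.IsUnramifiedAt (𝓞 K) P) ∧
  ∃ ψ : idealsPrimeTo m →* Gal(L/K),
    (∀ (I : idealsPrimeTo m) (v : HeightOneSpectrum (𝓞 K)),
      ((I : (FractionalIdeal (𝓞 K)⁰ K)ˣ) : FractionalIdeal (𝓞 K)⁰ K) = v.asIdeal →
      ∀ P : Ideal (𝓞 L), P.IsPrime → P.LiesOver v.asIdeal →
        (RingOfIntegers.mapAlgHom (ψ I : L ≃ₐ[K] L)).IsArithFrobAt P) ∧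
    ∀ I : idealsPrimeTo m, ψ I = 1 ↔
      ∃ α : Kˣ, IsOneMod m α ∧ IsTotallyPositive α ∧
        (I : (FractionalIdeal (𝓞 K)⁰ K)ˣ) = toPrincipalIdeal (𝓞 K) K α

end RayClass

/-- The absolute value of the discriminant of the number field `K`, raised to the power
`1 / [K : ℚ]`. -/
def rootDiscriminant (K : Type*) [Field K] [NumberField K] : ℝ :=
  |(NumberField.discr K : ℝ)| ^ (1 / (Module.finrank ℚ K : ℝ))

/-! ### The field `N'` -/

namespace Example256

/-- `√7` as a complex number. -/
def s7 : ℂ := ((√7 : ℝ) : ℂ)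

/-- `√13` as a complex number. -/
def s13 : ℂ := ((√13 : ℝ) : ℂ)

/-- The numbers `ν_{i,j}`, used for `i, j ∈ {1, 2}`. -/
def nu (i j : ℕ) : ℂ :=
  -13 + (-1) ^ i * (5 * s7) - (-1) ^ j * (8 * s13) + (-1) ^ (i + j) * (3 * s7 * s13)

/-- The set `C` of the numbers whose square roots generate `N'`. -/
def C : Set ℂ :=
  {7, 13, -1, (3 + s13) / 2} ∪ {nu 1 1, nu 1 2, nu 2 1, nu 2 2}

/-- `F = ℚ(√7, √13)`. -/
def F : IntermediateField ℚ ℂ := IntermediateField.adjoin ℚ {s7, s13}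

/-- `N'`, generated over `ℚ` by all the square roots of all the elements of `C`. -/
def N' : IntermediateField ℚ ℂ := IntermediateField.adjoin ℚ {z : ℂ | z ^ 2 ∈ C}

lemma s7_sq : s7 ^ 2 = 7 := by
  rw [s7, ← Complex.ofReal_pow, Real.sq_sqrt (by norm_num)]; norm_num

lemma s13_sq : s13 ^ 2 = 13 := by
  rw [s13, ← Complex.ofReal_pow, Real.sq_sqrt (by norm_num)]; norm_num

lemma F_le_N' : F ≤ N' := by
  refine IntermediateField.adjoin.mono ℚ _ _ ?_
  rintro z (rfl | rfl)
  · simp [C, s7_sq]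
  · simp [C, s13_sq]

lemma isAlgebraic_natCast (n : ℕ) : IsAlgebraic ℚ (n : ℂ) := by
  simpa using isAlgebraic_algebraMap (R := ℚ) (A := ℂ) (n : ℚ)

lemma isAlgebraic_s7 : IsAlgebraic ℚ s7 :=
  IsAlgebraic.of_pow (n := 2) (by norm_num) (by rw [s7_sq]; exact_mod_cast isAlgebraic_natCast 7)

lemma isAlgebraic_s13 : IsAlgebraic ℚ s13 :=
  IsAlgebraic.of_pow (n := 2) (by norm_num) (by rw [s13_sq]; exact_mod_cast isAlgebraic_natCast 13)

instance : NumberField F where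
  to_charZero := inferInstance
  to_finiteDimensional := by
    refine IntermediateField.finiteDimensional_adjoin fun x hx => ?_
    rcases hx with rfl | rfl
    exacts [isAlgebraic_s7.isIntegral, isAlgebraic_s13.isIntegral]

lemma isAlgebraic_of_mem_F {z : ℂ} (hz : z ∈ F) : IsAlgebraic ℚ z :=
  (IntermediateField.isAlgebraic_iff).1
    (Algebra.IsAlgebraic.isAlgebraic (R := ℚ) (⟨z, hz⟩ : F))

lemma C_subset_F : C ⊆ F := by
  have h7 : s7 ∈ F := IntermediateField.subset_adjoin ℚ _ (by simp)
  have h13 : s13 ∈ F := IntermediateField.subset_adjoin ℚ _ (by simp)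
  have hn : ∀ n : ℕ, (n : ℂ) ∈ F := fun n => natCast_mem F n
  have hnu : ∀ i j : ℕ, nu i j ∈ F := fun i j => by
    have hs : ∀ k : ℕ, (-1 : ℂ) ^ k ∈ F := fun k => pow_mem (neg_mem (one_mem F)) k
    have h5 : (5 : ℂ) ∈ F := by exact_mod_cast hn 5
    have h8 : (8 : ℂ) ∈ F := by exact_mod_cast hn 8
    have h3 : (3 : ℂ) ∈ F := by exact_mod_cast hn 3
    have h13' : (13 : ℂ) ∈ F := by exact_mod_cast hn 13
    exact add_mem (sub_mem (add_mem (neg_mem h13') (mul_mem (hs i) (mul_mem h5 h7)))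
      (mul_mem (hs j) (mul_mem h8 h13))) (mul_mem (hs (i + j)) (mul_mem (mul_mem h3 h7) h13))
  rintro z ((rfl | rfl | rfl | rfl) | (rfl | rfl | rfl | rfl))
  · exact_mod_cast hn 7
  · exact_mod_cast hn 13
  · exact neg_mem (one_mem F)
  · exact div_mem (add_mem (by exact_mod_cast hn 3) h13) (by exact_mod_cast hn 2)
  all_goals exact hnu _ _

lemma finite_sqrt_C : {z : ℂ | z ^ 2 ∈ C}.Finite := by
  have hC : C.Finite := by unfold C; exact Set.toFinite _
  have h : {z : ℂ | z ^ 2 ∈ C} = ⋃ c ∈ C, {z : ℂ | z ^ 2 = c} := by ext z; simp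
  rw [h]
  refine hC.biUnion fun c _ => ?_
  refine (Polynomial.nthRoots 2 c).toFinset.finite_toSet.subset fun z hz => ?_
  simpa [Polynomial.mem_nthRoots] using hz

instance : NumberField N' where
  to_charZero := inferInstance
  to_finiteDimensional := by
    have : Finite {z : ℂ | z ^ 2 ∈ C} := finite_sqrt_C
    refine IntermediateField.finiteDimensional_adjoin fun x hx => ?_
    exact (IsAlgebraic.of_pow (n := 2) (by norm_num)
      (isAlgebraic_of_mem_F (C_subset_F hx))).isIntegral

/-- `N'` as an extension of `F`, through the inclusion. -/
instance : Algebra F N' := (IntermediateField.inclusion F_le_N').toRingHom.toAlgebra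

end Example256

end

noncomputable section

/-! ### Quadratic residue symbols in Dedekind domains -/

/-! Write ω = (1 + √13)/2 and O = ℤ[ω, √7]; this is the ring of integers of F, and it is principal.
In F the numbers 7 and 13 are squares, and up to squares the other elements of C are six numbers
d_i: -1, the unit ε = 1 + ω, and the four conjugates of n₁ = ω² + 2√7, which generate the four
primes above 3. So N' = F(√d_0, …, √d_5), the group Gal(N'/F) embeds in {±1}⁶ by its action on the
√d_i, and the Frobenius at a prime v not dividing 6 acts on √d_i by the quadratic residue symbol
(d_i/v) (`Multiquadratic.sign_eq_leg`). The Artin map is therefore I ↦ ((d_i/I))_i, and everything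
about its kernel is a statement on these symbols. No class field theory is assumed.

The ray lies in the kernel (`ZB.jac_d_eq_one`): if γ is totally positive and γ ≡ 1 mod 6, then
(d_i/γ) = 1. Symbols of elements of ℤ[ω] modulo γ equal symbols modulo the relative norm of γ, so -1
and ε are settled in the Euclidean ring ℤ[ω]. For n₁, write γ = g(c + 2e√7); modulo c + 2e√7 one has
e·n₁ ≡ eω² - c, which again lies in ℤ[ω]. What remains follows from quadratic reciprocity in ℤ[ω]
(`ZW.recip`), which is itself deduced from reciprocity over ℤ by the same elimination: for x and β
primary, a combination qx - bβ is a rational integer. The sign terms are Hilbert symbols at the real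
places, matched by the Steinberg relation. The conjugates of n₁ follow by symmetry.

The kernel is no larger: as O is principal (Minkowski bound), an ideal prime to 6 comes from some γ
prime to 6. By `ZB.exists_isUnit_mul_prod` a unit times γ times a subproduct of six explicit primes
g_j lies in the ray. The 6 × 6 matrix of the symbols (d_i/g_j) is invertible over 𝔽₂, so a γ with
trivial symbols needs no g_j. The same matrix shows that Gal(N'/F) is all of {±1}⁶, whence [N' : ℚ]
= 4 · 64.

The discriminant comes from 𝔇⁴ = (72) for the different 𝔇 of N'/F (`differentIdeal_pow_four`). That
72 lies in 𝔇⁴ follows from `prod_mem_differentIdeal`, a version of "the different contains the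
differences θ - σθ" for towers, used with integers of N' adapted to the prime 2. For the reverse
inclusion, traces of multiples of √d_i are divisible by d_i when d_i lies above 3. At 2, an inertia
group of order at least 3 contains a nontrivial element fixing √n₁, which forces the divisibility of
the traces of y(√n₁ - (ω + 3 + √7)). Since disc F = 364², the fourth power of the root discriminant
is 72 · 364². The same membership gives unramifiedness outside 6. -/

lemma exists_pow_half_eq_mul {q : ℕ} (hq : Odd q) (f : ℕ) :
    ∃ S, q ^ f = 2 * (q / 2 * S) + 1 ∧ S % 2 = f % 2 := by
  obtain ⟨h, rfl⟩ := hq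
  have hh : (2 * h + 1) / 2 = h := by omega
  rw [hh]
  induction f with
  | zero => exact ⟨0, by simp, rfl⟩
  | succ f ih =>
    obtain ⟨S, h1, h2⟩ := ih
    refine ⟨S * (2 * h + 1) + 1, ?_, ?_⟩
    · rw [pow_succ, h1]; ring
    · have : S * (2 * h + 1) + 1 = 2 * (S * h) + S + 1 := by ring
      omega

/-- Euler's criterion in `l` uses the exponent (q^f - 1)/2 = (q - 1)/2 · S with S = 1 + q + ⋯ +
q^(f-1), and S ≡ f mod 2 because q is odd. In characteristic 2 every nonzero element is a square. -/
lemma quadraticChar_algebraMap (k l : Type*) [Field k] [Fintype k] [DecidableEq k]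
    [Field l] [Fintype l] [DecidableEq l] [Algebra k l] (a : k) :
    quadraticChar l (algebraMap k l a) = quadraticChar k a ^ Module.finrank k l := by
  have hf : Module.finrank k l ≠ 0 := Module.finrank_pos.ne'
  rcases eq_or_ne a 0 with rfl | ha
  · simp [hf]
  have ha' : algebraMap k l a ≠ 0 := by simpa using ha
  have hchar : ringChar l = ringChar k := by
    have := charP_of_injective_algebraMap (algebraMap k l).injective (ringChar k)
    exact (ringChar.eq l (ringChar k))
  by_cases h2 : ringChar k = 2
  · rw [quadraticChar_eq_one_of_char_two h2 ha,
      quadraticChar_eq_one_of_char_two (hchar.trans h2) ha', one_pow]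
  rcases quadraticChar_dichotomy ha with h | h
  · rw [h, one_pow]
    exact (quadraticChar_one_iff_isSquare ha').2
      (((quadraticChar_one_iff_isSquare ha).1 h).map (algebraMap k l))
  · rw [h]
    have hcard : Fintype.card l = Fintype.card k ^ Module.finrank k l := Module.card_eq_pow_finrank
    have hodd : Odd (Fintype.card k) := by
      rw [Nat.odd_iff]; exact FiniteField.odd_card_of_char_ne_two h2
    obtain ⟨S, hS1, hS2⟩ := exists_pow_half_eq_mul hodd (Module.finrank k l)
    have hl2 : ringChar l ≠ 2 := by rwa [hchar]
    have e1 := quadraticChar_eq_pow_of_char_ne_two' hl2 (algebraMap k l a)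
    have e2 := quadraticChar_eq_pow_of_char_ne_two' h2 a
    rw [h] at e2
    have : Fintype.card l / 2 = Fintype.card k / 2 * S := by rw [hcard, hS1]; omega
    rw [this, pow_mul, ← map_pow, ← e2] at e1
    simp only [Int.cast_neg, Int.cast_one, map_neg, map_one] at e1
    have hpar : ((-1 : l)) ^ S = ((-1 : ℤ) ^ Module.finrank k l : ℤ) := by
      push_cast
      rw [neg_one_pow_eq_pow_mod_two, hS2, ← neg_one_pow_eq_pow_mod_two]
    rw [hpar] at e1
    have hne : (-1 : l) ≠ 1 := Ring.neg_one_ne_one_of_char_ne_two hl2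
    rcases quadraticChar_dichotomy ha' with h' | h' <;>
    rcases neg_one_pow_eq_or ℤ (Module.finrank k l) with h'' | h'' <;>
    rw [h', h''] at e1 ⊢ <;> push_cast at e1
    · exact absurd e1.symm hne
    · exact absurd e1 hne

open Classical in
/-- The quadratic residue symbol modulo the ideal `P`. -/
def leg {R : Type*} [CommRing R] (P : Ideal R) (x : R) : ℤ :=
  if x ∈ P then 0 else if IsSquare (Ideal.Quotient.mk P x) then 1 else -1

section leg

variable {R : Type*} [CommRing R]

lemma leg_eq_leg {S : Type*} [CommRing S] {P : Ideal R} {Q : Ideal S} {x : R} {y : S}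
    (h1 : x ∈ P ↔ y ∈ Q)
    (h2 : IsSquare (Ideal.Quotient.mk P x) ↔ IsSquare (Ideal.Quotient.mk Q y)) :
    leg P x = leg Q y := by
  unfold leg
  split_ifs <;> tauto

lemma leg_congr {P : Ideal R} {x y : R} (h : x - y ∈ P) : leg P x = leg P y := by
  have h1 : x ∈ P ↔ y ∈ P := by
    constructor <;> intro h' 
    · simpa using sub_mem h' h
    · simpa using add_mem h h'
  exact leg_eq_leg h1 (by rw [Ideal.Quotient.eq.2 h])

attribute [local instance] Ideal.Quotient.field in
lemma leg_eq_quadraticChar (P : Ideal R) [P.IsMaximal] [Fintype (R ⧸ P)] [DecidableEq (R ⧸ P)]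
    (x : R) : leg P x = quadraticChar (R ⧸ P) (Ideal.Quotient.mk P x) := by
  have h := Ideal.Quotient.eq_zero_iff_mem (I := P) (a := x)
  rw [leg, quadraticChar_apply, quadraticCharFun]
  split_ifs <;> tauto

lemma leg_mul (P : Ideal R) [P.IsMaximal] [Finite (R ⧸ P)] (x y : R) :
    leg P (x * y) = leg P x * leg P y := by
  classical
  have := Fintype.ofFinite (R ⧸ P)
  let _ := Ideal.Quotient.field P
  simp only [leg_eq_quadraticChar, map_mul]

lemma leg_one (P : Ideal R) [P.IsMaximal] : leg P 1 = 1 := by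
  rw [leg, if_neg ((Ideal.ne_top_iff_one P).1 (Ideal.IsMaximal.ne_top ‹_›))]
  simp

lemma leg_sq_of_notMem {P : Ideal R} {x : R} (h : x ∉ P) : leg P x * leg P x = 1 := by
  rw [leg]; split_ifs <;> simp_all

/-- Euler's criterion. -/
lemma leg_euler (P : Ideal R) [P.IsMaximal] [Finite (R ⧸ P)] (h2 : (2 : R) ∉ P) (x : R) :
    (leg P x : R) - x ^ (Nat.card (R ⧸ P) / 2) ∈ P := by
  classical
  have := Fintype.ofFinite (R ⧸ P)
  let _ := Ideal.Quotient.field P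
  rw [leg_eq_quadraticChar, ← Ideal.Quotient.eq, map_pow, map_intCast, Nat.card_eq_fintype_card]
  refine quadraticChar_eq_pow_of_char_ne_two' (fun h => h2 ?_) _
  have := CharP.cast_eq_zero (R ⧸ P) (ringChar (R ⧸ P))
  rw [h] at this
  rw [← Ideal.Quotient.eq_zero_iff_mem, map_ofNat]
  simpa using this

lemma leg_map_ringEquiv {S : Type*} [CommRing S] (e : R ≃+* S) (P : Ideal R) (x : R) :
    leg (P.map e) (e x) = leg P x := by
  have h1 : e x ∈ P.map e ↔ x ∈ P := by
    rw [← Ideal.comap_symm, Ideal.mem_comap]; simp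
  have h2 : IsSquare (Ideal.Quotient.mk (P.map e) (e x)) ↔ IsSquare (Ideal.Quotient.mk P x) := by
    have h3 : Ideal.Quotient.mk (P.map e) (e x) =
        Ideal.quotientEquiv P (P.map e) e rfl (Ideal.Quotient.mk P x) := rfl
    rw [h3]
    constructor
    · intro h
      simpa using h.map (Ideal.quotientEquiv P (P.map e) e rfl).symm
    · intro h
      exact h.map (Ideal.quotientEquiv P (P.map e) e rfl)
  exact leg_eq_leg h1 h2

end leg

/-- The quadratic residue symbol `(x / I)`, multiplicative in the ideal `I`. -/
def jac {R : Type*} [CommRing R] [IsDedekindDomain R] (I : Ideal R) (x : R) : ℤ :=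
  ((UniqueFactorizationMonoid.normalizedFactors I).map (leg · x)).prod

section jac

variable {R : Type*} [CommRing R] [IsDedekindDomain R]

lemma jac_one (x : R) : jac 1 x = 1 := by
  rw [jac, UniqueFactorizationMonoid.normalizedFactors_one]; rfl

lemma jac_top (x : R) : jac ⊤ x = 1 := by rw [← Ideal.one_eq_top, jac_one]

lemma jac_of_isPrime {P : Ideal R} [P.IsPrime] (h : P ≠ ⊥) (x : R) : jac P x = leg P x := by
  rw [jac, UniqueFactorizationMonoid.normalizedFactors_irreducible
    ((Ideal.prime_iff_isPrime h).2 inferInstance).irreducible]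
  simp

lemma jac_mul_ideal {I J : Ideal R} (hI : I ≠ ⊥) (hJ : J ≠ ⊥) (x : R) :
    jac (I * J) x = jac I x * jac J x := by
  rw [jac, UniqueFactorizationMonoid.normalizedFactors_mul hI hJ]
  simp [jac]

lemma jac_induction {p : Ideal R → Prop} (h1 : p ⊤)
    (hmul : ∀ P I : Ideal R, P.IsMaximal → P ≠ ⊥ → I ≠ ⊥ → p I → p (P * I))
    {I : Ideal R} (hI : I ≠ ⊥) : p I := by
  induction I using UniqueFactorizationMonoid.induction_on_prime with
  | h₁ => exact absurd rfl hI
  | h₂ x hx => rw [Ideal.isUnit_iff.1 hx]; exact h1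
  | h₃ a q ha hq ih =>
    have hq' := hq.ne_zero
    exact hmul q a ((Ideal.isPrime_of_prime hq).isMaximal hq') hq' ha (ih ha)

lemma jac_congr {I : Ideal R} {x y : R} (h : x - y ∈ I) : jac I x = jac I y := by
  rcases eq_or_ne I ⊥ with rfl | hI
  · rw [Ideal.mem_bot, sub_eq_zero] at h; rw [h]
  unfold jac
  congr 1
  refine Multiset.map_congr rfl fun P hP => leg_congr ?_
  exact Ideal.dvd_iff_le.1 (UniqueFactorizationMonoid.dvd_of_mem_normalizedFactors hP) h

variable [Ring.HasFiniteQuotients R]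

lemma finite_quotient_of_mem {I P : Ideal R}
    (hP : P ∈ UniqueFactorizationMonoid.normalizedFactors I) : P.IsMaximal ∧ Finite (R ⧸ P) := by
  have h := UniqueFactorizationMonoid.prime_of_normalized_factor _ hP
  exact ⟨(Ideal.isPrime_of_prime h).isMaximal h.ne_zero,
    Ring.HasFiniteQuotients.finiteQuotient h.ne_zero⟩

lemma jac_mul (I : Ideal R) (x y : R) : jac I (x * y) = jac I x * jac I y := by
  unfold jac
  rw [← Multiset.prod_map_mul]
  congr 1
  refine Multiset.map_congr rfl fun P hP => ?_
  obtain ⟨h1, h2⟩ := finite_quotient_of_mem hP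
  exact leg_mul P x y

lemma jac_one_right (I : Ideal R) : jac I 1 = 1 := by
  unfold jac
  refine Multiset.prod_eq_one fun z hz => ?_
  obtain ⟨P, hP, rfl⟩ := Multiset.mem_map.1 hz
  obtain ⟨h1, h2⟩ := finite_quotient_of_mem hP
  exact leg_one P

lemma jac_pow (I : Ideal R) (x : R) (n : ℕ) : jac I (x ^ n) = jac I x ^ n := by
  induction n with
  | zero => simp [jac_one_right]
  | succ n ih => rw [pow_succ, jac_mul, ih, pow_succ]

lemma jac_mul_self {I : Ideal R} {x : R} (h : Ideal.span {x} ⊔ I = ⊤) :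
    jac I x * jac I x = 1 := by
  unfold jac
  rw [← Multiset.prod_map_mul]
  refine Multiset.prod_eq_one fun z hz => ?_
  obtain ⟨P, hP, rfl⟩ := Multiset.mem_map.1 hz
  refine leg_sq_of_notMem fun hx => ?_
  have h2 := Ideal.dvd_iff_le.1 (UniqueFactorizationMonoid.dvd_of_mem_normalizedFactors hP)
  have h3 : (⊤ : Ideal R) ≤ P := by
    rw [← h]; exact sup_le ((Ideal.span_singleton_le_iff_mem _).2 hx) h2
  exact (finite_quotient_of_mem hP).1.ne_top (top_le_iff.1 h3)

end jac

lemma jac_map_ringEquiv {R S : Type*} [CommRing R] [IsDedekindDomain R]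
    [CommRing S] [IsDedekindDomain S] (e : R ≃+* S) {I : Ideal R} (hI : I ≠ ⊥) (x : R) :
    jac (I.map e) (e x) = jac I x := by
  refine jac_induction (p := fun I => jac (I.map e) (e x) = jac I x) ?_ ?_ hI
  · rw [Ideal.map_top, jac_top, jac_top]
  · intro P I hP hP0 hI ih
    have hne : ∀ J : Ideal R, J ≠ ⊥ → J.map e ≠ ⊥ := fun J hJ h => hJ
      ((Ideal.map_eq_bot_iff_of_injective e.injective).1 h)
    have : (P.map e).IsPrime := Ideal.map_isPrime_of_equiv e
    rw [Ideal.map_mul, jac_mul_ideal (hne P hP0) (hne I hI), ih, jac_mul_ideal hP0 hI,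
      jac_of_isPrime (hne P hP0), jac_of_isPrime hP0, leg_map_ringEquiv]

lemma leg_span_natCast {p : ℕ} [Fact p.Prime] (r : ℤ) :
    leg (Ideal.span {(p : ℤ)}) r = legendreSym p r := by
  have h1 : r ∈ Ideal.span {(p : ℤ)} ↔ (r : ZMod p) = 0 := by
    rw [Ideal.mem_span_singleton, ZMod.intCast_zmod_eq_zero_iff_dvd]
  have h2 : IsSquare (Ideal.Quotient.mk (Ideal.span {(p : ℤ)}) r) ↔ IsSquare (r : ZMod p) := by
    have h3 : Int.quotientSpanNatEquivZMod p (Ideal.Quotient.mk (Ideal.span {(p : ℤ)}) r)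
      = (r : ZMod p) := by simp
    rw [← h3]
    exact ⟨fun h => h.map _, fun h => by
      simpa using h.map (Int.quotientSpanNatEquivZMod p).symm⟩
  rw [leg, legendreSym, quadraticChar_apply, quadraticCharFun]
  split_ifs <;> tauto

lemma jac_int_natCast (r : ℤ) {n : ℕ} (hn : n ≠ 0) :
    jac (Ideal.span {(n : ℤ)}) r = jacobiSym r n := by
  induction n using Nat.recOnMul with
  | zero => exact absurd rfl hn
  | one => simp [jac_top]
  | prime p hp =>
    have := Fact.mk hp
    have hpr : (Ideal.span {(p : ℤ)}).IsPrime :=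
      (Ideal.span_singleton_prime (by exact_mod_cast hp.ne_zero)).2 (Nat.prime_iff_prime_int.1 hp)
    rw [jac_of_isPrime (by simpa using hp.ne_zero), leg_span_natCast, jacobiSym.legendreSym.to_jacobiSym]
  | mul a b iha ihb =>
    obtain ⟨ha, hb⟩ := mul_ne_zero_iff.1 hn
    rw [jacobiSym.mul_right' r ha hb, ← iha ha, ← ihb hb, Nat.cast_mul,
      ← Ideal.span_singleton_mul_span_singleton, jac_mul_ideal] <;> simpa

lemma jac_int (r : ℤ) {n : ℤ} (hn : n ≠ 0) :
    jac (Ideal.span {n}) r = jacobiSym r n.natAbs := by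
  rw [← jac_int_natCast r (Int.natAbs_ne_zero.2 hn), Int.span_natAbs]

set_option linter.unusedSectionVars false

/-! ### Symbols of elements of the base ring -/

section tower

variable {R S : Type*} [CommRing R] [IsDedekindDomain R] [CommRing S] [IsDedekindDomain S]
  [Algebra R S] [Module.Finite R S] [Module.IsTorsionFree R S] [CharZero R]
  [Ring.HasFiniteQuotients R] [Ring.HasFiniteQuotients S]

lemma under_ne_bot {P : Ideal S} (h : P ≠ ⊥) : P.under R ≠ ⊥ :=
  mt Ideal.eq_bot_of_comap_eq_bot h

lemma leg_algebraMap (P : Ideal S) [P.IsMaximal] (hP : P ≠ ⊥) [(P.under R).IsMaximal]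
    [Finite (R ⧸ P.under R)] (r : R) :
    leg P (algebraMap R S r) = leg (P.under R) r ^ P.inertiaDeg R := by
  classical
  have := Ring.HasFiniteQuotients.finiteQuotient hP
  have := Fintype.ofFinite (S ⧸ P)
  have := Fintype.ofFinite (R ⧸ P.under R)
  let _ := Ideal.Quotient.field P
  let _ := Ideal.Quotient.field (P.under R)
  rw [leg_eq_quadraticChar, leg_eq_quadraticChar, Ideal.inertiaDeg_eq_of_isMaximal (P.under R),
    ← quadraticChar_algebraMap]
  rfl

/-- A prime above `p` with inertia degree f has relative norm `p ^ f`, and the symbol of an element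
of `R` modulo it is the f-th power of the symbol modulo `p`. This moves computations down to the
smaller ring. -/
lemma jac_algebraMap {I : Ideal S} (hI : I ≠ ⊥) (r : R) :
    jac I (algebraMap R S r) = jac (Ideal.relNorm R I) r := by
  refine jac_induction (p := fun I => jac I (algebraMap R S r) = jac (Ideal.relNorm R I) r)
    ?_ ?_ hI
  · rw [jac_top, Ideal.relNorm_top, jac_top]
  · intro P I hP hP0 hI ih
    have hp0 : P.under R ≠ ⊥ := under_ne_bot hP0
    have : (P.under R).IsMaximal := Ideal.IsPrime.isMaximal inferInstance hp0
    have := Ring.HasFiniteQuotients.finiteQuotient hp0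
    have hN : ∀ J : Ideal S, J ≠ ⊥ → Ideal.relNorm R J ≠ ⊥ := fun J hJ h =>
      hJ (Ideal.relNorm_eq_bot_iff.1 h)
    have hpow : ∀ n, jac (P.under R ^ n) r = leg (P.under R) r ^ n := by
      intro n
      induction n with
      | zero => rw [pow_zero, pow_zero, jac_one]
      | succ n ih =>
        rw [pow_succ, jac_mul_ideal (pow_ne_zero _ hp0) hp0, ih, jac_of_isPrime hp0, pow_succ]
    rw [jac_mul_ideal hP0 hI, ih, map_mul, jac_mul_ideal (hN P hP0) (hN I hI), jac_of_isPrime hP0,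
      leg_algebraMap P hP0, Ideal.relNorm_eq_pow_of_isMaximal P (P.under R), hpow]

end tower

/-! ### Symbols modulo ideals of the base ring in a quadratic extension -/

section quadratic

variable {R : Type*} [CommRing R] [IsDedekindDomain R] {a b : R}
  [CharZero R] [Ring.HasFiniteQuotients R]

open QuadraticAlgebra

lemma intNorm_quadraticAlgebra [IsDedekindDomain (QuadraticAlgebra R a b)]
    (x : QuadraticAlgebra R a b) :
    Algebra.intNorm R (QuadraticAlgebra R a b) x = x.norm := by
  rw [Algebra.intNorm_eq_norm, Algebra.norm_apply, ← det_toLinearMap_eq_norm]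
  rfl

/-- Conjugation, as a ring automorphism. -/
def conjEquiv (R : Type*) [CommRing R] (a b : R) :
    QuadraticAlgebra R a b ≃+* QuadraticAlgebra R a b :=
  RingEquiv.ofRingHom (starRingEnd _) (starRingEnd _) (by ext x <;> simp) (by ext x <;> simp)

lemma conjEquiv_apply (x : QuadraticAlgebra R a b) : conjEquiv R a b x = star x := rfl

variable [IsDedekindDomain (QuadraticAlgebra R a b)]
  [Ring.HasFiniteQuotients (QuadraticAlgebra R a b)]

lemma leg_of_two_mem {S : Type*} [CommRing S] (P : Ideal S) [P.IsMaximal] [Finite (S ⧸ P)]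
    (h2 : (2 : S) ∈ P) {x : S} (hx : x ∉ P) : leg P x = 1 := by
  classical
  have := Fintype.ofFinite (S ⧸ P)
  let _ := Ideal.Quotient.field P
  rw [leg_eq_quadraticChar]
  refine quadraticChar_eq_one_of_char_two ?_ (by rwa [Ne, Ideal.Quotient.eq_zero_iff_mem])
  have h : ((2 : ℕ) : S ⧸ P) = 0 := by
    rw [← Ideal.Quotient.eq_zero_iff_mem, map_ofNat] at h2; exact_mod_cast h2
  exact (CharP.ringChar_of_prime_eq_zero Nat.prime_two h)

lemma eq_of_int_sub_mem {S : Type*} [CommRing S] {P : Ideal S} [P.IsPrime] (h2 : (2 : S) ∉ P)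
    {u v : ℤ} (hu : u = 1 ∨ u = -1) (hv : v = 1 ∨ v = -1) (h : (u : S) - v ∈ P) : u = v := by
  rcases hu with rfl | rfl <;> rcases hv with rfl | rfl <;> simp at h ⊢
  · apply h2; norm_num at h; exact h
  · apply h2
    have := neg_mem h
    norm_num at this; exact this

lemma leg_eq_one_or {S : Type*} [CommRing S] {P : Ideal S} {x : S} (h : x ∉ P) :
    leg P x = 1 ∨ leg P x = -1 := by
  have := leg_sq_of_notMem h
  exact mul_self_eq_one_iff.1 this

/-- Powers in an inert residue field: the Frobenius is induced by the conjugation. -/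
lemma pow_card_sub_star_mem (p : Ideal R) [p.IsMaximal] [Finite (R ⧸ p)]
    (P : Ideal (QuadraticAlgebra R a b)) [P.IsMaximal] [Finite (QuadraticAlgebra R a b ⧸ P)]
    [P.LiesOver p] (hf : P.inertiaDeg R = 2) (x : QuadraticAlgebra R a b) :
    x ^ Nat.card (R ⧸ p) - star x ∈ P := by
  classical
  have := Fintype.ofFinite (QuadraticAlgebra R a b ⧸ P)
  have := Fintype.ofFinite (R ⧸ p)
  let _ := Ideal.Quotient.field P
  let _ := Ideal.Quotient.field p
  rw [Ideal.inertiaDeg_eq_of_isMaximal p] at hf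
  set fr := FiniteField.frobeniusAlgHom (R ⧸ p) (QuadraticAlgebra R a b ⧸ P) with hfr
  have hfr' : ∀ y, fr y = y ^ Nat.card (R ⧸ p) := fun y => by
    rw [hfr, Nat.card_eq_fintype_card]; rfl
  have hdec : ∀ y : QuadraticAlgebra R a b, y = algebraMap R _ y.re + algebraMap R _ y.im * ω := by
    intro y; ext <;> simp [algebraMap_eq]
  have hR : ∀ r : R, fr (Ideal.Quotient.mk P (algebraMap R _ r)) =
      Ideal.Quotient.mk P (algebraMap R _ r) := fun r => fr.commutes (Ideal.Quotient.mk p r)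
  -- Frobenius fixes the image of `R`, so it permutes the roots of X² - bX - a.
  have hom : fr (Ideal.Quotient.mk P ω) = Ideal.Quotient.mk P ω ∨
      fr (Ideal.Quotient.mk P ω) = Ideal.Quotient.mk P (star ω) := by
    have h1 : (ω : QuadraticAlgebra R a b) * ω = algebraMap R _ a + algebraMap R _ b * ω := by
      ext <;> simp [algebraMap_eq]
    have h2 := congrArg (fun y => fr (Ideal.Quotient.mk P y)) h1
    simp only [map_mul, map_add, hR] at h2
    have h3 := congrArg (Ideal.Quotient.mk P) h1
    simp only [map_mul, map_add] at h3
    have h4 : (star ω : QuadraticAlgebra R a b) = algebraMap R _ b - ω := by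
      ext <;> simp [algebraMap_eq]
    have h5 : (fr (Ideal.Quotient.mk P ω) - Ideal.Quotient.mk P ω) *
        (fr (Ideal.Quotient.mk P ω) - Ideal.Quotient.mk P (star ω)) = 0 := by
      rw [h4, map_sub]
      linear_combination h2 - h3
    rcases mul_eq_zero.1 h5 with h | h
    · exact Or.inl (sub_eq_zero.1 h)
    · exact Or.inr (sub_eq_zero.1 h)
  rcases hom with h | h
  -- Fixing ω would make Frobenius trivial, but its order is the inertia degree 2.
  · exfalso
    have h1 : fr = 1 := by
      ext y
      obtain ⟨y, rfl⟩ := Ideal.Quotient.mk_surjective y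
      rw [hdec y, map_add, map_mul, map_add, map_mul, hR, hR, h]
      rfl
    have h2 := FiniteField.orderOf_frobeniusAlgHom (R ⧸ p) (QuadraticAlgebra R a b ⧸ P)
    rw [← hfr, h1, orderOf_one, hf] at h2
    omega
  · rw [← Ideal.Quotient.eq, map_pow, ← hfr', hdec x, map_add, map_mul, map_add, map_mul, hR, hR, h,
      ← map_mul, ← map_add]
    congr 1
    ext <;> simp [algebraMap_eq]

lemma mem_map_conj {P : Ideal (QuadraticAlgebra R a b)} {x : QuadraticAlgebra R a b} :
    x ∈ P.map (conjEquiv R a b) ↔ star x ∈ P := by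
  rw [← Ideal.comap_symm, Ideal.mem_comap]; rfl

lemma mul_star_mem {P : Ideal (QuadraticAlgebra R a b)} {x : QuadraticAlgebra R a b} :
    x.norm ∈ P.under R ↔ x * star x ∈ P := by
  rw [← algebraMap_norm_eq_mul_star]; rfl

/-- If `p` is inert, Frobenius is conjugation and Euler's criterion turns `x` into x^(q+1) = N x.
Otherwise `p` becomes a product of a degree one prime and its conjugate (possibly equal), and the
symbol of `x` at the conjugate prime is that of the conjugate of `x` at the first one. -/
lemma jac_map_algebraMap (p : Ideal R) [p.IsMaximal] (hp : p ≠ ⊥) (x : QuadraticAlgebra R a b)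
    (hx : x.norm ∉ p) :
    jac (p.map (algebraMap R (QuadraticAlgebra R a b))) x = leg p x.norm := by
  set J := p.map (algebraMap R (QuadraticAlgebra R a b)) with hJ
  have hJ0 : J ≠ ⊥ := fun h => hp
    ((Ideal.map_eq_bot_iff_of_injective (FaithfulSMul.algebraMap_injective R _)).1 h)
  have hNJ : Ideal.relNorm R J = p ^ 2 := by rw [hJ, Ideal.relNorm_algebraMap, finrank_eq_two]
  have hp1 : p ≠ ⊤ := Ideal.IsMaximal.ne_top inferInstance
  have hq := Ring.HasFiniteQuotients.finiteQuotient hp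
  have hover : ∀ Q : Ideal (QuadraticAlgebra R a b), Q.IsPrime → J ≤ Q → Q.under R = p :=
    fun Q hQ h => ((‹p.IsMaximal›).eq_of_le (Ideal.IsPrime.ne_top inferInstance)
      (Ideal.map_le_iff_le_comap.1 h)).symm
  have hNtop : ∀ I : Ideal (QuadraticAlgebra R a b), Ideal.relNorm R I = ⊤ → I = ⊤ := by
    intro I hI
    rw [Ideal.eq_top_iff_one]
    have h1 := Ideal.relNorm_le_comap R I
    rw [hI] at h1
    simpa using h1 (Submodule.mem_top : (1 : R) ∈ _)
  have hfac : ∀ I : Ideal (QuadraticAlgebra R a b), I ≠ ⊥ → I ≠ ⊤ →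
      ∃ Q I', Q.IsMaximal ∧ Q ≠ ⊥ ∧ I' ≠ ⊥ ∧ I = Q * I' := by
    intro I h0 h1
    obtain ⟨Q, hQ, hIQ⟩ := Ideal.exists_le_maximal I h1
    obtain ⟨I', rfl⟩ := Ideal.dvd_iff_le.2 hIQ
    obtain ⟨h2, h3⟩ := mul_ne_zero_iff.1 h0
    exact ⟨Q, I', hQ, h2, h3, rfl⟩
  have hpinj : ∀ {m n : ℕ}, p ^ m = p ^ n → m = n := fun {m n} h =>
    (IsLeftCancelMulZero.mul_left_cancel_of_ne_zero hp).pow_injective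
      (by rwa [Ideal.one_eq_top]) h
  have hJ1 : J ≠ ⊤ := by
    intro h
    rw [h, Ideal.relNorm_top, ← Ideal.one_eq_top, ← pow_zero p] at hNJ
    exact absurd (hpinj hNJ) (by norm_num)
  obtain ⟨Q, I, hQ, hQ0, hI0, hJQ⟩ := hfac J hJ0 hJ1
  have hQp : Q.under R = p := hover Q hQ.isPrime (hJQ ▸ Ideal.mul_le_left)
  have hLO : Q.LiesOver p := ⟨hQp.symm⟩
  have hNQ := Ideal.relNorm_eq_pow_of_isMaximal (R := R) Q p
  have hxQ : x ∉ Q := fun h => hx (hQp ▸ mul_star_mem.2 (Ideal.mul_mem_right _ _ h))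
  have hxQ' : star x ∉ Q := fun h => hx (hQp ▸ mul_star_mem.2 (Ideal.mul_mem_left _ _ h))
  have hqQ := Ring.HasFiniteQuotients.finiteQuotient hQ0
  by_cases hI1 : I = ⊤
  -- The inert case; residue characteristic 2 is separate, since there all symbols of elements
  -- outside the prime are 1.
  · have hJQ' : J = Q := by rw [hJQ, hI1, Ideal.mul_top]
    rw [hJQ'] at hNJ ⊢
    rw [jac_of_isPrime hQ0]
    have hf : Q.inertiaDeg R = 2 := hpinj (hNQ ▸ hNJ)
    by_cases h2 : (2 : QuadraticAlgebra R a b) ∈ Q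
    · rw [leg_of_two_mem Q h2 hxQ, leg_of_two_mem p _ hx]
      rw [← hQp, Ideal.under_def, Ideal.mem_comap, map_ofNat]; exact h2
    · have h2p : (2 : R) ∉ p := by
        intro h; rw [← hQp, Ideal.under_def, Ideal.mem_comap, map_ofNat] at h; exact h2 h
      refine eq_of_int_sub_mem h2 (leg_eq_one_or hxQ) (leg_eq_one_or hx) ?_
      have e1 := leg_euler Q h2 x
      have e2 := leg_euler p h2p x.norm
      have e3 := pow_card_sub_star_mem p Q hf x
      have hc : Nat.card (QuadraticAlgebra R a b ⧸ Q) = Nat.card (R ⧸ p) ^ 2 := by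
        rw [← hf]; exact (Ideal.cardQuot_pow_inertiaDeg p Q).symm
      have hmem : ∀ r, r ∈ p ↔ algebraMap R (QuadraticAlgebra R a b) r ∈ Q := by
        intro r; rw [← hQp]; rfl
      rw [hmem, map_sub, map_pow, algebraMap_norm_eq_mul_star, map_intCast] at e2
      have hodd : Nat.card (R ⧸ p) % 2 = 1 := by
        have := Fintype.ofFinite (R ⧸ p)
        let _ := Ideal.Quotient.field p
        rw [Nat.card_eq_fintype_card]
        refine FiniteField.odd_card_of_char_ne_two fun h => h2p ?_
        have := CharP.cast_eq_zero (R ⧸ p) (ringChar (R ⧸ p))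
        rw [h] at this
        rw [← Ideal.Quotient.eq_zero_iff_mem, map_ofNat]
        simpa using this
      -- (q² - 1)/2 = (q + 1)(q - 1)/2, with natural division since q is odd.
      have hhalf : Nat.card (R ⧸ p) ^ 2 / 2 = (Nat.card (R ⧸ p) + 1) * (Nat.card (R ⧸ p) / 2) := by
        obtain ⟨h, hh⟩ : ∃ h, Nat.card (R ⧸ p) = 2 * h + 1 := ⟨_, (by omega :
          Nat.card (R ⧸ p) = 2 * (Nat.card (R ⧸ p) / 2) + 1)⟩
        rw [hh]
        have : (2 * h + 1) ^ 2 = 2 * (2 * h * h + 2 * h) + 1 := by ring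
        have h3 : (2 * h + 1) / 2 = h := by omega
        rw [this, h3]
        have h4 : (2 * h + 1 + 1) * h = 2 * h * h + 2 * h := by ring
        omega
      rw [hc, hhalf, pow_mul] at e1
      rw [← Ideal.Quotient.eq, map_pow, pow_succ] at e1
      rw [← Ideal.Quotient.eq] at e2 e3 ⊢
      rw [e1, e2, map_pow, map_mul, map_mul, e3, mul_comm]
  · obtain ⟨Q', I', hQ', hQ'0, hI'0, hIQ⟩ := hfac I hI0 hI1
    have hQ'p : Q'.under R = p := hover Q' hQ'.isPrime
      (by rw [hJQ, hIQ]; exact Ideal.mul_le_right.trans Ideal.mul_le_left)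
    have hLO' : Q'.LiesOver p := ⟨hQ'p.symm⟩
    have hNQ' := Ideal.relNorm_eq_pow_of_isMaximal (R := R) Q' p
    have f1 := Ideal.inertiaDeg_pos (R := R) Q
    have f2 := Ideal.inertiaDeg_pos (R := R) Q'
    rw [hJQ, hIQ, map_mul, map_mul, hNQ, hNQ', ← mul_assoc, ← pow_add] at hNJ
    have hle : Q.inertiaDeg R + Q'.inertiaDeg R = 2 := by
      have h1 : p ^ (Q.inertiaDeg R + Q'.inertiaDeg R) ∣ p ^ 2 := ⟨_, hNJ.symm⟩
      have := (pow_dvd_pow_iff hp (by rw [Ideal.isUnit_iff]; exact hp1)).1 h1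
      omega
    have hI'1 : I' = ⊤ := by
      refine hNtop I' ?_
      rw [hle] at hNJ
      exact mul_left_cancel₀ (pow_ne_zero 2 hp) (hNJ.trans (Ideal.mul_top _).symm)
    have hJQQ : J = Q * Q' := by rw [hJQ, hIQ, hI'1, Ideal.mul_top]
    set σ := conjEquiv R a b with hσ
    have hσσ : ∀ P : Ideal (QuadraticAlgebra R a b), (P.map σ).map σ = P := by
      intro P; ext y; rw [mem_map_conj, mem_map_conj, star_star]
    have hσle : J.map σ ≤ J := by
      refine Ideal.map_le_iff_le_comap.2 (Ideal.map_le_iff_le_comap.2 fun r hr => ?_)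
      have h1 : σ (algebraMap R _ r) = algebraMap R _ r := by
        rw [hσ, conjEquiv_apply]; ext <;> simp [algebraMap_eq]
      rw [Ideal.mem_comap, Ideal.mem_comap, h1]
      exact Ideal.mem_map_of_mem _ hr
    have hσJ : J.map σ = J := le_antisymm hσle ((hσσ J).ge.trans (Ideal.map_mono hσle))
    have hQpr : Prime Q := (Ideal.prime_iff_isPrime hQ0).2 hQ.isPrime
    have hQ'pr : Prime Q' := (Ideal.prime_iff_isPrime hQ'0).2 hQ'.isPrime
    have hσQ : (Q.map σ).IsMaximal := Ideal.map_isMaximal_of_equiv σ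
    have hσQ' : (Q'.map σ).IsMaximal := Ideal.map_isMaximal_of_equiv σ
    -- The product Q Q' is stable under conjugation, so Q is the conjugate of Q or of Q'. In the
    -- former case any y in Q has its norm in `p`, hence y or its conjugate in Q', and Q' is stable
    -- too; so Q = Q'.
    have hconj : Q' = Q.map σ := by
      have h1 : Q * Q' = Q.map σ * Q'.map σ := by rw [← Ideal.map_mul, ← hJQQ, hσJ]
      have h2 : Q ∣ Q.map σ * Q'.map σ := ⟨_, h1.symm⟩
      rcases hQpr.dvd_or_dvd h2 with h3 | h3
      · have h4 : Q.map σ = Q := hσQ.eq_of_le hQ.ne_top (Ideal.dvd_iff_le.1 h3)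
        rw [h4] at h1
        have h5 : Q' = Q'.map σ := mul_left_cancel₀ hQ0 h1
        rw [h4]
        refine (hQ.eq_of_le hQ'.ne_top fun y hy => ?_).symm
        have h6 : y * star y ∈ Q' := by
          rw [← mul_star_mem, hQ'p, ← hQp, mul_star_mem]
          exact Ideal.mul_mem_right _ _ hy
        rcases hQ'.isPrime.mem_or_mem h6 with h7 | h7
        · exact h7
        · rw [h5, mem_map_conj]; exact h7
      · have h4 : Q'.map σ = Q := hσQ'.eq_of_le hQ.ne_top (Ideal.dvd_iff_le.1 h3)
        rw [← h4, hσσ]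
    have hf1 : Q.inertiaDeg R = 1 := by omega
    rw [hJQQ, jac_mul_ideal hQ0 hQ'0, jac_of_isPrime hQ0, jac_of_isPrime hQ'0, hconj]
    have h1 : leg (Q.map σ) x = leg Q (star x) := by
      rw [← leg_map_ringEquiv σ Q (star x), hσ, conjEquiv_apply, star_star]
    have hmx : (Q.under R).IsMaximal := by rw [hQp]; infer_instance
    have hfq : Finite (R ⧸ Q.under R) := by rw [hQp]; infer_instance
    rw [h1, ← leg_mul, ← algebraMap_norm_eq_mul_star, leg_algebraMap Q hQ0, hf1, pow_one, hQp]

/-- The symbol modulo an ideal of the base ring. -/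
lemma jac_map_of_isCoprime {I : Ideal R} (hI : I ≠ ⊥) (x : QuadraticAlgebra R a b)
    (hx : Ideal.span {x.norm} ⊔ I = ⊤) :
    jac (I.map (algebraMap R (QuadraticAlgebra R a b))) x = jac I x.norm := by
  have hinj := FaithfulSMul.algebraMap_injective R (QuadraticAlgebra R a b)
  have hne : ∀ J : Ideal R, J ≠ ⊥ → J.map (algebraMap R (QuadraticAlgebra R a b)) ≠ ⊥ :=
    fun J hJ h => hJ ((Ideal.map_eq_bot_iff_of_injective hinj).1 h)
  revert hx
  refine jac_induction (p := fun I => Ideal.span {x.norm} ⊔ I = ⊤ →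
    jac (I.map (algebraMap R (QuadraticAlgebra R a b))) x = jac I x.norm) ?_ ?_ hI
  · intro _; rw [Ideal.map_top, jac_top, jac_top]
  · intro P I hP hP0 hI ih hx
    have h1 : Ideal.span {x.norm} ⊔ I = ⊤ :=
      top_le_iff.1 (hx ▸ sup_le_sup_left Ideal.mul_le_right _)
    have h2 : x.norm ∉ P := fun h => hP.ne_top <| top_le_iff.1 (hx ▸
      sup_le ((Ideal.span_singleton_le_iff_mem _).2 h) Ideal.mul_le_left)
    rw [Ideal.map_mul, jac_mul_ideal (hne P hP0) (hne I hI), ih h1, jac_mul_ideal hP0 hI,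
      jac_map_algebraMap P hP0 x h2, jac_of_isPrime hP0]

end quadratic

set_option linter.unusedSectionVars false

/-! ### The Hilbert symbol at a real place -/

open Classical in
/-- The Hilbert symbol of two nonzero real numbers. -/
def hs (x y : ℝ) : ℤ := if x < 0 ∧ y < 0 then -1 else 1

lemma hs_of_pos_left {x : ℝ} (y : ℝ) (h : 0 < x) : hs x y = 1 := by
  rw [hs, if_neg]; rintro ⟨h1, -⟩; linarith

lemma hs_of_pos_right (x : ℝ) {y : ℝ} (h : 0 < y) : hs x y = 1 := by
  rw [hs, if_neg]; rintro ⟨-, h1⟩; linarith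

lemma hs_of_neg {x y : ℝ} (hx : x < 0) (hy : y < 0) : hs x y = -1 := by
  rw [hs, if_pos ⟨hx, hy⟩]

lemma hs_comm (x y : ℝ) : hs x y = hs y x := by simp only [hs, and_comm]

lemma hs_mul_self (x y : ℝ) : hs x y * hs x y = 1 := by
  rw [hs]; split_ifs <;> rfl

lemma hs_mul_left {x x' : ℝ} (hx : x ≠ 0) (hx' : x' ≠ 0) (y : ℝ) :
    hs (x * x') y = hs x y * hs x' y := by
  rcases lt_or_ge y 0 with hy | hy
  · rcases lt_or_gt_of_ne hx with h | h <;> rcases lt_or_gt_of_ne hx' with h' | h'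
    · rw [hs_of_pos_left _ (mul_pos_of_neg_of_neg h h'), hs_of_neg h hy, hs_of_neg h' hy]; rfl
    · rw [hs_of_neg (mul_neg_of_neg_of_pos h h') hy, hs_of_neg h hy, hs_of_pos_left _ h']; rfl
    · rw [hs_of_neg (mul_neg_of_pos_of_neg h h') hy, hs_of_neg h' hy, hs_of_pos_left _ h]; rfl
    · rw [hs_of_pos_left _ (mul_pos h h'), hs_of_pos_left _ h, hs_of_pos_left _ h']; rfl
  · have : ∀ z, hs z y = 1 := fun z => by
      rw [hs, if_neg]; rintro ⟨-, h1⟩; linarith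
    simp [this]

lemma hs_mul_right {y y' : ℝ} (hy : y ≠ 0) (hy' : y' ≠ 0) (x : ℝ) :
    hs x (y * y') = hs x y * hs x y' := by
  rw [hs_comm, hs_mul_left hy hy', hs_comm, hs_comm y']

lemma hs_neg_one_neg_one : hs (-1) (-1) = -1 := hs_of_neg (by norm_num) (by norm_num)

/-- Dividing by n gives qx/n + (-b)y/n = 1, and two reals with sum 1 are not both negative. So the
symbol of qnx and -bny is 1; the rest is bimultiplicativity. -/
lemma hs_steinberg {q b n x y : ℝ} (hq : q ≠ 0) (hb : b ≠ 0) (hn : n ≠ 0) (hx : x ≠ 0)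
    (hy : y ≠ 0) (h : q * x - b * y = n) :
    hs x y = hs q y * hs (-b) x * hs n x * hs n y * (hs (q * n) (-b * n)) := by
  have h1 : hs (q * n * x) (-b * n * y) = 1 := by
    rw [hs, if_neg]
    rintro ⟨h1, h2⟩
    have : n * n = q * n * x + -b * n * y := by rw [← h]; ring
    nlinarith [mul_self_nonneg n]
  have hb' : -b ≠ 0 := neg_ne_zero.2 hb
  rw [hs_mul_left (mul_ne_zero hq hn) hx, hs_mul_right (mul_ne_zero hb' hn) hy,
    hs_mul_right (mul_ne_zero hb' hn) hy, hs_mul_left hq hn y, hs_mul_right hb' hn x] at h1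
  rw [hs_comm (-b) x, hs_comm n x]
  generalize hs (q * n) (-b * n) = K at *
  have e1 := hs_mul_self x y
  generalize hs x y = u at *
  rcases mul_self_eq_one_iff.1 e1 with rfl | rfl <;> linarith

/-! ### Jacobi symbols -/

open NumberTheorySymbols

/-- For M ≡ 1 mod 4 the sign in quadratic reciprocity disappears once |M| serves as modulus and the
signed M as argument. -/
lemma jacobiSym_natAbs_recip {M : ℤ} (hM : M % 4 = 1) {m : ℕ} (hm : Odd m) :
    J((m : ℤ) | M.natAbs) = J(M | m) := by
  rcases lt_or_ge M 0 with h | h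
  · have hb : (M.natAbs : ℤ) = -M := by omega
    have hb3 : M.natAbs % 4 = 3 := by omega
    have h1 : J(M | m) = ZMod.χ₄ m * J((M.natAbs : ℤ) | m) := by
      rw [← jacobiSym.neg _ hm, hb, neg_neg]
    rw [h1]
    rcases Nat.odd_mod_four_iff.1 (Nat.odd_iff.1 hm) with h4 | h4
    · rw [ZMod.χ₄_nat_one_mod_four h4, one_mul]
      exact jacobiSym.quadratic_reciprocity_one_mod_four h4 (by rw [Nat.odd_iff]; omega)
    · rw [ZMod.χ₄_nat_three_mod_four h4, neg_one_mul]
      exact jacobiSym.quadratic_reciprocity_three_mod_four h4 hb3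
  · have hb : (M.natAbs : ℤ) = M := by omega
    rw [jacobiSym.quadratic_reciprocity_one_mod_four' hm (by omega), hb]

lemma jacobiSym_neg_one_natAbs {M : ℤ} (hM : M % 4 = 1) : J(-1 | M.natAbs) = hs (-1) M := by
  rw [jacobiSym.at_neg_one (by rw [Nat.odd_iff]; omega)]
  rcases lt_or_ge M 0 with h | h
  · rw [ZMod.χ₄_nat_three_mod_four (by omega), hs_of_neg (by norm_num) (by exact_mod_cast h)]
  · rw [ZMod.χ₄_nat_one_mod_four (by omega), hs_of_pos_right _ (by
      have : 0 < M := by omega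
      exact_mod_cast this)]

lemma jacobiSym_two_natAbs {M : ℤ} (hM : M % 8 = 1) : J(2 | M.natAbs) = 1 := by
  rw [jacobiSym.at_two (by rw [Nat.odd_iff]; omega), ZMod.χ₈_nat_eq_if_mod_eight]
  have : M.natAbs % 8 = 1 ∨ M.natAbs % 8 = 7 := by omega
  rw [if_neg (by omega), if_pos this]

lemma jacobiSym_two_natAbs' {M : ℤ} (hM : M % 8 = 5) : J(2 | M.natAbs) = -1 := by
  rw [jacobiSym.at_two (by rw [Nat.odd_iff]; omega), ZMod.χ₈_nat_eq_if_mod_eight]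
  have : ¬ (M.natAbs % 8 = 1 ∨ M.natAbs % 8 = 7) := by omega
  rw [if_neg (by omega), if_neg this]

lemma gcd_natAbs_eq_one {r M : ℤ} (h : IsCoprime r M) : r.gcd M.natAbs = 1 := by
  have := Int.isCoprime_iff_gcd_eq_one.1 h
  rwa [Int.gcd, Int.natAbs_natCast]

lemma jacobiSym_natAbs_mul_self {r M : ℤ} (h : IsCoprime r M) :
    J(r | M.natAbs) * J(r | M.natAbs) = 1 := by
  rw [← sq]; exact jacobiSym.sq_one (gcd_natAbs_eq_one h)

lemma jacobiSym_eq_of_dvd {x y : ℤ} {n : ℕ} (h : (n : ℤ) ∣ x - y) : J(x | n) = J(y | n) :=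
  jacobiSym.mod_left' (Int.ModEq.symm (Int.modEq_iff_dvd.2 h))

/-- M is a square modulo the odd part of r, so reciprocity makes that part contribute 1; a factor 2
contributes 1 because then M ≡ 1 mod 8. Only the sign of r remains, and it gives the real Hilbert
symbol. -/
lemma jacobiSym_of_sq {r M u t : ℤ} (hM : M % 4 = 1) (hr : r ≠ 0) (hc : IsCoprime r M)
    (h2 : r % 2 = 0 → M % 8 = 1) (hd : r ∣ M * u ^ 2 - t ^ 2) (hu : IsCoprime u r) :
    J(r | M.natAbs) = hs r M := by
  obtain ⟨i, m, hm, hrm⟩ : ∃ i m : ℕ, Odd m ∧ r.natAbs = 2 ^ i * m := by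
    obtain ⟨i, m, h1, h2⟩ := Nat.exists_eq_two_pow_mul_odd (Int.natAbs_ne_zero.2 hr)
    exact ⟨i, m, h1, h2⟩
  have hmr : (m : ℤ) ∣ r := by
    rw [← Int.dvd_natAbs, hrm]; push_cast; exact Dvd.intro_left _ rfl
  have e1 : J((m : ℤ) | M.natAbs) = 1 := by
    rw [jacobiSym_natAbs_recip hM hm]
    have hcM : IsCoprime M (m : ℤ) := (hc.symm.of_isCoprime_of_dvd_right hmr)
    have hcu : IsCoprime u (m : ℤ) := hu.of_isCoprime_of_dvd_right hmr
    have h3 : J(M * u ^ 2 | m) = J(t ^ 2 | m) := jacobiSym_eq_of_dvd (hmr.trans hd)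
    have hct : IsCoprime t (m : ℤ) := by
      have h4 : IsCoprime (M * u ^ 2) (m : ℤ) := hcM.mul_left hcu.pow_left
      obtain ⟨w, hw⟩ := hmr.trans hd
      have h5 : t ^ 2 = M * u ^ 2 + m * (-w) := by linarith
      have h6 : IsCoprime (t ^ 2) (m : ℤ) := by
        rw [h5]; exact IsCoprime.add_mul_left_left h4 _
      exact (IsCoprime.pow_left_iff (by norm_num)).1 h6
    have hg : ∀ {z : ℤ}, IsCoprime z (m : ℤ) → z.gcd m = 1 :=
      fun h => Int.isCoprime_iff_gcd_eq_one.1 h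
    rw [jacobiSym.mul_left, jacobiSym.sq_one' (hg hcu), jacobiSym.sq_one' (hg hct), mul_one] at h3
    exact h3
  have e2 : J(2 | M.natAbs) ^ i = 1 := by
    rcases Nat.eq_zero_or_pos i with rfl | hi
    · rw [pow_zero]
    · rw [jacobiSym_two_natAbs, one_pow]
      apply h2
      have : 2 ∣ r.natAbs := by
        rw [hrm]; exact Dvd.dvd.mul_right (dvd_pow_self 2 hi.ne') m
      omega
  have e3 : J((r.natAbs : ℤ) | M.natAbs) = 1 := by
    rw [hrm]; push_cast
    rw [jacobiSym.mul_left, jacobiSym.pow_left, e1, e2, one_mul]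
  rcases lt_or_ge r 0 with h | h
  · have h5 : r = -1 * (r.natAbs : ℤ) := by omega
    have h6 : J(r | M.natAbs) = J(-1 | M.natAbs) * J((r.natAbs : ℤ) | M.natAbs) := by
      conv_lhs => rw [h5]
      rw [jacobiSym.mul_left]
    rw [h6, e3, mul_one, jacobiSym_neg_one_natAbs hM]
    have h7 : (r : ℝ) < 0 := by exact_mod_cast h
    rcases lt_or_ge M 0 with h8 | h8
    · have h8' : (M : ℝ) < 0 := by exact_mod_cast h8
      rw [hs_of_neg (by norm_num) h8', hs_of_neg h7 h8']
    · have h8' : (0 : ℝ) < M := by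
        have : 0 < M := by omega
        exact_mod_cast this
      rw [hs_of_pos_right _ h8', hs_of_pos_right _ h8']
  · have h5 : (r.natAbs : ℤ) = r := by omega
    rw [h5] at e3
    rw [e3, hs_of_pos_left _ (by
      have : 0 < r := by omega
      exact_mod_cast this)]

lemma jacobiSym_recip {g M : ℤ} (hg : g % 4 = 1) (hM : M % 4 = 1) :
    J(g | M.natAbs) = J(M | g.natAbs) * hs g M := by
  have hodd : Odd g.natAbs := by rw [Nat.odd_iff]; omega
  have h1 := jacobiSym_natAbs_recip hM hodd
  rcases lt_or_ge g 0 with h | h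
  · have h5 : g = -1 * (g.natAbs : ℤ) := by omega
    have h6 : J(g | M.natAbs) = J(-1 | M.natAbs) * J((g.natAbs : ℤ) | M.natAbs) := by
      conv_lhs => rw [h5]
      rw [jacobiSym.mul_left]
    rw [h6, h1, jacobiSym_neg_one_natAbs hM, mul_comm]
    congr 1
    have h7 : (g : ℝ) < 0 := by exact_mod_cast h
    simp only [hs, h7, true_and]
    norm_num
  · have h5 : (g.natAbs : ℤ) = g := by omega
    rw [h5] at h1
    rw [h1, hs_of_pos_left _ (by
      have : 0 < g := by omega
      exact_mod_cast this), mul_one]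

/-! ### The ring `ℤ[(1 + √13) / 2]` -/

/-- The ring `ℤ[ω]` with `ω = (1 + √13) / 2`. -/
abbrev ZW := QuadraticAlgebra ℤ 3 1

namespace ZW

open QuadraticAlgebra

lemma norm_eq (x : ZW) : x.norm = x.re * x.re + x.re * x.im - 3 * x.im * x.im := by
  rw [norm_def]; ring

lemma norm_eq_zero {x : ZW} : x.norm = 0 ↔ x = 0 := by
  refine ⟨fun h => ?_, fun h => by rw [h, QuadraticAlgebra.norm_zero]⟩
  rw [norm_eq] at h
  have h1 : (2 * x.re + x.im) * (2 * x.re + x.im) = 13 * (x.im * x.im) := by linarith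
  have h2 : x.im = 0 := by
    by_contra h0
    have h13 : Nat.Prime 13 := by norm_num
    have := h13.irrational_sqrt
    apply this.ne_rat (|(2 * x.re + x.im : ℤ)| / |(x.im : ℤ)| : ℚ)
    rw [Real.sqrt_eq_iff_mul_self_eq (by norm_num) (by push_cast; positivity)]
    have h3 : (x.im : ℝ) ≠ 0 := by exact_mod_cast h0
    push_cast
    rw [div_mul_div_comm, abs_mul_abs_self, abs_mul_abs_self,
      eq_div_iff (mul_ne_zero h3 h3)]
    have h4 : ((2 * x.re + x.im) * (2 * x.re + x.im) : ℝ) = 13 * (x.im * x.im) := by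
      exact_mod_cast congrArg (Int.cast (R := ℝ)) h1
    linarith
  rw [h2] at h1
  have h3 : x.re = 0 := by
    have : x.re * x.re = 0 := by linarith
    simpa using this
  ext <;> simpa

instance : IsDomain ZW := by
  have : NoZeroDivisors ZW := ⟨fun {x y} h => by
    rw [← norm_eq_zero, map_mul, mul_eq_zero, norm_eq_zero, norm_eq_zero] at h
    exact h⟩
  exact NoZeroDivisors.to_isDomain _

lemma exists_two_mul_abs_sub_le (v : ℤ) {n : ℤ} (hn : n ≠ 0) : ∃ d, 2 * |v - n * d| ≤ |n| := by
  wlog h : 0 < n generalizing n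
  · obtain ⟨d, hd⟩ := this (n := -n) (neg_ne_zero.2 hn) (by omega)
    exact ⟨-d, by simpa using hd⟩
  refine ⟨(2 * v + n) / (2 * n), ?_⟩
  have h1 := Int.emod_add_mul_ediv (2 * v + n) (2 * n)
  have h2 := Int.emod_nonneg (2 * v + n) (b := 2 * n) (by omega)
  have h3 := Int.emod_lt_of_pos (2 * v + n) (b := 2 * n) (by omega)
  rw [abs_of_pos h]
  have h4 : 2 * |v - n * ((2 * v + n) / (2 * n))| = |2 * (v - n * ((2 * v + n) / (2 * n)))| := by
    rw [abs_mul]; rfl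
  rw [h4, abs_le]
  constructor <;> linarith

/-- Rounding the ω-coordinate of x/y first, one reaches a remainder r + sω with |s| ≤ 1/2 and |2r +
s| ≤ 1. Its norm ((2r + s)² - 13s²)/4 lies between -13/16 and 1/4. -/
lemma exists_natAbs_norm_sub_lt (x : ZW) {y : ZW} (hy : y ≠ 0) :
    ∃ q, (x - y * q).norm.natAbs < y.norm.natAbs := by
  have hn : y.norm ≠ 0 := norm_eq_zero.not.2 hy
  obtain ⟨d, hd⟩ := exists_two_mul_abs_sub_le (x * star y).im hn
  obtain ⟨c, hc⟩ := exists_two_mul_abs_sub_le (2 * (x * star y).re +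
    ((x * star y).im - y.norm * d)) (n := 2 * y.norm) (by simpa using hn)
  refine ⟨⟨c, d⟩, ?_⟩
  set n := y.norm
  have h1 : (x - y * ⟨c, d⟩) * star y
      = ⟨(x * star y).re - n * c, (x * star y).im - n * d⟩ := by
    have : (x - y * ⟨c, d⟩) * star y = x * star y - ⟨c, d⟩ * (y * star y) := by ring
    rw [this, ← algebraMap_norm_eq_mul_star]
    ext <;> simp <;> ring
  have h2 := congrArg QuadraticAlgebra.norm h1
  rw [map_mul, QuadraticAlgebra.norm_star,
    norm_eq ⟨(x * star y).re - n * c, (x * star y).im - n * d⟩] at h2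
  dsimp only at h2
  set u := (x * star y).re
  set v := (x * star y).im - n * d
  rw [abs_mul, abs_two] at hc
  have hc' : |2 * (u - n * c) + v| ≤ |n| := by
    have : 2 * u + v - 2 * n * c = 2 * (u - n * c) + v := by ring
    rw [this] at hc; linarith
  have hc2 := sq_le_sq' (abs_le.1 hc').1 (abs_le.1 hc').2
  have hd2 : (2 * |v|) * (2 * |v|) ≤ |n| * |n| :=
    mul_le_mul hd hd (by positivity) (by positivity)
  have hv : |v| * |v| = v * v := abs_mul_abs_self v
  have hnn : |n| * |n| = n * n := abs_mul_abs_self n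
  have hn2 : 0 < n * n := mul_self_pos.2 hn
  have hsq : |n| ^ 2 = n * n := by rw [sq, hnn]
  have key : |(x - y * ⟨c, d⟩).norm * n| < |n| * |n| := by
    change (x - y * ⟨c, d⟩).norm * n = _ at h2
    rw [h2, hnn, abs_lt]
    constructor <;> nlinarith
  rw [abs_mul] at key
  have := lt_of_mul_lt_mul_right key (abs_nonneg n)
  zify; exact this

instance : IsPrincipalIdealRing ZW := ⟨fun I => by
  by_cases h : I = ⊥
  · rw [h]; exact bot_isPrincipal
  obtain ⟨z, hz, hz0⟩ := Submodule.exists_mem_ne_zero_of_ne_bot h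
  let s : Set ℕ := {m | ∃ y ∈ I, y ≠ 0 ∧ y.norm.natAbs = m}
  have hs : s.Nonempty := ⟨_, z, hz, hz0, rfl⟩
  obtain ⟨y, hy, hy0, hym⟩ := Nat.sInf_mem hs
  refine ⟨y, le_antisymm (fun x hx => ?_) ((Ideal.span_singleton_le_iff_mem I).2 hy)⟩
  obtain ⟨q, hq⟩ := exists_natAbs_norm_sub_lt x hy0
  have hx' : x - y * q ∈ I := I.sub_mem hx (I.mul_mem_right q hy)
  by_cases h0 : x - y * q = 0
  · exact Ideal.mem_span_singleton'.2 ⟨q, by rw [mul_comm]; exact (sub_eq_zero.1 h0).symm⟩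
  · have : sInf s ≤ (x - y * q).norm.natAbs := Nat.sInf_le ⟨_, hx', h0, rfl⟩
    omega⟩

instance : Ring.HasFiniteQuotients ZW := inferInstance

lemma span_ne_bot {x : ZW} (hx : x ≠ 0) : Ideal.span {x} ≠ ⊥ := by
  simpa [Ideal.span_singleton_eq_bot] using hx

lemma jac_intCast {β : ZW} (hβ : β ≠ 0) (r : ℤ) :
    jac (Ideal.span {β}) (r : ZW) = jacobiSym r β.norm.natAbs := by
  have h := jac_algebraMap (R := ℤ) (span_ne_bot hβ) r
  rw [Ideal.relNorm_singleton, intNorm_quadraticAlgebra, jac_int _ (norm_eq_zero.not.2 hβ)] at h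
  exact h

lemma isCoprime_intCast {r s : ℤ} (h : IsCoprime (r : ZW) (s : ZW)) : IsCoprime r s := by
  obtain ⟨u, v, huv⟩ := h
  refine ⟨u.re, v.re, ?_⟩
  have := congrArg QuadraticAlgebra.re huv
  simpa using this

lemma isCoprime_norm {r : ℤ} {β : ZW} (h : IsCoprime (r : ZW) β) : IsCoprime r β.norm := by
  apply isCoprime_intCast
  have h1 : IsCoprime (r : ZW) (star β) := by
    have := h.map (starRingEnd ZW)
    simpa [starRingEnd_apply] using this
  have h2 := h.mul_right h1
  rwa [← algebraMap_norm_eq_mul_star] at h2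

lemma isCoprime_of_norm {r : ℤ} {β : ZW} (h : IsCoprime r β.norm) : IsCoprime (r : ZW) β := by
  have h1 : IsCoprime (r : ZW) ((β.norm : ℤ) : ZW) := by
    simpa using h.map (Int.castRingHom ZW)
  have h2 : ((β.norm : ℤ) : ZW) = β * star β := algebraMap_norm_eq_mul_star β
  rw [h2] at h1
  exact h1.of_mul_right_left

lemma jac_span_intCast {g : ℤ} (hg : g ≠ 0) {x : ZW} (h : IsCoprime x.norm g) :
    jac (Ideal.span {(g : ZW)}) x = jacobiSym x.norm g.natAbs := by
  have h1 : (Ideal.span {g}).map (algebraMap ℤ ZW) = Ideal.span {(g : ZW)} := by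
    rw [Ideal.map_span, Set.image_singleton]; rfl
  rw [← h1, jac_map_of_isCoprime (by simpa [Ideal.span_singleton_eq_bot] using hg), jac_int _ hg]
  rw [← Ideal.isCoprime_iff_sup_eq, Ideal.isCoprime_span_singleton_iff]
  exact h

/-- The first real embedding of `ℤ[ω]`. -/
def φ₁ : ZW →+* ℝ := (QuadraticAlgebra.lift (R := ℤ) (A := ℝ) (a := 3) (b := 1)
  ⟨(1 + √13) / 2, by
    have : √13 * √13 = (13 : ℝ) := Real.mul_self_sqrt (by norm_num)
    simp only [zsmul_eq_mul]; push_cast; linarith⟩ : ZW →ₐ[ℤ] ℝ)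

/-- The second real embedding of `ℤ[ω]`. -/
def φ₂ : ZW →+* ℝ := φ₁.comp (starRingEnd ZW)

lemma φ₁_apply (x : ZW) : φ₁ x = x.re + x.im * ((1 + √13) / 2) := by
  simp [φ₁, QuadraticAlgebra.lift]

lemma φ₂_apply (x : ZW) : φ₂ x = x.re + x.im * ((1 - √13) / 2) := by
  simp only [φ₂, RingHom.comp_apply, starRingEnd_apply, φ₁_apply, re_star, im_star]
  push_cast; ring

lemma φ₁_mul_φ₂ (x : ZW) : φ₁ x * φ₂ x = x.norm := by
  have : √13 * √13 = (13 : ℝ) := Real.mul_self_sqrt (by norm_num)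
  rw [φ₁_apply, φ₂_apply, norm_eq]
  push_cast
  linear_combination (-(x.im : ℝ) * x.im / 4) * this

lemma φ₁_ne_zero {x : ZW} (hx : x ≠ 0) : φ₁ x ≠ 0 := fun h => by
  have := φ₁_mul_φ₂ x
  rw [h, zero_mul] at this
  exact hx (norm_eq_zero.1 (by exact_mod_cast this.symm))

lemma φ₂_ne_zero {x : ZW} (hx : x ≠ 0) : φ₂ x ≠ 0 := fun h => by
  have := φ₁_mul_φ₂ x
  rw [h, mul_zero] at this
  exact hx (norm_eq_zero.1 (by exact_mod_cast this.symm))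

end ZW

/-! ### Quadratic reciprocity in ℤ[ω] and its supplements -/

namespace ZW

open QuadraticAlgebra NumberTheorySymbols

/-- An element of `ℤ[ω]` is primary if it is congruent to `1` modulo `4`. -/
def IsPrimary (x : ZW) : Prop := x.re % 4 = 1 ∧ x.im % 4 = 0

lemma IsPrimary.exists_eq {x : ZW} (h : IsPrimary x) :
    ∃ m n : ℤ, x.re = 4 * m + 1 ∧ x.im = 4 * n :=
  ⟨x.re / 4, x.im / 4, by have := h.1; omega, by have := h.2; omega⟩

lemma IsPrimary.ne_zero {x : ZW} (h : IsPrimary x) : x ≠ 0 := by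
  rintro rfl
  simp [IsPrimary] at h

lemma IsPrimary.mul {x y : ZW} (hx : IsPrimary x) (hy : IsPrimary y) : IsPrimary (x * y) := by
  obtain ⟨m, n, h1, h2⟩ := hx.exists_eq
  obtain ⟨m', n', h3, h4⟩ := hy.exists_eq
  constructor
  · rw [re_mul, h1, h2, h3, h4]; ring_nf; omega
  · rw [im_mul, h1, h2, h3, h4]; ring_nf; omega

lemma IsPrimary.of_mul {x y : ZW} (hx : IsPrimary x) (hxy : IsPrimary (x * y)) : IsPrimary y := by
  obtain ⟨m, n, h1, h2⟩ := hx.exists_eq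
  obtain ⟨h3, h4⟩ := hxy
  rw [re_mul, h1, h2] at h3
  rw [im_mul, h1, h2] at h4
  ring_nf at h3 h4
  constructor <;> omega

lemma IsPrimary.norm_mod {x : ZW} (hx : IsPrimary x) : x.norm % 4 = 1 := by
  obtain ⟨m, n, h1, h2⟩ := hx.exists_eq
  rw [norm_eq, h1, h2]; ring_nf; omega

lemma IsPrimary.norm_mod_eight {x : ZW} (hx : IsPrimary x) (h : x.im % 8 = 0) :
    x.norm % 8 = 1 := by
  obtain ⟨m, -, h1, -⟩ := hx.exists_eq
  obtain ⟨n, h2⟩ : ∃ n, x.im = 8 * n := ⟨x.im / 8, by omega⟩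
  rw [norm_eq, h1, h2]; ring_nf; omega

lemma IsPrimary.norm_mod_eight' {x : ZW} (hx : IsPrimary x) (h : x.im % 8 = 4) :
    x.norm % 8 = 5 := by
  obtain ⟨m, -, h1, -⟩ := hx.exists_eq
  obtain ⟨n, h2⟩ : ∃ n, x.im = 8 * n + 4 := ⟨x.im / 8, by omega⟩
  rw [norm_eq, h1, h2]; ring_nf; omega

lemma isPrimary_intCast {g : ℤ} : IsPrimary (g : ZW) ↔ g % 4 = 1 := by
  simp [IsPrimary]

lemma jac_mul_span {x y : ZW} (hx : x ≠ 0) (hy : y ≠ 0) (z : ZW) :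
    jac (Ideal.span {x * y}) z = jac (Ideal.span {x}) z * jac (Ideal.span {y}) z := by
  rw [← Ideal.span_singleton_mul_span_singleton, jac_mul_ideal (span_ne_bot hx) (span_ne_bot hy)]

lemma jac_sq_of_isCoprime {x y : ZW} (h : IsCoprime x y) :
    jac (Ideal.span {y}) x * jac (Ideal.span {y}) x = 1 :=
  jac_mul_self (by
    rw [← Ideal.isCoprime_iff_sup_eq, Ideal.isCoprime_span_singleton_iff]; exact h)

/-- The product of the Hilbert symbols at the two real places. -/
def hs₂ (x y : ZW) : ℤ := hs (φ₁ x) (φ₁ y) * hs (φ₂ x) (φ₂ y)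

lemma hs₂_comm (x y : ZW) : hs₂ x y = hs₂ y x := by
  rw [hs₂, hs₂, hs_comm, hs_comm (φ₂ x)]

lemma hs₂_mul_right {x y z : ZW} (hy : y ≠ 0) (hz : z ≠ 0) :
    hs₂ x (y * z) = hs₂ x y * hs₂ x z := by
  rw [hs₂, hs₂, hs₂, map_mul, map_mul, hs_mul_right (φ₁_ne_zero hy) (φ₁_ne_zero hz),
    hs_mul_right (φ₂_ne_zero hy) (φ₂_ne_zero hz)]
  ring

lemma hs₂_intCast (g : ℤ) {x : ZW} (hx : x ≠ 0) : hs₂ (g : ZW) x = hs g x.norm := by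
  rw [hs₂, map_intCast, map_intCast, ← hs_mul_right (φ₁_ne_zero hx) (φ₂_ne_zero hx), φ₁_mul_φ₂]

/-- With one rational argument both symbols are Jacobi symbols between g and the norm of x, so this
is reciprocity over ℤ. -/
lemma recip_intCast {g : ℤ} (hg : g % 4 = 1) {x : ZW} (hx : IsPrimary x)
    (hc : IsCoprime x (g : ZW)) :
    jac (Ideal.span {(g : ZW)}) x * jac (Ideal.span {x}) (g : ZW) = hs₂ x g := by
  have hc' : IsCoprime g x.norm := isCoprime_norm hc.symm
  have hg0 : g ≠ 0 := by rintro rfl; simp at hg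
  rw [jac_span_intCast hg0 hc'.symm, jac_intCast hx.ne_zero, jacobiSym_recip hg hx.norm_mod,
    hs₂_comm, hs₂_intCast _ hx.ne_zero, ← mul_assoc, jacobiSym_natAbs_mul_self hc'.symm, one_mul]

lemma exists_primitive {β : ZW} (hβ : IsPrimary β) : ∃ (g : ℤ) (β₀ : ZW), g % 4 = 1 ∧
    IsPrimary β₀ ∧ IsCoprime β₀.re β₀.im ∧ β = g * β₀ := by
  obtain ⟨h1, h2⟩ := hβ
  obtain ⟨d, hd, x, y, hx, hy, hxy⟩ : ∃ d : ℤ, d % 4 = 1 ∧ ∃ x y, β.re = d * x ∧ β.im = d * y ∧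
      IsCoprime x y := by
    have hre : β.re ≠ 0 := by intro h; rw [h] at h1; simp at h1
    obtain ⟨x, hx⟩ := Int.gcd_dvd_left (a := β.re) (b := β.im)
    obtain ⟨y, hy⟩ := Int.gcd_dvd_right (a := β.re) (b := β.im)
    set d : ℤ := (β.re.gcd β.im : ℤ)
    have hd0 : d ≠ 0 := by rintro h; rw [h, zero_mul] at hx; exact hre hx
    have hxy : IsCoprime x y := by
      obtain ⟨u, v, huv⟩ : ∃ u v, d = β.re * u + β.im * v := ⟨_, _, Int.gcd_eq_gcd_ab _ _⟩
      refine ⟨u, v, mul_left_cancel₀ hd0 ?_⟩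
      rw [mul_one]
      conv_rhs => rw [huv, hx, hy]
      ring
    have hodd : d % 2 = 1 := by
      by_contra h
      obtain ⟨k, hk⟩ : ∃ k, d = 2 * k := ⟨d / 2, by omega⟩
      rw [hk, mul_assoc] at hx
      omega
    -- The content is odd and determined up to sign; the sign is fixed by requiring it to be 1
    -- modulo 4.
    rcases (by omega : d % 4 = 1 ∨ (-d) % 4 = 1) with h | h
    · exact ⟨d, h, x, y, hx, hy, hxy⟩
    · exact ⟨-d, h, -x, -y, by linarith, by linarith, hxy.neg_neg⟩
  refine ⟨d, ⟨x, y⟩, hd, ?_, hxy, ?_⟩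
  · obtain ⟨k, hk⟩ : ∃ k, d = 4 * k + 1 := ⟨d / 4, by omega⟩
    rw [hx, hk] at h1
    rw [hy, hk] at h2
    ring_nf at h1 h2
    constructor <;> dsimp only <;> omega
  · ext <;> simp [hx, hy]

lemma eq_one_of_im_eq_zero {β : ZW} (hβ : IsPrimary β) (h : IsCoprime β.re β.im)
    (h0 : β.im = 0) : β = 1 := by
  rw [h0, isCoprime_zero_right, Int.isUnit_iff] at h
  have := hβ.1
  ext
  · rw [re_one]; omega
  · rw [im_one, h0]

lemma norm_isCoprime_im {β : ZW} (h : IsCoprime β.re β.im) : IsCoprime β.im β.norm := by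
  have h1 : IsCoprime β.im (β.re * β.re) := h.symm.mul_right h.symm
  have h2 : β.norm = β.re * β.re + β.im * (β.re - 3 * β.im) := by rw [norm_eq]; ring
  rw [h2]
  exact h1.add_mul_left_right _

/-- Eliminating the ω-coordinates gives qx - bβ = n with q, b, n rational. Modulo β one may replace
x by n/q, and modulo x one may replace β by -n/b, so both symbols become Jacobi symbols with bottom
M = N β or X = N x. These are real Hilbert symbols by `jacobiSym_of_sq`, and the Steinberg relation
for qx - bβ = n at the two real places assembles them into `hs₂ x β`. -/
lemma recip_primitive {x β : ZW} (hx : IsPrimary x) (hβ : IsPrimary β)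
    (hx' : IsCoprime x.re x.im) (hβ' : IsCoprime β.re β.im) (hc : IsCoprime x β) :
    jac (Ideal.span {β}) x * jac (Ideal.span {x}) β = hs₂ x β := by
  by_cases hb0 : x.im = 0
  · have : x = ((1 : ℤ) : ZW) := by rw [eq_one_of_im_eq_zero hx hx' hb0, Int.cast_one]
    rw [this, mul_comm, hs₂_comm]
    exact recip_intCast (by norm_num) hβ (by rw [Int.cast_one]; exact isCoprime_one_right)
  by_cases hq0 : β.im = 0
  · have : β = ((1 : ℤ) : ZW) := by rw [eq_one_of_im_eq_zero hβ hβ' hq0, Int.cast_one]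
    rw [this]
    exact recip_intCast (by norm_num) hx (by rw [Int.cast_one]; exact isCoprime_one_right)
  -- Removing the common divisor h of the ω-coordinates makes q and b coprime. That 4 divides h
  -- controls the norms modulo 8 below.
  obtain ⟨h, q, b, hh0, hq, hb, hqb, hh4⟩ : ∃ h q b : ℤ, h ≠ 0 ∧ β.im = h * q ∧ x.im = h * b ∧
      IsCoprime q b ∧ h % 4 = 0 := by
    obtain ⟨q, hq⟩ := Int.gcd_dvd_left (a := β.im) (b := x.im)
    obtain ⟨b, hb⟩ := Int.gcd_dvd_right (a := β.im) (b := x.im)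
    have h4 : (4 : ℤ) ∣ β.im.gcd x.im := Int.dvd_coe_gcd (by have := hβ.2; omega)
      (by have := hx.2; omega)
    obtain ⟨u, v, huv⟩ : ∃ u v, (β.im.gcd x.im : ℤ) = β.im * u + x.im * v :=
      ⟨_, _, Int.gcd_eq_gcd_ab _ _⟩
    generalize (β.im.gcd x.im : ℤ) = d at *
    have hd0 : d ≠ 0 := by rintro h; rw [h, zero_mul] at hq; exact hq0 hq
    refine ⟨d, q, b, hd0, hq, hb, ⟨u, v, mul_left_cancel₀ hd0 ?_⟩, by omega⟩
    rw [mul_one]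
    conv_rhs => rw [huv, hq, hb]
    ring
  have hq0' : q ≠ 0 := by rintro rfl; simp [hq] at hq0
  have hb0' : b ≠ 0 := by rintro rfl; simp [hb] at hb0
  set n : ℤ := q * x.re - b * β.re with hn
  have hrel : (q : ZW) * x - b * β = (n : ZW) := by
    ext
    · simp [hn]
    · simp [hq, hb]; ring
  have hx0 := hx.ne_zero
  have hβ0 := hβ.ne_zero
  set M := β.norm with hMdef
  set X := x.norm with hXdef
  have hM : M % 4 = 1 := hβ.norm_mod
  have hX : X % 4 = 1 := hx.norm_mod
  have hM' : M = β.re * β.re + q * (h * (β.re - 3 * β.im)) := by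
    rw [hMdef, norm_eq, hq]; ring
  have hX' : X = x.re * x.re + b * (h * (x.re - 3 * x.im)) := by
    rw [hXdef, norm_eq, hb]; ring
  have hqp : IsCoprime q β.re := (hq ▸ hβ').symm.of_mul_left_right
  have hba : IsCoprime b x.re := (hb ▸ hx').symm.of_mul_left_right
  have hqM : IsCoprime q M := by
    rw [hM']; exact (hqp.mul_right hqp).add_mul_left_right _
  have hbX : IsCoprime b X := by
    rw [hX']; exact (hba.mul_right hba).add_mul_left_right _
  obtain ⟨m1, -, hm1, -⟩ := hx.exists_eq
  obtain ⟨m2, -, hm2, -⟩ := hβ.exists_eq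
  -- Here coprimality and the congruences modulo 4 force x = β, which is then a unit of norm 1: both
  -- sides equal 1.
  by_cases hn0 : n = 0
  · have e1 : q * x.re = b * β.re := by linarith
    have h1 : b ∣ q := hba.dvd_of_dvd_mul_right ⟨β.re, e1⟩
    have h2 : IsUnit b := hqb.symm.isUnit_of_dvd' dvd_rfl h1
    have h3 : q ∣ b := hqp.dvd_of_dvd_mul_right ⟨x.re, e1.symm⟩
    have h4 : IsUnit q := hqb.isUnit_of_dvd' dvd_rfl h3
    have h5 : x = β := by
      rw [Int.isUnit_iff] at h2 h4
      rcases h2 with rfl | rfl <;> rcases h4 with rfl | rfl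
      · ext <;> omega
      · omega
      · omega
      · ext <;> omega
    rw [h5, isCoprime_self] at hc
    rw [h5, Ideal.span_singleton_eq_top.2 hc, jac_top, mul_one]
    rw [isUnit_iff_norm_isUnit, Int.isUnit_iff] at hc
    have h6 : β.norm = 1 := by omega
    have h8 : φ₁ β * φ₂ β = 1 := by rw [φ₁_mul_φ₂, h6]; norm_num
    rw [hs₂]
    rcases lt_or_gt_of_ne (φ₁_ne_zero hβ0) with h9 | h9
    · have h10 : φ₂ β < 0 := by nlinarith
      rw [hs_of_neg h9 h9, hs_of_neg h10 h10]; rfl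
    · have h10 : 0 < φ₂ β := by nlinarith
      rw [hs_of_pos_left _ h9, hs_of_pos_left _ h10]; rfl
  have hcn : IsCoprime (n : ZW) β ∧ IsCoprime (n : ZW) x := by
    constructor
    · have h1 : IsCoprime ((q : ZW) * x) β := (isCoprime_of_norm hqM).mul_left hc
      have h2 : (n : ZW) = q * x + β * (-b) := by rw [← hrel]; ring
      rw [h2]; exact h1.add_mul_left_left _
    · have h1 : IsCoprime (-((b : ZW) * β)) x := ((isCoprime_of_norm hbX).mul_left hc.symm).neg_left
      have h2 : (n : ZW) = -(b * β) + x * q := by rw [← hrel]; ring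
      rw [h2]; exact h1.add_mul_left_left _
  have hnM : IsCoprime n M := isCoprime_norm hcn.1
  have hnX : IsCoprime n X := isCoprime_norm hcn.2
  have e1 : jac (Ideal.span {β}) x = J(q | M.natAbs) * J(n | M.natAbs) := by
    have h1 : jac (Ideal.span {β}) ((q : ZW) * x) = jac (Ideal.span {β}) (n : ZW) :=
      jac_congr (Ideal.mem_span_singleton'.2 ⟨b, by rw [← hrel]; ring⟩)
    rw [jac_mul, jac_intCast hβ0, jac_intCast hβ0] at h1
    rw [← h1, ← mul_assoc, jacobiSym_natAbs_mul_self hqM, one_mul]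
  have e2 : jac (Ideal.span {x}) β = J(-b | X.natAbs) * J(n | X.natAbs) := by
    have h1 : jac (Ideal.span {x}) (((-b : ℤ) : ZW) * β) = jac (Ideal.span {x}) (n : ZW) :=
      jac_congr (Ideal.mem_span_singleton'.2 ⟨-q, by rw [← hrel]; push_cast; ring⟩)
    rw [jac_mul, jac_intCast hx0, jac_intCast hx0] at h1
    rw [← h1, ← mul_assoc, jacobiSym_natAbs_mul_self hbX.neg_left, one_mul]
  -- M is the square of the rational coordinate of β modulo q, and an even q makes the ω-coordinate
  -- of β divisible by 8, so M ≡ 1 mod 8.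
  have e3 : J(q | M.natAbs) = hs q M := by
    refine jacobiSym_of_sq (u := 1) (t := β.re) hM hq0' hqM (fun h2 => ?_) ?_ isCoprime_one_left
    · apply hβ.norm_mod_eight
      obtain ⟨k, rfl⟩ : ∃ k, q = 2 * k := ⟨q / 2, by omega⟩
      obtain ⟨k', rfl⟩ : ∃ k, h = 4 * k := ⟨h / 4, by omega⟩
      rw [hq, show 4 * k' * (2 * k) = 8 * (k' * k) by ring]; omega
    · exact ⟨h * (β.re - 3 * β.im), by rw [hM']; ring⟩
  have e4 : J(-b | X.natAbs) = hs (-b) X := by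
    have := jacobiSym_of_sq (r := -b) (u := 1) (t := x.re) hX (neg_ne_zero.2 hb0') hbX.neg_left
      (fun h2 => ?_) ?_ isCoprime_one_left
    · rw [this]; push_cast; rfl
    · apply hx.norm_mod_eight
      obtain ⟨k, rfl⟩ : ∃ k, b = 2 * k := ⟨b / 2, by omega⟩
      obtain ⟨k', rfl⟩ : ∃ k, h = 4 * k := ⟨h / 4, by omega⟩
      rw [hb, show 4 * k' * (2 * k) = 8 * (k' * k) by ring]; omega
    · exact ⟨-(h * (x.re - 3 * x.im)), by rw [hX']; ring⟩
  have hM0 : M ≠ 0 := by omega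
  have hX0 : X ≠ 0 := by omega
  -- Taking norms in qx = bβ + n shows q²X ≡ b²M mod n, so q²MX ≡ (bM)². If n is even, q and b are
  -- odd, and then M and X are both 1 or both 5 modulo 8.
  have e5 : J(n | M.natAbs) * J(n | X.natAbs) = hs n M * hs n X := by
    have h1 : (M * X).natAbs = M.natAbs * X.natAbs := Int.natAbs_mul _ _
    have : NeZero M.natAbs := ⟨by omega⟩
    have : NeZero X.natAbs := ⟨by omega⟩
    have h2 : q ^ 2 * X = b ^ 2 * M + n * (2 * b * β.re + b * β.im + n) := by
      have h3 := congrArg QuadraticAlgebra.norm (show (q : ZW) * x = b * β + n by rw [← hrel]; ring)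
      rw [map_mul, norm_intCast, Int.cast_id] at h3
      rw [hXdef, h3, hMdef, norm_eq, norm_eq]
      simp
      ring
    have h3 := jacobiSym_of_sq (r := n) (M := M * X) (u := q) (t := b * M)
      (by rw [Int.mul_emod, hM, hX]; rfl) hn0 (hnM.mul_right hnX) (fun h4 => ?_)
      ⟨M * (2 * b * β.re + b * β.im + n), by linear_combination M * h2⟩ ?_
    · rw [h1, jacobiSym.mul_right] at h3
      rw [h3]
      push_cast
      exact hs_mul_right (by exact_mod_cast hM0) (by exact_mod_cast hX0) _
    · have h5 : n = q * (4 * m1 + 1) - b * (4 * m2 + 1) := by rw [hn, hm1, hm2]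
      have h5' : (q - b) % 2 = 0 := by ring_nf at h5; omega
      have hodd : q % 2 = 1 ∧ b % 2 = 1 := by
        by_contra h6
        obtain ⟨u, v, huv⟩ := hqb
        obtain ⟨k, rfl⟩ : ∃ k, q = 2 * k := ⟨q / 2, by omega⟩
        obtain ⟨k', rfl⟩ : ∃ k, b = 2 * k := ⟨b / 2, by omega⟩
        have : 2 * (u * k + v * k') = 1 := by linarith
        omega
      obtain ⟨k', rfl⟩ : ∃ k, h = 4 * k := ⟨h / 4, by omega⟩
      obtain ⟨k1, rfl⟩ : ∃ k, q = 2 * k + 1 := ⟨q / 2, by omega⟩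
      obtain ⟨k2, rfl⟩ : ∃ k, b = 2 * k + 1 := ⟨b / 2, by omega⟩
      rcases Int.even_or_odd' k' with ⟨k, rfl | rfl⟩
      · rw [Int.mul_emod, hβ.norm_mod_eight (by rw [hq]; ring_nf; omega),
          hx.norm_mod_eight (by rw [hb]; ring_nf; omega)]; rfl
      · rw [Int.mul_emod, hβ.norm_mod_eight' (by rw [hq]; ring_nf; omega),
          hx.norm_mod_eight' (by rw [hb]; ring_nf; omega)]; rfl
    · have h4 : IsCoprime q (-b * β.re) := hqb.neg_right.mul_right hqp
      have h5 : n = -b * β.re + q * x.re := by rw [hn]; ring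
      rw [h5]
      exact h4.add_mul_left_right _
  have key : ∀ φ : ZW →+* ℝ, φ x ≠ 0 → φ β ≠ 0 → hs (φ x) (φ β) =
      hs q (φ β) * hs (-b) (φ x) * hs n (φ x) * hs n (φ β) * hs (q * n) (-b * n) := by
    intro φ h1 h2
    refine hs_steinberg (by exact_mod_cast hq0') (by exact_mod_cast hb0') (by exact_mod_cast hn0)
      h1 h2 ?_
    have := congrArg φ hrel
    simpa using this
  have hM1 : (M : ℝ) = φ₁ β * φ₂ β := (φ₁_mul_φ₂ β).symm
  have hX1 : (X : ℝ) = φ₁ x * φ₂ x := (φ₁_mul_φ₂ x).symm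
  have n1 := φ₁_ne_zero hx0
  have n2 := φ₂_ne_zero hx0
  have n3 := φ₁_ne_zero hβ0
  have n4 := φ₂_ne_zero hβ0
  calc jac (Ideal.span {β}) x * jac (Ideal.span {x}) β
      = J(q | M.natAbs) * J(-b | X.natAbs) * (J(n | M.natAbs) * J(n | X.natAbs)) := by
        rw [e1, e2]; ring
    _ = hs q M * hs (-b) X * (hs n M * hs n X) := by rw [e3, e4, e5]
    _ = hs₂ x β := by
        rw [hs₂, key φ₁ n1 n3, key φ₂ n2 n4, hM1, hX1, hs_mul_right n3 n4, hs_mul_right n3 n4,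
          hs_mul_right n1 n2, hs_mul_right n1 n2]
        linear_combination (-(hs q (φ₁ β) * hs q (φ₂ β) * (hs (-b) (φ₁ x) * hs (-b) (φ₂ x)) *
          (hs n (φ₁ β) * hs n (φ₂ β) * (hs n (φ₁ x) * hs n (φ₂ x))))) *
          hs_mul_self (q * n : ℝ) (-b * n)

lemma recip {x β : ZW} (hx : IsPrimary x) (hβ : IsPrimary β) (hc : IsCoprime x β) :
    jac (Ideal.span {β}) x * jac (Ideal.span {x}) β = hs₂ x β := by
  obtain ⟨g, β₀, hg, hβ₀, hp, rfl⟩ := exists_primitive hβ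
  obtain ⟨k, x₀, hk, hx₀, hp', rfl⟩ := exists_primitive hx
  have hg' : IsPrimary (g : ZW) := isPrimary_intCast.2 hg
  have hk' : IsPrimary (k : ZW) := isPrimary_intCast.2 hk
  have h1 := recip_intCast hg hx hc.of_mul_right_left
  have h2 := recip_intCast hk hβ₀ hc.symm.of_mul_right_left.of_mul_left_right
  have h3 := recip_primitive hx₀ hβ₀ hp' hp hc.of_mul_left_right.of_mul_right_right
  rw [jac_mul_span hg'.ne_zero hβ₀.ne_zero, jac_mul _ (g : ZW), hs₂_mul_right hg'.ne_zero
    hβ₀.ne_zero, ← h1, hs₂_comm (_ * _) β₀, hs₂_mul_right hk'.ne_zero hx₀.ne_zero,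
    hs₂_comm β₀ x₀, ← h2, ← h3, jac_mul_span hk'.ne_zero hx₀.ne_zero β₀,
    jac_mul (Ideal.span {β₀})]
  ring

/-- The fundamental unit of `ℤ[ω]`. -/
def ε : ZW := ⟨1, 1⟩

lemma jac_neg_one {β : ZW} (hβ : IsPrimary β) : jac (Ideal.span {β}) (-1) = hs (-1) β.norm := by
  have := jac_intCast hβ.ne_zero (-1)
  rw [jacobiSym_neg_one_natAbs hβ.norm_mod] at this
  simpa using this

lemma jac_two {β : ZW} (hβ : IsPrimary β) :
    jac (Ideal.span {β}) 2 = if β.im % 8 = 0 then 1 else -1 := by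
  have h : jac (Ideal.span {β}) 2 = J(2 | β.norm.natAbs) := by
    simpa using jac_intCast hβ.ne_zero 2
  rw [h]
  split_ifs with h8
  · exact jacobiSym_two_natAbs (hβ.norm_mod_eight h8)
  · exact jacobiSym_two_natAbs' (hβ.norm_mod_eight' (by have := hβ.2; omega))

lemma norm_ε : ε.norm = -1 := by rw [norm_eq]; rfl

lemma ε_ne_zero : ε ≠ 0 := by rw [Ne, ← norm_eq_zero, norm_ε]; norm_num

/-- The elimination of `recip_primitive` with the unit ε in place of x: the ω-coordinate of ε is 1,
so qε - β = n is already rational. -/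
lemma jac_ε {β : ZW} (hβ : IsPrimary β) : jac (Ideal.span {β}) ε = hs₂ ε β := by
  obtain ⟨g, β', hg, hβ', hp, rfl⟩ := exists_primitive hβ
  clear hβ
  rename' β' => β, hβ' => hβ
  have hg' : IsPrimary (g : ZW) := isPrimary_intCast.2 hg
  rw [jac_mul_span hg'.ne_zero hβ.ne_zero, hs₂_mul_right hg'.ne_zero hβ.ne_zero]
  congr 1
  · rw [jac_span_intCast (by rintro rfl; simp at hg) (by rw [norm_ε]; exact isCoprime_one_left.neg_left),
      norm_ε, jacobiSym_neg_one_natAbs hg, hs₂_comm, hs₂_intCast _ ε_ne_zero, norm_ε, hs_comm]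
    norm_num
  set q := β.im with hq
  by_cases hq0 : q = 0
  · rw [eq_one_of_im_eq_zero hβ hp hq0, Ideal.span_singleton_one, jac_top, hs₂, map_one, map_one,
      hs_of_pos_right _ one_pos, hs_of_pos_right _ one_pos]; rfl
  set n : ℤ := q - β.re with hn
  set M := β.norm with hMdef
  have hM : M % 4 = 1 := hβ.norm_mod
  have hβ0 := hβ.ne_zero
  have hrel : (q : ZW) * ε - (1 : ℤ) * β = (n : ZW) := by
    ext
    · simp [hn, ε]
    · simp [hq, ε]
  have hqM : IsCoprime q M := norm_isCoprime_im hp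
  have hnq : IsCoprime q n := by
    have : n = -β.re + q * 1 := by rw [hn]; ring
    rw [this]; exact hp.symm.neg_right.add_mul_left_right _
  have h2 : -q ^ 2 = M + n * (2 * β.re + q + n) := by
    rw [hMdef, norm_eq, hn, ← hq]; ring
  have hnM : IsCoprime n M := by
    have h3 : IsCoprime n (-q ^ 2) := hnq.symm.pow_right.neg_right
    rw [h2] at h3
    exact h3.of_add_mul_left_right
  have hn4 : (-n) % 4 = 1 := by have := hβ.1; have := hβ.2; omega
  have hn0 : n ≠ 0 := by omega
  have e1 : jac (Ideal.span {β}) ε = J(q | M.natAbs) * J(n | M.natAbs) := by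
    have h1 : jac (Ideal.span {β}) ((q : ZW) * ε) = jac (Ideal.span {β}) (n : ZW) :=
      jac_congr (Ideal.mem_span_singleton'.2 ⟨1, by rw [← hrel]; push_cast; ring⟩)
    rw [jac_mul, jac_intCast hβ0, jac_intCast hβ0] at h1
    rw [← h1, ← mul_assoc, jacobiSym_natAbs_mul_self hqM, one_mul]
  -- The square factor 4 of q is dropped: the evenness condition of `jacobiSym_of_sq` is then
  -- available for k = q/4, since k even means 8 ∣ q.
  have e2 : J(q | M.natAbs) = hs q M := by
    obtain ⟨k, hk⟩ : ∃ k, q = 4 * k := ⟨q / 4, by have := hβ.2; omega⟩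
    have hkM : IsCoprime k M := (hk ▸ hqM).of_mul_left_right
    have h4 : J(4 | M.natAbs) = 1 := by
      have h4M : IsCoprime (2 : ℤ) M :=
        ⟨-2 * (M / 4), 1, by have := Int.emod_add_mul_ediv M 4; omega⟩
      have : (4 : ℤ) = 2 * 2 := by norm_num
      rw [this, jacobiSym.mul_left, jacobiSym_natAbs_mul_self h4M]
    have hk0 : k ≠ 0 := by rintro rfl; exact hq0 hk
    have h5 : J(k | M.natAbs) = hs k M := by
      refine jacobiSym_of_sq (u := 1) (t := β.re) hM hk0 hkM (fun h => ?_)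
        ⟨4 * (β.re - 3 * q), by rw [hMdef, norm_eq, ← hq, hk]; ring⟩ isCoprime_one_left
      exact hβ.norm_mod_eight (by omega)
    rw [hk, jacobiSym.mul_left, h4, one_mul, h5]
    push_cast
    rw [hs_mul_left (by norm_num) (by exact_mod_cast hk0), hs_of_pos_left (x := 4) _ (by norm_num),
      one_mul]
  -- As -n ≡ 1 mod 4, reciprocity applies to -n, and M ≡ -q² mod n reduces the reciprocal symbol to
  -- that of -1.
  have e3 : J(n | M.natAbs) = hs n M * hs (-1) (-n) := by
    have h3 := jacobiSym_recip hn4 hM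
    have h4 : J(-n | M.natAbs) = J(-1 | M.natAbs) * J(n | M.natAbs) := by
      rw [← jacobiSym.mul_left, neg_one_mul]
    have h5 : J(M | n.natAbs) = J(-1 | n.natAbs) := by
      have h6 : J(M | n.natAbs) = J(-q ^ 2 | n.natAbs) :=
        jacobiSym_eq_of_dvd (Int.natAbs_dvd.2 ⟨-(2 * β.re + q + n), by rw [h2]; ring⟩)
      have h7 : -q ^ 2 = -1 * (q * q) := by ring
      rw [h6, h7, jacobiSym.mul_left, jacobiSym.mul_left q q, jacobiSym_natAbs_mul_self hnq, mul_one]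
    have h8 := jacobiSym_neg_one_natAbs hn4
    have hMr : (M : ℝ) ≠ 0 := by
      have : M ≠ 0 := by omega
      exact_mod_cast this
    have hnr : (n : ℝ) ≠ 0 := by exact_mod_cast hn0
    rw [Int.natAbs_neg] at h3 h8
    rw [h4, h5, h8, jacobiSym_neg_one_natAbs hM] at h3
    push_cast at h3
    have h9 : hs (-n : ℝ) M = hs (-1) M * hs n M := by
      rw [← hs_mul_left (by norm_num) hnr, neg_one_mul]
    rw [h9] at h3
    have h10 := hs_mul_self (-1) (M : ℝ)
    calc J(n | M.natAbs) = hs (-1) M * (hs (-1) M * J(n | M.natAbs)) := by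
          rw [← mul_assoc, h10, one_mul]
      _ = hs n M * hs (-1) (-n) := by
          rw [h3]; linear_combination (hs n M * hs (-1) (-n : ℝ)) * h10
  have hnr : (n : ℝ) ≠ 0 := by exact_mod_cast hn0
  have key : ∀ φ : ZW →+* ℝ, φ ε ≠ 0 → φ β ≠ 0 → hs (φ ε) (φ β) =
      hs q (φ β) * hs (-1) (φ ε) * hs n (φ ε) * hs n (φ β) * hs (q * n) (-1 * n) := by
    intro φ h1 h2
    refine hs_steinberg (by exact_mod_cast hq0) one_ne_zero hnr h1 h2 ?_
    have := congrArg φ hrel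
    simpa using this
  have n1 := φ₁_ne_zero ε_ne_zero
  have n2 := φ₂_ne_zero ε_ne_zero
  have n3 := φ₁_ne_zero hβ0
  have n4 := φ₂_ne_zero hβ0
  have hM1 : (M : ℝ) = φ₁ β * φ₂ β := (φ₁_mul_φ₂ β).symm
  have hε1 : φ₁ ε * φ₂ ε = -1 := by rw [φ₁_mul_φ₂, norm_ε]; norm_num
  have f1 : hs (-1) (φ₁ ε) * hs (-1) (φ₂ ε) = hs (-1) (-1) := by rw [← hs_mul_right n1 n2, hε1]
  have f2 : hs n (φ₁ ε) * hs n (φ₂ ε) = hs n (-1) := by rw [← hs_mul_right n1 n2, hε1]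
  have f3 : hs (-1) (-n) = hs (-1) (-1) * hs n (-1) := by
    rw [hs_comm (n : ℝ), ← hs_mul_right (by norm_num) hnr, neg_one_mul]
  rw [e1, e2, e3, hs₂, key φ₁ n1 n3, key φ₂ n2 n4, f3, ← f1, ← f2, hM1, hs_mul_right n3 n4,
    hs_mul_right n3 n4]
  linear_combination (-(hs q (φ₁ β) * hs q (φ₂ β) * (hs (-1) (φ₁ ε) * hs (-1) (φ₂ ε)) *
    (hs n (φ₁ β) * hs n (φ₂ β) * (hs n (φ₁ ε) * hs n (φ₂ ε))))) * hs_mul_self (q * n : ℝ) (-1 * n)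

/-- Reduction modulo `4`. -/
def modFour : ZW →+* QuadraticAlgebra (ZMod 4) 3 1 :=
  (QuadraticAlgebra.lift (R := ℤ) (a := 3) (b := 1)
    ⟨(⟨0, 1⟩ : QuadraticAlgebra (ZMod 4) 3 1), by ext <;> simp⟩).toRingHom

lemma modFour_apply (x : ZW) : modFour x = ⟨x.re, x.im⟩ := by
  ext <;> simp [modFour, QuadraticAlgebra.lift]

lemma isPrimary_iff_modFour {x : ZW} : IsPrimary x ↔ modFour x = 1 := by
  rw [modFour_apply, QuadraticAlgebra.ext_iff, re_one, im_one]
  have h1 : ((x.re : ZMod 4) = 1) ↔ x.re % 4 = 1 := by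
    have := ZMod.intCast_eq_intCast_iff' x.re 1 4
    simpa using this
  have h2 : ((x.im : ZMod 4) = 0) ↔ x.im % 4 = 0 := by
    have := ZMod.intCast_eq_intCast_iff' x.im 0 4
    simpa using this
  rw [h1, h2, IsPrimary]

lemma exists_unit_mul_isPrimary {x : ZW} (hx : x.norm % 2 = 1) :
    ∃ k j : ℕ, IsPrimary ((-1) ^ j * ε ^ k * x) := by
  -- The hypothesis says that the norm is odd. Up to sign, powers of ε represent all the unit
  -- classes modulo 4, by enumeration.
  have h : ∀ a b : ZMod 4, 2 * (a * a + a * b - 3 * b * b) = 2 → ∃ (k : Fin 6) (s : Fin 2),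
      (-1) ^ s.1 * (QuadraticAlgebra.mk 1 1 : QuadraticAlgebra (ZMod 4) 3 1) ^ k.1 * ⟨a, b⟩ = 1 := by
    decide
  obtain ⟨k, j, hkj⟩ := h x.re x.im (by
    obtain ⟨m, hm⟩ : ∃ m, x.norm = 2 * m + 1 := ⟨x.norm / 2, by omega⟩
    rw [norm_eq] at hm
    have h4 : (4 : ZMod 4) = 0 := rfl
    have := congrArg (Int.cast (R := ZMod 4)) hm
    push_cast at this
    rw [this]
    linear_combination (m : ZMod 4) * h4)
  refine ⟨k, j, isPrimary_iff_modFour.2 ?_⟩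
  rw [map_mul, map_mul, map_pow, map_pow, map_neg, map_one, modFour_apply, modFour_apply]
  simpa [ε] using hkj

end ZW

/-! ### The ring `ℤ[(1 + √13) / 2, √7]` -/

/-- The ring `ℤ[ω, √7]` with `ω = (1 + √13) / 2`. -/
abbrev ZB := QuadraticAlgebra ZW 7 0

namespace ZB

open QuadraticAlgebra

/-- The element with given coordinates in the basis `1, ω, √7, ω√7`. -/
abbrev mk (a b c d : ℤ) : ZB := ⟨⟨a, b⟩, ⟨c, d⟩⟩

lemma norm_eq (x : ZB) : x.norm = x.re * x.re - 7 * x.im * x.im := by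
  rw [norm_def]; ring

/-- The ring homomorphism on `ℤ[ω, √7]` with given values at `ω` and `√7`. -/
def lift {R : Type*} [CommRing R] (w s : R) (hw : w * w = w + 3) (hs : s * s = 7) : ZB →+* R where
  toFun x := (x.re.re + x.re.im * w) + (x.im.re + x.im.im * w) * s
  map_one' := by simp
  map_zero' := by simp
  map_add' x y := by simp; ring
  map_mul' x y := by
    simp only [re_mul, im_mul, re_add, im_add, re_ofNat, im_ofNat, re_zero, im_zero]
    push_cast
    linear_combination
      (-(x.re.im * y.re.im + (x.re.im * y.im.im + x.im.im * y.re.im) * s) : R) * hw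
      - (7 * x.im.im * y.im.im : R) * hw
      - ((x.im.re + x.im.im * w) * (y.im.re + y.im.im * w) : R) * hs

lemma lift_apply {R : Type*} [CommRing R] {w s : R} (hw : w * w = w + 3) (hs : s * s = 7) (x : ZB) :
    lift w s hw hs x = (x.re.re + x.re.im * w) + (x.im.re + x.im.im * w) * s := rfl

lemma not_sq_seven (x : ZW) : x * x ≠ 7 := by
  intro h
  have h1 := congrArg QuadraticAlgebra.re h
  have h2 := congrArg QuadraticAlgebra.im h
  simp only [re_mul, im_mul, re_ofNat, im_ofNat] at h1 h2
  have h3 : x.im * (2 * x.re + x.im) = 0 := by linarith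
  rcases mul_eq_zero.1 h3 with h4 | h4
  · rw [h4] at h1
    have h5 : x.re * x.re = 7 := by linarith
    have h6 : x.re < 3 := by nlinarith
    have h7 : -3 < x.re := by nlinarith
    generalize x.re = a at *
    interval_cases a <;> omega
  · have h5 : x.im = -2 * x.re := by linarith
    rw [h5] at h1
    have h6 : 13 * (x.re * x.re) = 7 := by linarith
    omega

lemma norm_eq_zero {x : ZB} : x.norm = 0 ↔ x = 0 := by
  refine ⟨fun h => ?_, fun h => by rw [h, QuadraticAlgebra.norm_zero]⟩
  rw [norm_eq] at h
  by_cases h0 : x.im = 0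
  · rw [h0] at h
    have : x.re * x.re = 0 := by linear_combination h
    ext1
    · simpa using this
    · simpa using h0
  · exfalso
    have h1 : x.im ^ 2 ∣ x.re ^ 2 := ⟨7, by linear_combination h⟩
    obtain ⟨w, hw⟩ := (IsIntegrallyClosed.pow_dvd_pow_iff two_ne_zero).1 h1
    apply not_sq_seven w
    rw [hw] at h
    have h2 : x.im * x.im * (w * w - 7) = 0 := by linear_combination h
    have h3 := (mul_eq_zero.1 h2).resolve_left (mul_self_ne_zero.2 h0)
    linear_combination h3

instance : IsDomain ZB := by
  have : NoZeroDivisors ZB := ⟨fun {x y} h => by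
    rw [← norm_eq_zero, map_mul, mul_eq_zero, norm_eq_zero, norm_eq_zero] at h
    exact h⟩
  exact NoZeroDivisors.to_isDomain _

instance : Module.Finite ℤ ZB := Module.Finite.trans ZW ZB

instance : Ring.HasFiniteQuotients ZB := Ring.HasFiniteQuotients.of_module_finite ℤ ZB

instance : CharZero ZB := charZero_of_injective_algebraMap
  (R := ℤ) (algebraMap ℤ ZB).injective_int

/-- An element of the fraction field that is integral lies in the ring. -/
lemma dvd_of_isIntegral_div {F : Type*} [Field F] {f : ZW →+* F} (hf : Function.Injective f)
    {u n : ZW} (hn : n ≠ 0) (h : IsIntegral ℤ (f u / f n)) : n ∣ u := by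
  let := f.toAlgebra
  let g : FractionRing ZW →ₐ[ZW] F := IsFractionRing.liftAlgHom (g := Algebra.ofId ZW F) hf
  have h1 : g (algebraMap ZW _ u / algebraMap ZW _ n) = f u / f n := by
    rw [map_div₀, AlgHom.commutes, AlgHom.commutes]; rfl
  rw [← h1] at h
  have h2 : IsIntegral ZW
      (algebraMap ZW (FractionRing ZW) u / algebraMap ZW (FractionRing ZW) n) :=
    (isIntegral_algHom_iff g g.toRingHom.injective).1 h.tower_top
  obtain ⟨y, hy⟩ := IsIntegrallyClosed.isIntegral_iff.1 h2
  refine ⟨y, ?_⟩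
  have hn' : algebraMap ZW (FractionRing ZW) n ≠ 0 := by
    simpa using hn
  rw [eq_div_iff hn', ← map_mul] at hy
  rw [← IsFractionRing.injective ZW (FractionRing ZW) hy, mul_comm]

/-- The prime 7 is unramified in ℤ[ω], so there are no nilpotents modulo 7. -/
lemma seven_dvd_of_sq {z : ZW} (h : 7 ∣ z * z) : 7 ∣ z := by
  obtain ⟨y, hy⟩ := h
  have h1 := congrArg QuadraticAlgebra.re hy
  have h2 := congrArg QuadraticAlgebra.im hy
  simp only [re_mul, im_mul, re_ofNat, im_ofNat] at h1 h2
  have key : ∀ a b : ZMod 7, a * a + 3 * b * b = 0 → a * b + b * a + b * b = 0 →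
      a = 0 ∧ b = 0 := by decide
  have h7 : (7 : ZMod 7) = 0 := rfl
  obtain ⟨ha, hb⟩ := key z.re z.im
    (by
      have := congrArg (Int.cast (R := ZMod 7)) h1
      push_cast at this
      rw [this, h7]; ring)
    (by
      have := congrArg (Int.cast (R := ZMod 7)) h2
      push_cast at this
      linear_combination this + ((y.im : ZMod 7)) * h7)
  obtain ⟨c, hc⟩ := (ZMod.intCast_zmod_eq_zero_iff_dvd z.re 7).1 ha
  obtain ⟨d, hd⟩ := (ZMod.intCast_zmod_eq_zero_iff_dvd z.im 7).1 hb
  refine ⟨⟨c, d⟩, ?_⟩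
  ext
  · simpa using hc
  · simpa using hd

/-- The form is u² + v² modulo 4. This is the reason that √7 needs no denominator 2 in an integral
basis. -/
lemma two_dvd_of_four_dvd {u v : ZW} (h : 4 ∣ u * u - 7 * (v * v)) : 2 ∣ u ∧ 2 ∣ v := by
  obtain ⟨y, hy⟩ := h
  have h1 := congrArg QuadraticAlgebra.re hy
  have h2 := congrArg QuadraticAlgebra.im hy
  simp only [re_mul, im_mul, re_ofNat, im_ofNat, re_sub, im_sub] at h1 h2
  have key : ∀ a b c d : ZMod 4, a * a + 3 * b * b - 7 * (c * c + 3 * d * d) = 0 →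
      a * b + b * a + b * b - 7 * (c * d + d * c + d * d) = 0 →
      (2 * a = 0 ∧ 2 * b = 0) ∧ 2 * c = 0 ∧ 2 * d = 0 := by decide
  have h4 : (4 : ZMod 4) = 0 := rfl
  obtain ⟨⟨ha, hb⟩, hc, hd⟩ := key u.re u.im v.re v.im
    (by
      have := congrArg (Int.cast (R := ZMod 4)) h1
      push_cast at this
      linear_combination this + (y.re : ZMod 4) * h4)
    (by
      have := congrArg (Int.cast (R := ZMod 4)) h2
      push_cast at this
      linear_combination this + (y.im : ZMod 4) * h4)
  have even : ∀ a : ℤ, (2 * (a : ZMod 4) = 0) → 2 ∣ a := fun a h => by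
    have h' : ((2 * a : ℤ) : ZMod 4) = 0 := by push_cast; exact h
    have := (ZMod.intCast_zmod_eq_zero_iff_dvd (2 * a) 4).1 h'
    omega
  obtain ⟨a, ha⟩ := even _ ha
  obtain ⟨b, hb⟩ := even _ hb
  obtain ⟨c, hc⟩ := even _ hc
  obtain ⟨d, hd⟩ := even _ hd
  refine ⟨⟨⟨a, b⟩, ?_⟩, ⟨⟨c, d⟩, ?_⟩⟩
  · ext
    · simpa using ha
    · simpa using hb
  · ext
    · simpa using hc
    · simpa using hd

/-- The hypotheses say that x/n has trace U and norm N in ℤ[ω]. Then 14·im(x)/n has square 7(U² -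
4N), so it is 7V, and U² - 7V² = 4N makes U and V even. -/
lemma algebraMap_dvd_of_dvd_norm {x : ZB} {n : ZW} (hn : n ≠ 0) (h1 : n ∣ 2 * x.re)
    (h2 : n * n ∣ x.norm) : algebraMap ZW ZB n ∣ x := by
  obtain ⟨U, hU⟩ := h1
  obtain ⟨N, hN⟩ := h2
  rw [norm_eq] at hN
  have h3 : n ^ 2 ∣ (14 * x.im) ^ 2 := ⟨7 * (U * U - 4 * N), by
    linear_combination (28 : ZW) * (-hN) + 7 * (2 * x.re + n * U) * hU⟩
  obtain ⟨Z, hZ⟩ := (IsIntegrallyClosed.pow_dvd_pow_iff two_ne_zero).1 h3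
  have hnn : n * n ≠ 0 := mul_self_ne_zero.2 hn
  have hZ2 : Z * Z = 7 * (U * U - 4 * N) := by
    apply mul_left_cancel₀ hnn
    linear_combination -(14 * x.im + n * Z) * hZ + (28 : ZW) * (-hN) + 7 * (2 * x.re + n * U) * hU
  obtain ⟨V, rfl⟩ := seven_dvd_of_sq ⟨_, hZ2⟩
  have h7 : (7 : ZW) ≠ 0 := by norm_num
  have h2' : (2 : ZW) ≠ 0 := by norm_num
  have hV : 2 * x.im = n * V := mul_left_cancel₀ h7 (by linear_combination hZ)
  have hUV : U * U - 7 * (V * V) = 4 * N := mul_left_cancel₀ h7 (by linear_combination -hZ2)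
  obtain ⟨⟨u, rfl⟩, ⟨v, rfl⟩⟩ := two_dvd_of_four_dvd ⟨N, hUV⟩
  refine ⟨⟨u, v⟩, ?_⟩
  ext1
  · rw [re_mul, algebraMap_re, algebraMap_im]
    apply mul_left_cancel₀ h2'
    linear_combination hU
  · rw [im_mul, algebraMap_re, algebraMap_im]
    apply mul_left_cancel₀ h2'
    linear_combination hV

/-- The conjugation `ω ↦ 1 - ω`. -/
def conjW : ZB ≃+* ZB where
  toFun x := ⟨star x.re, star x.im⟩
  invFun x := ⟨star x.re, star x.im⟩
  left_inv x := by simp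
  right_inv x := by simp
  map_add' x y := by ext1 <;> simp
  map_mul' x y := by
    ext1 <;> simp [mul_comm]

end ZB

/-! ### ℤ[ω, √7] is the ring of integers of F -/

namespace Example256

open ZB

/-- `√7` in `F`. -/
def s7F : F := ⟨s7, IntermediateField.subset_adjoin ℚ _ (by simp)⟩

/-- `√13` in `F`. -/
def s13F : F := ⟨s13, IntermediateField.subset_adjoin ℚ _ (by simp)⟩

lemma s7F_sq : s7F * s7F = 7 := Subtype.ext (by rw [← sq]; exact s7_sq)

lemma s13F_sq : s13F * s13F = 13 := Subtype.ext (by rw [← sq]; exact s13_sq)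

lemma wF_sq : (1 + s13F) / 2 * ((1 + s13F) / 2) = (1 + s13F) / 2 + 3 := by
  linear_combination s13F_sq / 4

/-- The embedding of `ℤ[ω, √7]` into `F`. -/
instance : Algebra ZB F := (ZB.lift ((1 + s13F) / 2) s7F wF_sq s7F_sq).toAlgebra

lemma algebraMap_F_apply (x : ZB) : algebraMap ZB F x =
    (x.re.re + x.re.im * ((1 + s13F) / 2)) + (x.im.re + x.im.im * ((1 + s13F) / 2)) * s7F := rfl

lemma algebraMap_F_injective : Function.Injective (algebraMap ZB F) := by
  rw [injective_iff_map_eq_zero]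
  intro x hx
  have h1 : algebraMap ZB F (x * star x) = 0 := by rw [map_mul, hx, zero_mul]
  rw [← QuadraticAlgebra.algebraMap_norm_eq_mul_star] at h1
  have h2 : algebraMap ZB F (algebraMap ZW ZB (x.norm * star x.norm)) = 0 := by
    rw [map_mul, map_mul, h1, zero_mul]
  rw [← QuadraticAlgebra.algebraMap_norm_eq_mul_star] at h2
  rw [algebraMap_F_apply] at h2
  have h3 : ((x.norm.norm : ℤ) : F) = 0 := by
    simpa using h2
  rw [Int.cast_eq_zero, ZW.norm_eq_zero, ZB.norm_eq_zero] at h3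
  exact h3

instance : FaithfulSMul ZB F := (faithfulSMul_iff_algebraMap_injective ZB F).2 algebraMap_F_injective

lemma exists_eq_div_intCast (z : F) : ∃ (x : ZB) (n : ℤ), n ≠ 0 ∧ z = algebraMap ZB F x / n := by
  obtain ⟨z, hz⟩ := z
  have hz' : z ∈ Algebra.adjoin ℚ ({s7, s13} : Set ℂ) := by
    rw [← IntermediateField.adjoin_toSubalgebra_of_isAlgebraic]
    · exact hz
    · rintro x (rfl | rfl)
      exacts [isAlgebraic_s7, isAlgebraic_s13]
  suffices h : ∃ (x : ZB) (n : ℤ), n ≠ 0 ∧ z = (algebraMap ZB F x : F) / n by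
    obtain ⟨x, n, hn, h⟩ := h
    exact ⟨x, n, hn, Subtype.ext (h.trans (by push_cast; rfl))⟩
  induction hz' using Algebra.adjoin_induction with
  | mem y hy =>
    rcases hy with rfl | rfl
    · refine ⟨ZB.mk 0 0 1 0, 1, one_ne_zero, ?_⟩
      rw [algebraMap_F_apply]
      simp [s7F]
    · refine ⟨ZB.mk (-1) 2 0 0, 1, one_ne_zero, ?_⟩
      rw [algebraMap_F_apply]
      simp only [s13F, s7F]
      push_cast
      have h2 : ((2 : F) : ℂ) = 2 := rfl
      simp
      rw [h2]; ring
  | algebraMap r =>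
    refine ⟨(r.num : ZB), r.den, by exact_mod_cast r.den_nz, ?_⟩
    rw [map_intCast]
    simp
    exact_mod_cast (Rat.num_div_den r).symm
  | add a b _ _ ha hb =>
    obtain ⟨x, n, hn, rfl⟩ := ha (IntermediateField.algebra_adjoin_le_adjoin ℚ _ ‹_›)
    obtain ⟨y, m, hm, rfl⟩ := hb (IntermediateField.algebra_adjoin_le_adjoin ℚ _ ‹_›)
    refine ⟨x * m + y * n, n * m, mul_ne_zero hn hm, ?_⟩
    have hn' : (n : ℂ) ≠ 0 := by exact_mod_cast hn
    have hm' : (m : ℂ) ≠ 0 := by exact_mod_cast hm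
    simp only [map_add, map_mul, map_intCast]
    push_cast
    field_simp
  | mul a b _ _ ha hb =>
    obtain ⟨x, n, hn, rfl⟩ := ha (IntermediateField.algebra_adjoin_le_adjoin ℚ _ ‹_›)
    obtain ⟨y, m, hm, rfl⟩ := hb (IntermediateField.algebra_adjoin_le_adjoin ℚ _ ‹_›)
    refine ⟨x * y, n * m, mul_ne_zero hn hm, ?_⟩
    simp only [map_mul]
    push_cast
    rw [div_mul_div_comm]

instance : IsFractionRing ZB F := IsFractionRing.of_field _ _ fun z => by
  obtain ⟨x, n, hn, rfl⟩ := exists_eq_div_intCast z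
  exact ⟨x, n, by rw [map_intCast]⟩

lemma isIntegral_algebraMap_F (x : ZB) : IsIntegral ℤ (algebraMap ZB F x) :=
  (Algebra.IsIntegral.isIntegral (R := ℤ) x).map (algebraMap ZB F).toIntAlgHom

/-- An integral x/n, with n rational, has integral conjugate over ℚ(√13); so its trace and norm lie
in ℤ[ω], and `algebraMap_dvd_of_dvd_norm` applies. -/
instance : IsIntegralClosure ZB ℤ F where
  algebraMap_injective := algebraMap_F_injective
  isIntegral_iff {z} := by
    refine ⟨fun h => ?_, fun ⟨x, hx⟩ => hx ▸ isIntegral_algebraMap_F x⟩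
    obtain ⟨x, n, hn, rfl⟩ := exists_eq_div_intCast z
    have hinj : Function.Injective ((algebraMap ZB F).comp (conjEquiv ZW 7 0 : ZB →+* ZB)) :=
      algebraMap_F_injective.comp (conjEquiv ZW 7 0).injective
    let σ : F →+* F := IsFractionRing.lift hinj
    have hσ : ∀ y : ZB, σ (algebraMap ZB F y) = algebraMap ZB F (star y) := fun y => by
      simp only [σ, IsFractionRing.lift_algebraMap]; rfl
    have h' : IsIntegral ℤ (algebraMap ZB F (star x) / n) := by
      have := h.map σ.toIntAlgHom
      simpa [hσ] using this
    have hinj' : Function.Injective ((algebraMap ZB F).comp (algebraMap ZW ZB)) :=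
      algebraMap_F_injective.comp QuadraticAlgebra.algebraMap_injective
    have hn0 : (n : ZW) ≠ 0 := by exact_mod_cast hn
    have h1 : (n : ZW) ∣ 2 * x.re := by
      apply dvd_of_isIntegral_div hinj' hn0
      have h3 := h.add h'
      have h4 : (algebraMap ZB F).comp (algebraMap ZW ZB) (2 * x.re) =
          algebraMap ZB F (x + star x) :=
        congrArg (algebraMap ZB F) (by ext1 <;> simp <;> ring)
      rw [h4, map_intCast]
      rwa [← add_div, ← map_add] at h3
    have h2 : (n : ZW) * n ∣ x.norm := by
      apply dvd_of_isIntegral_div hinj' (mul_ne_zero hn0 hn0)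
      have h3 := h.mul h'
      have h4 : (algebraMap ZB F).comp (algebraMap ZW ZB) x.norm =
          algebraMap ZB F (x * star x) :=
        congrArg (algebraMap ZB F) (QuadraticAlgebra.algebraMap_norm_eq_mul_star x)
      rw [h4, map_mul ((algebraMap ZB F).comp _), map_intCast]
      rwa [div_mul_div_comm, ← map_mul] at h3
    obtain ⟨y, hy⟩ := algebraMap_dvd_of_dvd_norm hn0 h1 h2
    refine ⟨y, ?_⟩
    have hnF : (n : F) ≠ 0 := by exact_mod_cast hn
    rw [eq_div_iff hnF, hy, map_mul, mul_comm]
    simp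

instance : IsDedekindDomain ZB := IsIntegralClosure.isDedekindDomain ℤ ℚ F ZB

end Example256

/-! ### Reciprocity for totally positive moduli, and the prime ρ above 3 -/

namespace ZW

open QuadraticAlgebra

/-- An element is totally positive if it is positive under both real embeddings. -/
def IsTotPos (x : ZW) : Prop := 0 < φ₁ x ∧ 0 < φ₂ x

lemma hs₂_of_isTotPos (x : ZW) {β : ZW} (h : IsTotPos β) : hs₂ x β = 1 := by
  rw [hs₂, hs_of_pos_right _ h.1, hs_of_pos_right _ h.2, one_mul]

lemma jac_neg_one_of_isTotPos {β : ZW} (hβ : IsPrimary β) (hp : IsTotPos β) :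
    jac (Ideal.span {β}) (-1) = 1 := by
  rw [jac_neg_one hβ, hs_of_pos_right _ (by rw [← φ₁_mul_φ₂]; exact mul_pos hp.1 hp.2)]

lemma jac_ε_of_isTotPos {β : ZW} (hβ : IsPrimary β) (hp : IsTotPos β) :
    jac (Ideal.span {β}) ε = 1 := by
  rw [jac_ε hβ, hs₂_of_isTotPos _ hp]

lemma isUnit_ε : IsUnit ε := isUnit_iff_norm_isUnit.2 (by rw [norm_ε]; exact isUnit_one.neg)

lemma span_unit_mul {x : ZW} (j k : ℕ) :
    Ideal.span {(-1) ^ j * ε ^ k * x} = Ideal.span {x} := by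
  refine Ideal.span_singleton_mul_left_unit ?_ x
  exact (isUnit_one.neg.pow j).mul (isUnit_ε.pow k)

lemma isCoprime_unit_mul {x y : ZW} (j k : ℕ) (h : IsCoprime x y) :
    IsCoprime ((-1) ^ j * ε ^ k * x) y := by
  rwa [isCoprime_mul_unit_left_left ((isUnit_one.neg.pow j).mul (isUnit_ε.pow k))]

/-- A sign and a power of ε make x primary without changing its ideal, and both have trivial symbol
modulo a totally positive primary β. The Hilbert symbols vanish as well. -/
lemma recip_of_isTotPos {β x : ZW} (hβ : IsPrimary β) (hp : IsTotPos β) (hx : x.norm % 2 = 1)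
    (hc : IsCoprime x β) : jac (Ideal.span {β}) x = jac (Ideal.span {x}) β := by
  obtain ⟨k, j, h⟩ := exists_unit_mul_isPrimary hx
  have h1 := recip h hβ (isCoprime_unit_mul j k hc)
  rw [span_unit_mul, jac_mul, jac_mul, jac_pow, jac_pow, jac_neg_one_of_isTotPos hβ hp,
    jac_ε_of_isTotPos hβ hp, one_pow, one_pow, one_mul, one_mul, hs₂_of_isTotPos _ hp] at h1
  have h2 := jac_sq_of_isCoprime hc
  rcases mul_self_eq_one_iff.1 h2 with h3 | h3 <;> rw [h3] at h1 ⊢ <;> linarith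

/-- A prime element of norm `-3`. -/
def ρ : ZW := ⟨5, 4⟩

lemma norm_ρ : ρ.norm = -3 := by rw [norm_eq]; rfl

lemma isPrimary_ρ : IsPrimary ρ := ⟨rfl, rfl⟩

lemma sqrt_thirteen_bounds : 3.6 < √13 ∧ √13 < 3.61 :=
  ⟨Real.lt_sqrt_of_sq_lt (by norm_num), by rw [Real.sqrt_lt' (by norm_num)]; norm_num⟩

lemma φ₁_ρ : 0 < φ₁ ρ := by
  rw [φ₁_apply]; have := sqrt_thirteen_bounds; simp only [ρ]; push_cast; linarith

lemma φ₂_ρ : φ₂ ρ < 0 := by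
  rw [φ₂_apply]; have := sqrt_thirteen_bounds; simp only [ρ]; push_cast; linarith

lemma φ₂_ε : φ₂ ε < 0 := by
  rw [φ₂_apply]; have := sqrt_thirteen_bounds; simp only [ε]; push_cast; linarith

/-- The sign at the second real place. -/
def sgn₂ (x : ZW) : ℤ := hs (-1) (φ₂ x)

lemma sgn₂_mul {x y : ZW} (hx : x ≠ 0) (hy : y ≠ 0) : sgn₂ (x * y) = sgn₂ x * sgn₂ y := by
  rw [sgn₂, map_mul, hs_mul_right (φ₂_ne_zero hx) (φ₂_ne_zero hy)]; rfl

lemma sgn₂_mul_self (x : ZW) : sgn₂ x * sgn₂ x = 1 := hs_mul_self _ _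

lemma hs₂_ρ (x : ZW) : hs₂ ρ x = sgn₂ x := by
  rw [hs₂, hs_of_pos_left _ φ₁_ρ, one_mul, sgn₂, hs, hs]
  simp [φ₂_ρ]

lemma sgn₂_neg_one : sgn₂ (-1) = -1 := by rw [sgn₂, map_neg, map_one, hs_neg_one_neg_one]

lemma sgn₂_ε : sgn₂ ε = -1 := by rw [sgn₂, hs_of_neg (by norm_num) φ₂_ε]

lemma jac_ρ_neg_one : jac (Ideal.span {ρ}) (-1) = -1 := by
  rw [jac_neg_one isPrimary_ρ, norm_ρ, hs_of_neg (by norm_num) (by norm_num)]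

lemma jac_ρ_ε : jac (Ideal.span {ρ}) ε = -1 := by
  rw [jac_ε isPrimary_ρ, hs₂_comm, hs₂_ρ, sgn₂_ε]

lemma jac_ρ_two : jac (Ideal.span {ρ}) 2 = -1 := by
  rw [jac_two isPrimary_ρ]; rfl

lemma sgn₂_pow {x : ZW} (hx : x ≠ 0) (n : ℕ) : sgn₂ (x ^ n) = sgn₂ x ^ n := by
  induction n with
  | zero => simp [sgn₂, hs_of_pos_right]
  | succ n ih => rw [pow_succ, sgn₂_mul (pow_ne_zero _ hx) hx, ih, pow_succ]

/-- The symbol at a prime of norm `3` in terms of the reciprocal symbol. -/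
lemma jac_span_ρ {x : ZW} (hx : x.norm % 2 = 1) (hc : IsCoprime ρ x) :
    jac (Ideal.span {x}) ρ = jac (Ideal.span {ρ}) x * sgn₂ x := by
  obtain ⟨k, j, h⟩ := exists_unit_mul_isPrimary hx
  have hx0 : x ≠ 0 := by rintro rfl; simp at hx
  have h1 := recip isPrimary_ρ h (isCoprime_unit_mul j k hc.symm).symm
  rw [span_unit_mul, jac_mul, jac_mul, jac_pow, jac_pow, jac_ρ_neg_one, jac_ρ_ε, hs₂_ρ,
    sgn₂_mul (mul_ne_zero (pow_ne_zero _ (by norm_num)) (pow_ne_zero _ ε_ne_zero)) hx0,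
    sgn₂_mul (pow_ne_zero _ (by norm_num)) (pow_ne_zero _ ε_ne_zero), sgn₂_pow (by norm_num),
    sgn₂_pow ε_ne_zero, sgn₂_neg_one, sgn₂_ε] at h1
  have h2 := jac_sq_of_isCoprime hc.symm
  have h3 : ∀ n : ℕ, ((-1 : ℤ) ^ n) * (-1) ^ n = 1 := fun n => by
    rw [← mul_pow]; norm_num
  have h4 := h3 j
  have h5 := h3 k
  generalize ((-1 : ℤ) ^ j) = s at *
  generalize ((-1 : ℤ) ^ k) = t at *
  generalize jac (Ideal.span {ρ}) x = u at *
  generalize jac (Ideal.span {x}) ρ = v at *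
  have h6 : (s * s) * (t * t) * (v * u) = (s * s) * (t * t) * sgn₂ x := by
    linear_combination (s * t) * h1
  rw [h4, h5] at h6
  linear_combination (-v) * h2 + u * h6

lemma two_dvd_of_norm {x : ZW} (h : x.norm % 2 ≠ 1) : 2 ∣ x := by
  rw [norm_eq] at h
  have h2 : x.re % 2 = 0 ∧ x.im % 2 = 0 := by
    rcases Int.emod_two_eq_zero_or_one x.re with h1 | h1 <;>
    rcases Int.emod_two_eq_zero_or_one x.im with h2 | h2
    · exact ⟨h1, h2⟩
    all_goals
      exfalso
      apply h
      simp [Int.sub_emod, Int.add_emod, Int.mul_emod, h1, h2]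
  refine ⟨⟨x.re / 2, x.im / 2⟩, ?_⟩
  ext
  · simp; omega
  · simp; omega

lemma exists_eq_two_pow_mul {x : ZW} (hx : x ≠ 0) :
    ∃ (i : ℕ) (y : ZW), y.norm % 2 = 1 ∧ x = 2 ^ i * y := by
  have h2 : ¬ IsUnit (2 : ZW) := by
    rw [isUnit_iff_norm_isUnit, norm_eq]
    simp [Int.isUnit_iff]
  obtain ⟨y, h3, hy⟩ :=
    (FiniteMultiplicity.of_not_isUnit h2 hx).exists_eq_pow_mul_and_not_dvd
  refine ⟨_, y, ?_, h3⟩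
  by_contra h
  exact hy (two_dvd_of_norm h)

/-- The element `ω² ^ 2 - 28`. -/
def μ : ZW := ⟨-16, 7⟩

lemma μ_mul : μ * ε ^ 4 = ρ := by decide

/-- The two elements differ by ε⁴, the square of a unit. -/
lemma jac_μ {x : ZW} : jac (Ideal.span {x}) μ = jac (Ideal.span {x}) ρ := by
  have h1 := jac_sq_of_isCoprime (x := ε) (y := x)
    ⟨⟨-2, 1⟩, 0, by rw [zero_mul, add_zero]; decide⟩
  rw [← μ_mul, jac_mul, jac_pow]
  generalize jac (Ideal.span {x}) ε = u at *
  have : u ^ 4 = 1 := by linear_combination (u * u + 1) * h1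
  rw [this, mul_one]

lemma isCoprime_μ {x : ZW} (h : IsCoprime x ρ) : IsCoprime x μ := by
  rw [← μ_mul] at h; exact h.of_mul_right_left

lemma ρ_dvd_three : ρ ∣ 3 := ⟨⟨-9, 4⟩, by decide⟩

lemma isCoprime_ρ_of_three {x : ZW} (h : IsCoprime x 3) : IsCoprime x ρ :=
  h.of_isCoprime_of_dvd_right ρ_dvd_three

lemma jac_sq_right {x y : ZW} (h : IsCoprime y x) : jac (Ideal.span {x}) (y * y) = 1 := by
  rw [jac_mul, jac_sq_of_isCoprime h]

end ZW

/-! ### The symbols of d_i modulo an element of the ray -/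

namespace ZB

open QuadraticAlgebra ZW

lemma span_ne_bot {x : ZB} (hx : x ≠ 0) : Ideal.span {x} ≠ ⊥ := by
  simpa [Ideal.span_singleton_eq_bot] using hx

lemma jac_algebraMap' {γ : ZB} (hγ : γ ≠ 0) (r : ZW) :
    jac (Ideal.span {γ}) (algebraMap ZW ZB r) = jac (Ideal.span {γ.norm}) r := by
  have h := jac_algebraMap (R := ZW) (span_ne_bot hγ) r
  rwa [Ideal.relNorm_singleton, intNorm_quadraticAlgebra] at h

lemma jac_mul_span {x y : ZB} (hx : x ≠ 0) (hy : y ≠ 0) (z : ZB) :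
    jac (Ideal.span {x * y}) z = jac (Ideal.span {x}) z * jac (Ideal.span {y}) z := by
  rw [← Ideal.span_singleton_mul_span_singleton, jac_mul_ideal (span_ne_bot hx) (span_ne_bot hy)]

lemma jac_span_algebraMap {g : ZW} (hg : g ≠ 0) {x : ZB} (h : IsCoprime x.norm g) :
    jac (Ideal.span {algebraMap ZW ZB g}) x = jac (Ideal.span {g}) x.norm := by
  have h1 : (Ideal.span {g}).map (algebraMap ZW ZB) = Ideal.span {algebraMap ZW ZB g} := by
    rw [Ideal.map_span, Set.image_singleton]
  rw [← h1, jac_map_of_isCoprime (ZW.span_ne_bot hg)]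
  rw [← Ideal.isCoprime_iff_sup_eq, Ideal.isCoprime_span_singleton_iff]
  exact h

/-- An element is totally positive if it is positive under all real embeddings. -/
def IsTotPos (x : ZB) : Prop := ∀ φ : ZB →+* ℝ, 0 < φ x

lemma sq_φ₁ : ((1 + √13) / 2 : ℝ) * ((1 + √13) / 2) = (1 + √13) / 2 + 3 := by
  have : √13 * √13 = (13 : ℝ) := Real.mul_self_sqrt (by norm_num)
  linear_combination this / 4

lemma sq_φ₂ : ((1 - √13) / 2 : ℝ) * ((1 - √13) / 2) = (1 - √13) / 2 + 3 := by
  have : √13 * √13 = (13 : ℝ) := Real.mul_self_sqrt (by norm_num)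
  linear_combination this / 4

lemma sqrt_seven_sq : √7 * √7 = (7 : ℝ) := Real.mul_self_sqrt (by norm_num)

lemma neg_sqrt_seven_sq : -√7 * -√7 = (7 : ℝ) := by rw [neg_mul_neg, sqrt_seven_sq]

lemma IsTotPos.φ₁_pos {x : ZB} (h : IsTotPos x) :
    0 < φ₁ x.re + φ₁ x.im * √7 ∧ 0 < φ₁ x.re - φ₁ x.im * √7 := by
  have h1 := h (lift _ _ sq_φ₁ sqrt_seven_sq)
  have h2 := h (lift _ _ sq_φ₁ neg_sqrt_seven_sq)
  rw [lift_apply] at h1 h2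
  rw [φ₁_apply, φ₁_apply]
  constructor <;> linarith

lemma IsTotPos.φ₂_pos {x : ZB} (h : IsTotPos x) :
    0 < φ₂ x.re + φ₂ x.im * √7 ∧ 0 < φ₂ x.re - φ₂ x.im * √7 := by
  have h1 := h (lift _ _ sq_φ₂ sqrt_seven_sq)
  have h2 := h (lift _ _ sq_φ₂ neg_sqrt_seven_sq)
  rw [lift_apply] at h1 h2
  rw [φ₂_apply, φ₂_apply]
  constructor <;> linarith

lemma IsTotPos.norm {x : ZB} (h : IsTotPos x) : ZW.IsTotPos x.norm := by
  have h1 := mul_pos h.φ₁_pos.1 h.φ₁_pos.2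
  have h2 := mul_pos h.φ₂_pos.1 h.φ₂_pos.2
  have h7 := sqrt_seven_sq
  have e1 : φ₁ x.norm = φ₁ x.re * φ₁ x.re - 7 * φ₁ x.im * φ₁ x.im := by
    rw [norm_eq, map_sub, map_mul, map_mul, map_mul, map_ofNat]
  have e2 : φ₂ x.norm = φ₂ x.re * φ₂ x.re - 7 * φ₂ x.im * φ₂ x.im := by
    rw [norm_eq, map_sub, map_mul, map_mul, map_mul, map_ofNat]
  constructor
  · rw [e1]; linear_combination h1 - φ₁ x.im * φ₁ x.im * h7
  · rw [e2]; linear_combination h2 - φ₂ x.im * φ₂ x.im * h7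

lemma isPrimary_norm {γ : ZB} (h : 6 ∣ γ - 1) : IsPrimary γ.norm := by
  obtain ⟨⟨m, n⟩, hm⟩ := h
  have h1 : γ = ⟨1 + 6 * m, 6 * n⟩ := by
    rw [sub_eq_iff_eq_add'.1 hm]; ext1 <;> simp
  have h2 : γ.norm = 1 + 4 * (3 * m + 9 * (m * m) - 63 * (n * n)) := by
    rw [h1, norm_eq]; ring
  rw [h2]
  generalize 3 * m + 9 * (m * m) - 63 * (n * n) = z
  constructor
  · simp
  · simp

lemma jac_neg_one_eq_one {γ : ZB} (h6 : 6 ∣ γ - 1) (hp : IsTotPos γ) (h0 : γ ≠ 0) :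
    jac (Ideal.span {γ}) (-1) = 1 := by
  have := jac_algebraMap' h0 (-1)
  rw [jac_neg_one_of_isTotPos (isPrimary_norm h6) hp.norm] at this
  simpa using this

lemma jac_ε_eq_one {γ : ZB} (h6 : 6 ∣ γ - 1) (hp : IsTotPos γ) (h0 : γ ≠ 0) :
    jac (Ideal.span {γ}) (algebraMap ZW ZB ε) = 1 := by
  rw [jac_algebraMap' h0, jac_ε_of_isTotPos (isPrimary_norm h6) hp.norm]

/-- The element `ω² + 2√7`. -/
def n₁ : ZB := mk 3 1 2 0

lemma norm_n₁ : n₁.norm = μ := by rw [norm_eq]; decide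

/-- Modulo γ = c + 2e√7 one has e·n₁ ≡ eω² - c = n, so the symbol is (e/β)(n/β) with β = N γ.
Reciprocity gives (e/β) = 1 since β ≡ c² mod e. It gives (n/β) = (n/ρ)·`sgn₂ n` since β ≡ e²μ mod n,
where μ is ρ up to squares. The role of `g` is only to name the sign of n. -/
lemma jac_n₁_of_coprime {c e g : ZW} (hce : IsCoprime c e) (he : e ≠ 0) (h3e : 3 ∣ e)
    (h3c : IsCoprime c 3) (hβ : IsPrimary (c * c - 28 * (e * e)))
    (hβp : ZW.IsTotPos (c * c - 28 * (e * e)))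
    (hs : sgn₂ (e * ⟨3, 1⟩ - c) = - sgn₂ g) :
    jac (Ideal.span {(⟨c, 2 * e⟩ : ZB)}) n₁ = jac (Ideal.span {ρ}) c * sgn₂ g := by
  set β := c * c - 28 * (e * e) with hβdef
  set a : ZW := ⟨3, 1⟩ with ha
  set n := e * a - c with hn
  have hμ : a * a - 28 = μ := by decide
  set γ : ZB := ⟨c, 2 * e⟩ with hγ
  have hγβ : γ.norm = β := by rw [norm_eq]; simp [hγ, hβdef]; ring
  have hγ0 : γ ≠ 0 := by rw [Ne, ← norm_eq_zero, hγβ]; exact hβ.ne_zero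
  have hcβ : ∀ {x : ZW}, IsCoprime c x → x ∣ e → IsCoprime x β := fun {x} h ⟨y, hy⟩ => by
    have h1 : IsCoprime x (c * c) := h.symm.mul_right h.symm
    have h2 : β = c * c + x * (-28 * y * e) := by rw [hβdef]; linear_combination (-28) * e * hy
    rw [h2]; exact h1.add_mul_left_right _
  have heβ : IsCoprime e β := hcβ hce dvd_rfl
  have h3β : IsCoprime 3 β := hcβ h3c h3e
  have h3n : IsCoprime n 3 := by
    obtain ⟨y, hy⟩ := h3e
    have h2 : n = -c + 3 * (y * a) := by rw [hn, hy]; ring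
    rw [h2]; exact h3c.neg_left.add_mul_left_left _
  have hen : IsCoprime e n := by
    have h2 : n = -c + e * a := by rw [hn]; ring
    rw [h2]; exact hce.symm.neg_right.add_mul_left_right _
  -- Here a = ω², so c ≡ ea mod n and β ≡ e²(a² - 28) = e²μ.
  have hβn : β = e * e * μ + n * (-(c + e * a)) := by
    rw [← hμ, hβdef, hn]; ring
  have hnβ : IsCoprime n β := by
    rw [hβn]
    exact ((hen.symm.mul_right hen.symm).mul_right
      (isCoprime_μ (isCoprime_ρ_of_three h3n))).add_mul_left_right _
  have hn0 : n ≠ 0 := by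
    intro h0
    rw [h0, isCoprime_zero_left, isUnit_iff_norm_isUnit] at h3n
    rw [ZW.norm_eq] at h3n
    simp [Int.isUnit_iff] at h3n
  have e1 : jac (Ideal.span {γ}) (algebraMap ZW ZB e * n₁) =
      jac (Ideal.span {γ}) (algebraMap ZW ZB n) := by
    refine jac_congr (Ideal.mem_span_singleton'.2 ⟨1, ?_⟩)
    ext1
    · simp [hγ, hn, n₁, ha]
    · simp [hγ, n₁]
      ext <;> simp <;> ring
  rw [jac_mul, jac_algebraMap' hγ0, jac_algebraMap' hγ0, hγβ] at e1
  -- the symbol of `2`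
  obtain ⟨z, hz⟩ : ∃ z : ZW, β = 1 + 4 * z := by
    obtain ⟨m, k, h1, h2⟩ := hβ.exists_eq
    refine ⟨⟨m, k⟩, ?_⟩
    ext
    · rw [h1]; simp; ring
    · rw [h2]; simp
  have hcc : (c * c).re % 4 = 1 ∧ (c * c).im % 4 = 0 := by
    have : c * c = 1 + 4 * (z + 7 * (e * e)) := by linear_combination hz
    rw [this]
    generalize z + 7 * (e * e) = w
    constructor
    · simp
    · simp
  have hc2 : c.im % 2 = 0 ∧ c.re % 2 = 1 := by
    obtain ⟨h1, h2⟩ := hcc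
    rw [re_mul] at h1
    rw [im_mul] at h2
    have hy : c.im % 2 = 0 := by
      by_contra h
      obtain ⟨k, hk⟩ : ∃ k, c.im = 2 * k + 1 := ⟨c.im / 2, by omega⟩
      rw [hk] at h2
      ring_nf at h2
      omega
    refine ⟨hy, ?_⟩
    by_contra h
    obtain ⟨k, hk⟩ : ∃ k, c.im = 2 * k := ⟨c.im / 2, by omega⟩
    obtain ⟨l, hl⟩ : ∃ k, c.re = 2 * k := ⟨c.re / 2, by omega⟩
    rw [hk, hl] at h1
    ring_nf at h1
    omega
  have hcc8 : (c * c).im % 8 = 0 := by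
    obtain ⟨k, hk⟩ : ∃ k, c.im = 2 * k := ⟨c.im / 2, by omega⟩
    obtain ⟨l, hl⟩ : ∃ k, c.re = 2 * k + 1 := ⟨c.re / 2, by omega⟩
    have h1 : (c * c).im = 4 * (k * (2 * l + 1 + k)) := by rw [im_mul, hk, hl]; ring
    have h2 : k * (2 * l + 1 + k) % 2 = 0 := by
      rcases Int.even_or_odd' k with ⟨m, rfl | rfl⟩ <;> ring_nf <;> omega
    omega
  -- Reciprocity covers only odd arguments, so the factors 2 of e and n are evaluated separately.
  -- For even e, β ≡ c² mod 8.
  have h2e : 2 ∣ e → jac (Ideal.span {β}) 2 = 1 := fun ⟨y, hy⟩ => by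
    rw [jac_two hβ, if_pos]
    have : β = c * c - 8 * (14 * (y * y)) := by rw [hβdef, hy]; ring
    rw [this]
    have h8 : ∀ w : ZW, (8 * w).im = 8 * w.im := fun w => by simp
    rw [im_sub, h8]
    omega
  -- If n is even, c ≡ eω² mod 2 with c odd and rational modulo 2. So e ≡ ω mod 2, and 28e² shifts
  -- the ω-coordinate of β by 4 modulo 8. The value -1 equals (2/ρ), so powers of 2 in n do not
  -- disturb the comparison with ρ.
  have h2n : 2 ∣ n → jac (Ideal.span {β}) 2 = -1 := fun ⟨y, hy⟩ => by
    rw [jac_two hβ, if_neg]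
    have h4 := congrArg QuadraticAlgebra.re hy
    have h5 := congrArg QuadraticAlgebra.im hy
    simp [hn, ha] at h4 h5
    have h6 : e.re % 2 = 0 := by omega
    have h7 : e.im % 2 = 1 := by omega
    obtain ⟨k, hk⟩ : ∃ k, e.re = 2 * k := ⟨e.re / 2, by omega⟩
    obtain ⟨l, hl⟩ : ∃ k, e.im = 2 * k + 1 := ⟨e.im / 2, by omega⟩
    have h8 : (28 * (e * e)).im % 8 = 4 := by
      simp [hk, hl]
      ring_nf
      omega
    rw [hβdef, im_sub]
    omega
  -- the two factors
  have e2 : jac (Ideal.span {β}) e = 1 := by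
    obtain ⟨j, e', he', hej⟩ := exists_eq_two_pow_mul he
    have hde : e' ∣ e := ⟨2 ^ j, by rw [hej]; ring⟩
    have h1 : jac (Ideal.span {β}) e' = 1 := by
      rw [recip_of_isTotPos hβ hβp he' (heβ.of_isCoprime_of_dvd_left hde)]
      obtain ⟨y, hy⟩ := hde
      rw [jac_congr (y := c * c) (Ideal.mem_span_singleton'.2 ⟨-28 * y * e, by
        rw [hβdef]; linear_combination (28 * e) * hy⟩)]
      exact jac_sq_right (hce.of_isCoprime_of_dvd_right ⟨y, hy⟩)
    rw [hej, jac_mul, jac_pow, h1, mul_one]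
    rcases Nat.eq_zero_or_pos j with rfl | hj
    · rw [pow_zero]
    · rw [h2e (hej ▸ (dvd_pow_self 2 hj.ne').mul_right e'), one_pow]
  have e3 : jac (Ideal.span {β}) n = jac (Ideal.span {ρ}) n * sgn₂ n := by
    obtain ⟨i, n', hn', hni⟩ := exists_eq_two_pow_mul hn0
    have hdn : n' ∣ n := ⟨2 ^ i, by rw [hni]; ring⟩
    have hn'0 : n' ≠ 0 := by rintro rfl; simp at hn'
    have h1 : jac (Ideal.span {β}) n' = jac (Ideal.span {ρ}) n' * sgn₂ n' := by
      have hdn2 := hdn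
      obtain ⟨y, hy⟩ := hdn2
      rw [recip_of_isTotPos hβ hβp hn' (hnβ.of_isCoprime_of_dvd_left hdn),
        jac_congr (y := e * e * μ) (Ideal.mem_span_singleton'.2 ⟨y * (-(c + e * a)), by
          rw [hβn]; linear_combination (c + e * a) * hy⟩), jac_mul,
        jac_sq_right (hen.of_isCoprime_of_dvd_right hdn), one_mul, jac_μ]
      exact jac_span_ρ hn' ((isCoprime_ρ_of_three h3n).of_isCoprime_of_dvd_left hdn).symm
    have h2' : (2 : ZW) ≠ 0 := by norm_num
    have h2s : sgn₂ 2 = 1 := by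
      rw [sgn₂, map_ofNat, hs_of_pos_right _ (by norm_num)]
    rw [hni, jac_mul, jac_mul, jac_pow, jac_pow, jac_ρ_two, sgn₂_mul (pow_ne_zero _ h2') hn'0,
      sgn₂_pow h2', h2s, one_pow, one_mul, h1]
    rcases Nat.eq_zero_or_pos i with rfl | hi
    · simp
    · rw [h2n (hni ▸ (dvd_pow_self 2 hi.ne').mul_right n')]; ring
  have e4 : jac (Ideal.span {ρ}) n = - jac (Ideal.span {ρ}) c := by
    rw [jac_congr (y := -1 * c) ?_, jac_mul, jac_ρ_neg_one, neg_one_mul]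
    obtain ⟨y, hy⟩ := ρ_dvd_three.trans h3e
    exact Ideal.mem_span_singleton'.2 ⟨y * a, by rw [hn, hy]; ring⟩
  rw [e2, one_mul, e3, e4, hs] at e1
  rw [e1]; ring

end ZB

namespace ZB

open QuadraticAlgebra ZW

lemma jac_n₁_of_algebraMap {g : ZW} (hg : g.norm % 2 = 1) (h3 : IsCoprime g 3) :
    jac (Ideal.span {algebraMap ZW ZB g}) n₁ = jac (Ideal.span {ρ}) g * sgn₂ g := by
  have hg0 : g ≠ 0 := by rintro rfl; simp at hg
  have hc := isCoprime_ρ_of_three h3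
  rw [jac_span_algebraMap hg0 (by rw [norm_n₁]; exact (isCoprime_μ hc).symm), norm_n₁, jac_μ,
    jac_span_ρ hg hc.symm]

lemma jac_ρ_of_three {c m : ZW} (h : c = 1 + 6 * m) : jac (Ideal.span {ρ}) c = 1 := by
  obtain ⟨y, hy⟩ := ρ_dvd_three
  rw [jac_congr (y := 1) (Ideal.mem_span_singleton'.2 ⟨2 * y * m, by
    rw [h]; linear_combination (-(2 * m)) * hy⟩), jac_one_right]

lemma norm_odd {c m : ZW} (h : c = 1 + 6 * m) : c.norm % 2 = 1 := by
  rw [h, ZW.norm_eq]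
  simp
  ring_nf
  omega

/-- With g a primary gcd of the two coordinates of γ, write γ = g(c₀ + 2e√7). The two factors have
symbols (g/ρ)`sgn₂ g` and (c₀/ρ)`sgn₂ g`; their product is (gc₀/ρ) = 1, because gc₀ ≡ 1 mod 6 and ρ
divides 3. -/
lemma jac_n₁_eq_one {γ : ZB} (h6 : 6 ∣ γ - 1) (hp : IsTotPos γ) :
    jac (Ideal.span {γ}) n₁ = 1 := by
  have hprim := isPrimary_norm h6
  obtain ⟨⟨m, n⟩, hm⟩ := h6
  obtain ⟨c, e'⟩ := γ
  have hc : c = 1 + 6 * m := by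
    have := congrArg QuadraticAlgebra.re hm
    simp at this
    rw [sub_eq_iff_eq_add'.1 this]
  have he' : e' = 6 * n := by
    have := congrArg QuadraticAlgebra.im hm
    simpa using this
  have hcodd := norm_odd hc
  have hc3 : IsCoprime c 3 := ⟨1, -2 * m, by rw [hc]; ring⟩
  have hc6 : IsCoprime c 6 := ⟨1, -m, by rw [hc]; ring⟩
  by_cases hn : n = 0
  · have h1 : (⟨c, e'⟩ : ZB) = algebraMap ZW ZB c := by
      rw [he', hn, mul_zero]; rfl
    have h2 : sgn₂ c = 1 := by
      have h3 := add_pos hp.φ₂_pos.1 hp.φ₂_pos.2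
      simp only at h3
      exact hs_of_pos_right _ (by linarith)
    rw [h1, jac_n₁_of_algebraMap hcodd hc3, jac_ρ_of_three hc, h2, one_mul]
  obtain ⟨g, hgprim, hgc, hge, u, v, huv⟩ : ∃ g : ZW, IsPrimary g ∧ g ∣ c ∧ g ∣ e' ∧
      ∃ u v, u * c + v * e' = g := by
    obtain ⟨⟨g, hg⟩⟩ := IsPrincipalIdealRing.principal (Ideal.span {c, e'})
    change _ = Ideal.span {g} at hg
    have hgodd : g.norm % 2 = 1 := by
      have h1 : c ∈ Ideal.span {g} := hg ▸ Ideal.subset_span (by simp)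
      obtain ⟨y, rfl⟩ := Ideal.mem_span_singleton.1 h1
      by_contra h
      rw [map_mul, Int.mul_emod, (by omega : g.norm % 2 = 0), zero_mul] at hcodd
      simp at hcodd
    obtain ⟨k, j, hkj⟩ := exists_unit_mul_isPrimary hgodd
    rw [← span_unit_mul j k] at hg
    refine ⟨_, hkj, ?_, ?_, ?_⟩
    · rw [← Ideal.mem_span_singleton, ← hg]; exact Ideal.subset_span (by simp)
    · rw [← Ideal.mem_span_singleton, ← hg]; exact Ideal.subset_span (by simp)
    · rw [← Ideal.mem_span_pair, hg]; exact Ideal.mem_span_singleton_self _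
  obtain ⟨c₀, hc₀⟩ := hgc
  obtain ⟨e₀, he₀⟩ := hge
  have hg0 := hgprim.ne_zero
  have hcop : IsCoprime c₀ e₀ := ⟨u, v, mul_left_cancel₀ hg0 (by
    linear_combination huv - u * hc₀ - v * he₀)⟩
  have hgc' : g ∣ c := ⟨c₀, hc₀⟩
  have h6e : 6 ∣ e₀ := (hc6.of_isCoprime_of_dvd_left hgc').symm.dvd_of_dvd_mul_left
    ⟨n, by rw [← he₀, he']⟩
  obtain ⟨k, rfl⟩ := h6e
  have hk0 : k ≠ 0 := by
    rintro rfl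
    rw [he₀, mul_zero, mul_zero] at he'
    rcases mul_eq_zero.1 he'.symm with h | h
    · norm_num at h
    · exact hn h
  set e : ZW := 3 * k with he
  have hγ : (⟨c, e'⟩ : ZB) = algebraMap ZW ZB g * ⟨c₀, 2 * e⟩ := by
    ext1
    · simp [hc₀]
    · simp only [im_mul, algebraMap_re, algebraMap_im, he₀, he]; ring
  have hN : (⟨c, e'⟩ : ZB).norm = (g * g) * (c₀ * c₀ - 28 * (e * e)) := by
    rw [hγ, map_mul, QuadraticAlgebra.norm_algebraMap, norm_eq]; simp; ring
  have hβ : IsPrimary (c₀ * c₀ - 28 * (e * e)) :=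
    IsPrimary.of_mul (hgprim.mul hgprim) (hN ▸ hprim)
  have hβp : ZW.IsTotPos (c₀ * c₀ - 28 * (e * e)) := by
    have h1 := hp.norm
    rw [hN] at h1
    obtain ⟨h2, h3⟩ := h1
    rw [map_mul, map_mul] at h2 h3
    exact ⟨(mul_pos_iff_of_pos_left (mul_self_pos.2 (φ₁_ne_zero hg0))).1 h2,
      (mul_pos_iff_of_pos_left (mul_self_pos.2 (φ₂_ne_zero hg0))).1 h3⟩
  -- At the second real place ω² lies between 0 and 2√7, while total positivity makes c₀ ± 2e√7 have
  -- the sign of g; hence eω² - c₀ has the opposite sign.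
  have hs : sgn₂ (e * ⟨3, 1⟩ - c₀) = - sgn₂ g := by
    obtain ⟨h1, h2⟩ := hp.φ₂_pos
    have h3 : e' = g * (2 * e) := by rw [he₀, he]; ring
    simp only [hc₀, h3, map_mul, map_ofNat] at h1 h2
    have h7 : 2.64 < √7 := Real.lt_sqrt_of_sq_lt (by norm_num)
    have h13 := sqrt_thirteen_bounds
    have ha1 : φ₂ ⟨3, 1⟩ < 1.8 := by rw [φ₂_apply]; push_cast; linarith
    have ha2 : 0 < φ₂ ⟨3, 1⟩ := by rw [φ₂_apply]; push_cast; linarith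
    have hg := φ₂_ne_zero hg0
    have h4 : φ₂ (e * ⟨3, 1⟩ - c₀) = φ₂ e * φ₂ ⟨3, 1⟩ - φ₂ c₀ := by rw [map_sub, map_mul]
    unfold sgn₂
    rw [h4]
    clear h4
    generalize φ₂ ⟨3, 1⟩ = a at *
    generalize φ₂ g = G at *
    generalize φ₂ c₀ = C at *
    generalize φ₂ e = E at *
    have h1' : 0 < G * (C + 2 * E * √7) := by linarith
    have h2' : 0 < G * (C - 2 * E * √7) := by linarith
    rcases lt_or_gt_of_ne hg with h | h
    · have h5 : C + 2 * E * √7 < 0 := by nlinarith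
      have h6 : C - 2 * E * √7 < 0 := by nlinarith
      rw [hs_of_neg (by norm_num) h, hs_of_pos_right _ (by
        rcases le_or_gt 0 E with hE | hE <;> nlinarith)]
      rfl
    · have h5 := (mul_pos_iff_of_pos_left h).1 h1'
      have h6 := (mul_pos_iff_of_pos_left h).1 h2'
      rw [hs_of_neg (by norm_num) (by
        rcases le_or_gt 0 E with hE | hE <;> nlinarith), hs_of_pos_right _ h]
  have hc₀c : c₀ ∣ c := ⟨g, by rw [hc₀]; ring⟩
  have h3 : (3 : ZW) ≠ 0 := by norm_num
  have he0 : e ≠ 0 := mul_ne_zero h3 hk0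
  have key := jac_n₁_of_coprime (g := g)
    (hcop.of_isCoprime_of_dvd_right ⟨2, by simp only [he]; ring⟩)
    he0 (Dvd.intro k rfl) (hc3.of_isCoprime_of_dvd_left hc₀c) hβ hβp hs
  have hγ₀ : (⟨c₀, 2 * e⟩ : ZB) ≠ 0 := by
    intro h
    have h1 := congrArg QuadraticAlgebra.norm h
    rw [norm_eq, QuadraticAlgebra.norm_zero] at h1
    apply hβ.ne_zero
    rw [← h1]; simp; ring
  have hgodd : g.norm % 2 = 1 := by have := hgprim.norm_mod; omega
  have hgB : algebraMap ZW ZB g ≠ 0 := by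
    rw [Ne, FaithfulSMul.algebraMap_eq_zero_iff]; exact hg0
  rw [hγ, jac_mul_span hgB hγ₀, key,
    jac_n₁_of_algebraMap hgodd (hc3.of_isCoprime_of_dvd_left hgc')]
  have h1 : jac (Ideal.span {ρ}) g * jac (Ideal.span {ρ}) c₀ = 1 := by
    rw [← jac_mul, ← hc₀, jac_ρ_of_three hc]
  linear_combination (sgn₂ g * sgn₂ g) * h1 + sgn₂_mul_self g

lemma isTotPos_map {γ : ZB} (h : IsTotPos γ) (e : ZB ≃+* ZB) : IsTotPos (e γ) :=
  fun φ => h (φ.comp e)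

lemma six_dvd_map {γ : ZB} (h : 6 ∣ γ - 1) (e : ZB ≃+* ZB) : 6 ∣ e γ - 1 := by
  have := map_dvd e h
  rwa [map_sub, map_one, map_ofNat] at this

/-- Symbols are equivariant under automorphisms, and the ray is stable under them. -/
lemma jac_map_n₁_eq_one (e : ZB ≃+* ZB) {γ : ZB} (h6 : 6 ∣ γ - 1) (hp : IsTotPos γ)
    (h0 : γ ≠ 0) : jac (Ideal.span {γ}) (e n₁) = 1 := by
  have h1 := jac_n₁_eq_one (six_dvd_map h6 e.symm) (isTotPos_map hp e.symm)
  have h2 : e.symm γ ≠ 0 := by simpa using h0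
  rw [← jac_map_ringEquiv e (span_ne_bot h2), Ideal.map_span, Set.image_singleton] at h1
  simpa using h1

/-- The six elements of `ℤ[ω, √7]` whose square roots generate `N'` over `F`. -/
def d : Fin 6 → ZB :=
  ![-1, algebraMap ZW ZB ε, n₁, star n₁, conjW n₁, conjW (star n₁)]

lemma jac_d_eq_one {γ : ZB} (h6 : 6 ∣ γ - 1) (hp : IsTotPos γ) (h0 : γ ≠ 0) (i : Fin 6) :
    jac (Ideal.span {γ}) (d i) = 1 := by
  fin_cases i
  · exact jac_neg_one_eq_one h6 hp h0
  · exact jac_ε_eq_one h6 hp h0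
  · exact jac_n₁_eq_one h6 hp
  · exact jac_map_n₁_eq_one (conjEquiv ZW 7 0) h6 hp h0
  · exact jac_map_n₁_eq_one conjW h6 hp h0
  · exact jac_map_n₁_eq_one ((conjEquiv ZW 7 0).trans conjW) h6 hp h0

end ZB

/-! ### Discriminant of ℤ[ω, √7] and its primes of small norm -/

open QuadraticAlgebra in
lemma Algebra.norm_quadraticAlgebra {R : Type*} [CommRing R] {a b : R}
    (x : QuadraticAlgebra R a b) : Algebra.norm R x = x.norm := by
  rw [Algebra.norm_apply, ← det_toLinearMap_eq_norm]
  rfl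

lemma Algebra.trace_quadraticAlgebra {R : Type*} [CommRing R] {a b : R}
    (x : QuadraticAlgebra R a b) : Algebra.trace R _ x = x.trace := by
  rw [Algebra.trace_eq_matrix_trace (QuadraticAlgebra.basis a b), Matrix.trace_fin_two,
    QuadraticAlgebra.trace_def]
  simp [Algebra.leftMulMatrix_eq_repr_mul, QuadraticAlgebra.basis]
  ring

namespace ZB

open QuadraticAlgebra

lemma trace_int (x : ZB) : Algebra.trace ℤ ZB x = 4 * x.re.re + 2 * x.re.im := by
  rw [← Algebra.trace_trace (S := ZW), Algebra.trace_quadraticAlgebra,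
    Algebra.trace_quadraticAlgebra, trace_def, trace_def]
  simp
  ring

lemma norm_int (x : ZB) : Algebra.norm ℤ x = x.norm.norm := by
  rw [← Algebra.norm_norm (S := ZW), Algebra.norm_quadraticAlgebra, Algebra.norm_quadraticAlgebra]

/-- The basis `1, ω, √7, ω√7`. -/
def intBasis : Module.Basis (Fin 2 × Fin 2) ℤ ZB :=
  (QuadraticAlgebra.basis (R := ℤ) 3 1).smulTower (QuadraticAlgebra.basis (R := ZW) 7 0)

lemma discr_intBasis : Algebra.discr ℤ intBasis = 364 ^ 2 := by
  have hb : ⇑intBasis ∘ finProdFinEquiv.symm = ![mk 1 0 0 0, mk 0 0 1 0, mk 0 1 0 0, mk 0 0 0 1] := by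
    have h1 : ∀ i j, intBasis (i, j) = (⟨⟨if i = 0 ∧ j = 0 then 1 else 0,
        if i = 1 ∧ j = 0 then 1 else 0⟩, ⟨if i = 0 ∧ j = 1 then 1 else 0,
        if i = 1 ∧ j = 1 then 1 else 0⟩⟩ : ZB) := by
      intro i j
      rw [intBasis, Module.Basis.smulTower_apply]
      fin_cases i <;> fin_cases j <;> ext <;> simp [QuadraticAlgebra.basis]
    funext i
    fin_cases i
    · exact h1 0 0
    · exact h1 0 1
    · exact h1 1 0
    · exact h1 1 1
  rw [← Algebra.discr_reindex ℤ _ (finProdFinEquiv (m := 2) (n := 2))]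
  rw [hb, Algebra.discr_def]
  have : Algebra.traceMatrix ℤ ![mk 1 0 0 0, mk 0 0 1 0, mk 0 1 0 0, mk 0 0 0 1] =
      !![4, 0, 2, 0; 0, 28, 0, 14; 2, 0, 14, 0; 0, 14, 0, 98] := by
    ext i j
    rw [Algebra.traceMatrix_apply, Algebra.traceForm_apply, trace_int]
    fin_cases i <;> fin_cases j <;> rfl
  rw [this]
  simp [Matrix.det_succ_row_zero, Fin.sum_univ_succ]
  decide

lemma absNorm_span (x : ZB) : Ideal.absNorm (Ideal.span {x}) = x.norm.norm.natAbs := by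
  rw [Ideal.absNorm_span_singleton, norm_int]

lemma eq_span_of_absNorm {P : Ideal ZB} {x : ZB} (hx : x ∈ P) (hP : Ideal.absNorm P ≠ 0)
    (h : x.norm.norm.natAbs = Ideal.absNorm P) : P = Ideal.span {x} := by
  obtain ⟨J, hJ⟩ := Ideal.dvd_iff_le.2 ((Ideal.span_singleton_le_iff_mem P).2 hx)
  have h1 := congrArg Ideal.absNorm hJ
  rw [map_mul, absNorm_span, h] at h1
  have h2 : Ideal.absNorm J = 1 := by
    have : Ideal.absNorm P * 1 = Ideal.absNorm P * Ideal.absNorm J := by rw [mul_one]; exact h1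
    exact (Nat.eq_of_mul_eq_mul_left (Nat.pos_of_ne_zero hP) this).symm
  rw [Ideal.absNorm_eq_one_iff.1 h2, Ideal.mul_top] at hJ
  exact hJ.symm

lemma exists_residue_hom {P : Ideal ZB} {p : ℕ} [Fact p.Prime] (h : Ideal.absNorm P = p) :
    ∃ τ : ZB →+* ZMod p, RingHom.ker τ = P := by
  have h1 : Nat.card (ZB ⧸ P) = p := by rw [← h]; rfl
  have : Finite (ZB ⧸ P) := Nat.finite_of_card_ne_zero (by rw [h1]; exact (Fact.out : p.Prime).ne_zero)
  let := Fintype.ofFinite (ZB ⧸ P)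
  let e := ZMod.ringEquivOfPrime (ZB ⧸ P) (Fact.out : p.Prime)
    (by rw [← h1, Nat.card_eq_fintype_card])
  refine ⟨(e.symm : (ZB ⧸ P) →+* ZMod p).comp (Ideal.Quotient.mk P), ?_⟩
  ext x
  rw [RingHom.mem_ker, RingHom.comp_apply]
  simp [Ideal.Quotient.eq_zero_iff_mem]

lemma hom_sq {R : Type*} [CommRing R] (τ : ZB →+* R) :
    τ (mk 0 1 0 0) * τ (mk 0 1 0 0) = τ (mk 0 1 0 0) + 3 ∧
    τ (mk 0 0 1 0) * τ (mk 0 0 1 0) = 7 := by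
  rw [← map_mul, ← map_mul, ← map_ofNat τ 3, ← map_ofNat τ 7, ← map_add]
  exact ⟨congrArg τ (by decide), congrArg τ (by decide)⟩

lemma hom_apply {R : Type*} [CommRing R] (τ : ZB →+* R) (x : ZB) :
    τ x = (x.re.re + x.re.im * τ (mk 0 1 0 0)) +
      (x.im.re + x.im.im * τ (mk 0 1 0 0)) * τ (mk 0 0 1 0) := by
  have h : x = ((x.re.re : ZB) + x.re.im * mk 0 1 0 0) +
      ((x.im.re : ZB) + x.im.im * mk 0 1 0 0) * mk 0 0 1 0 := by
    ext <;> simp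
  conv_lhs => rw [h]
  simp only [map_add, map_mul, map_intCast]

/-- The norm of P divides p². It is not p, since a residue field 𝔽_p would contain an image of ω; so
it is p², the norm of x, and x generates P. -/
lemma isPrincipal_of_mem_of_hom {P : Ideal ZB} [P.IsPrime] (hP : Ideal.absNorm P ≠ 0) {x : ZB}
    (hx : x ∈ P) {p : ℕ} (hp : p.Prime) (hn : x.norm.norm.natAbs = p ^ 2)
    (h : ∀ w : ZMod p, w * w ≠ w + 3) : Submodule.IsPrincipal P := by
  have := Fact.mk hp
  have h1 : Ideal.absNorm P ∣ p ^ 2 := by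
    rw [← hn, ← absNorm_span]
    exact Ideal.absNorm_dvd_absNorm_of_le ((Ideal.span_singleton_le_iff_mem P).2 hx)
  obtain ⟨k, hk, hk'⟩ := (Nat.dvd_prime_pow Fact.out).1 h1
  interval_cases k
  · rw [pow_zero, Ideal.absNorm_eq_one_iff] at hk'
    exact absurd hk' (Ideal.IsPrime.ne_top ‹_›)
  · rw [pow_one] at hk'
    obtain ⟨τ, -⟩ := exists_residue_hom hk'
    exact absurd (hom_sq τ).1 (h _)
  · rw [eq_span_of_absNorm hx hP (by rw [hn, hk'])]
    exact ⟨⟨x, rfl⟩⟩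

lemma isPrincipal_of_mem_of_prime {P : Ideal ZB} [P.IsPrime] (hP : Ideal.absNorm P ≠ 0) {x : ZB}
    (hx : x ∈ P) (hn : x.norm.norm.natAbs.Prime) : Submodule.IsPrincipal P := by
  have h1 : Ideal.absNorm P ∣ x.norm.norm.natAbs := by
    rw [← absNorm_span]
    exact Ideal.absNorm_dvd_absNorm_of_le ((Ideal.span_singleton_le_iff_mem P).2 hx)
  rcases (Nat.dvd_prime hn).1 h1 with h | h
  · rw [Ideal.absNorm_eq_one_iff] at h
    exact absurd h (Ideal.IsPrime.ne_top ‹_›)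
  · rw [eq_span_of_absNorm hx hP h.symm]
    exact ⟨⟨x, rfl⟩⟩

/-- Since p² > 34, the norm of P is p, so P is the kernel of a map to 𝔽_p given by roots w and s. It
is enough to list, for each pair of roots, an element of prime norm that this map kills. -/
lemma isPrincipal_of_large_prime {P : Ideal ZB} [P.IsPrime] (h0 : Ideal.absNorm P ≠ 0)
    (h34 : Ideal.absNorm P ≤ 34) {p : ℕ} (hp : p.Prime) (h7 : 7 ≤ p) (hpP : (p : ZB) ∈ P)
    (h : ∀ w s : ZMod p, w * w = w + 3 → s * s = 7 → ∃ x : ZB, x.norm.norm.natAbs.Prime ∧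
      (x.re.re + x.re.im * w) + (x.im.re + x.im.im * w) * s = 0) : Submodule.IsPrincipal P := by
  have := Fact.mk hp
  have h1 : Ideal.absNorm P ∣ p ^ 4 := by
    have h2 : (p : ZB).norm.norm.natAbs = p ^ 4 := by
      rw [QuadraticAlgebra.norm_natCast, map_pow, QuadraticAlgebra.norm_natCast, Int.natAbs_pow, Int.natAbs_pow, ← pow_mul]
      simp
    rw [← h2, ← absNorm_span]
    exact Ideal.absNorm_dvd_absNorm_of_le ((Ideal.span_singleton_le_iff_mem P).2 hpP)
  obtain ⟨k, hk, hk'⟩ := (Nat.dvd_prime_pow Fact.out).1 h1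
  have hk1 : k = 1 := by
    have h2 : k < 2 := by
      by_contra h2
      have := Nat.pow_le_pow_right (n := p) (by omega) (by omega : 2 ≤ k)
      nlinarith
    have h3 : k ≠ 0 := by
      rintro rfl
      rw [pow_zero, Ideal.absNorm_eq_one_iff] at hk'
      exact absurd hk' (Ideal.IsPrime.ne_top ‹_›)
    omega
  rw [hk1, pow_one] at hk'
  obtain ⟨τ, hτ⟩ := exists_residue_hom hk'
  obtain ⟨x, hx, hx0⟩ := h _ _ (hom_sq τ).1 (hom_sq τ).2
  rw [← hom_apply, ← RingHom.mem_ker, hτ] at hx0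
  exact isPrincipal_of_mem_of_prime h0 hx0 hx

lemma isPrincipal_of_absNorm_le (P : Ideal ZB) [hP : P.IsPrime] (h0 : Ideal.absNorm P ≠ 0)
    (h : Ideal.absNorm P ≤ 34) : Submodule.IsPrincipal P := by
  have hN := Ideal.absNorm_mem P
  obtain ⟨p, hp, hpN, hpP⟩ : ∃ p : ℕ, p.Prime ∧ p ≤ 34 ∧ (p : ZB) ∈ P := by
    have h1 : ∀ n : ℕ, n ≠ 0 → n ≤ 34 → (n : ZB) ∈ P → ∃ p : ℕ, p.Prime ∧ p ≤ 34 ∧ (p : ZB) ∈ P := by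
      intro n
      induction n using Nat.recOnMul with
      | zero => intro h; exact absurd rfl h
      | one => intro _ _ h1; exact absurd ((Ideal.eq_top_iff_one P).2 (by simpa using h1)) hP.ne_top
      | prime p hp => intro _ h1 h2; exact ⟨p, hp, h1, h2⟩
      | mul a b ha hb =>
        intro h1 h2 h3
        rw [Nat.cast_mul] at h3
        have ha0 : a ≠ 0 := by rintro rfl; simp at h1
        have hb0 : b ≠ 0 := by rintro rfl; simp at h1
        rcases hP.mem_or_mem h3 with h4 | h4
        · exact ha ha0 ((Nat.le_mul_of_pos_right a (by omega)).trans h2) h4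
        · exact hb hb0 ((Nat.le_mul_of_pos_left b (by omega)).trans h2) h4
    exact h1 _ h0 h hN
  by_cases h7 : 7 ≤ p
  · have hcases : p = 7 ∨ p = 11 ∨ p = 13 ∨ p = 17 ∨ p = 19 ∨ p = 23 ∨ p = 29 ∨ p = 31 := by
      interval_cases p <;> first | omega | (exfalso; revert hp; norm_num)
    refine isPrincipal_of_large_prime h0 h hp h7 hpP ?_
    rcases hcases with rfl | rfl | rfl | rfl | rfl | rfl | rfl | rfl
    · intro w s h1 h2; exfalso; revert w; decide
    · intro w s h1 h2; exfalso; revert w; decide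
    · intro w s h1 h2; exfalso; revert s; decide
    · intro w s h1 h2; exfalso; revert s; decide
    · intro w s h1 h2; exfalso; revert w; decide
    · intro w s h1 h2; exfalso; revert s; decide
    -- Of the primes from 7 to 31 only 29 has roots of both polynomials; the four elements of norm
    -- 29 below serve the four pairs of roots.
    · have key : ∀ w s : ZMod 29, w * w = w + 3 → s * s = 7 →
          5 + w + w * s = 0 ∨ 5 + w - w * s = 0 ∨ 6 - w + (1 - w) * s = 0 ∨
            6 - w - (1 - w) * s = 0 := by decide
      intro w s h1 h2
      rcases key w s h1 h2 with h | h | h | h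
      · exact ⟨mk 5 1 0 1, by decide, by push_cast; linear_combination h⟩
      · exact ⟨mk 5 1 0 (-1), by decide, by push_cast; linear_combination h⟩
      · exact ⟨mk 6 (-1) 1 (-1), by decide, by push_cast; linear_combination h⟩
      · exact ⟨mk 6 (-1) (-1) 1, by decide, by push_cast; linear_combination h⟩
    · intro w s h1 h2; exfalso; revert w; decide
  · have hcases : p = 2 ∨ p = 3 ∨ p = 5 := by
      interval_cases p <;> first | omega | (exfalso; revert hp; norm_num)
    rcases hcases with rfl | rfl | rfl
    · have h2 : ((2 : ℕ) : ZB) = mk 3 0 1 0 * mk 3 0 (-1) 0 := by decide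
      rw [h2] at hpP
      rcases hP.mem_or_mem hpP with h | h
      · exact isPrincipal_of_mem_of_hom h0 h hp (by decide) (by decide)
      · exact isPrincipal_of_mem_of_hom h0 h hp (by decide) (by decide)
    -- 3 splits completely, into the four conjugates of n₁; 2 and 5 have only primes of degree at
    -- least 2.
    · have h2 : ((3 : ℕ) : ZB) = mk (-1) 0 0 0 * (n₁ * star n₁ * (conjW n₁ * conjW (star n₁))) := by
        decide
      rw [h2] at hpP
      rcases hP.mem_or_mem hpP with h | h
      · exact absurd (P.eq_top_of_isUnit_mem h (by
          rw [isUnit_iff_norm_isUnit, isUnit_iff_norm_isUnit]; decide)) hP.ne_top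
      rcases hP.mem_or_mem h with h | h <;> rcases hP.mem_or_mem h with h | h <;>
        exact isPrincipal_of_mem_of_prime h0 h (by decide)
    · have h2 : ∃ u, ((5 : ℕ) : ZB) = u * (mk 1 3 3 0 * mk 1 3 (-3) 0) ∧ IsUnit u := by
        refine ⟨mk (-4) (-3) 0 0, by decide, ?_⟩
        rw [isUnit_iff_norm_isUnit, isUnit_iff_norm_isUnit]; decide
      obtain ⟨u, h2, hu⟩ := h2
      rw [h2] at hpP
      rcases hP.mem_or_mem hpP with h | h
      · exact absurd (P.eq_top_of_isUnit_mem h hu) hP.ne_top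
      rcases hP.mem_or_mem h with h | h
      · exact isPrincipal_of_mem_of_hom h0 h hp (by decide) (by decide)
      · exact isPrincipal_of_mem_of_hom h0 h hp (by decide) (by decide)

end ZB

/-! ### Discriminant and class number of F -/

namespace Example256

/-- The ring of integers of `F` is `ℤ[ω, √7]`. -/
def ringEquiv : 𝓞 F ≃+* ZB := RingOfIntegers.equiv ZB

lemma coe_ringEquiv_symm (x : ZB) : ((ringEquiv.symm x : 𝓞 F) : F) = algebraMap ZB F x :=
  IsIntegralClosure.algebraMap_equiv ℤ ZB F (𝓞 F) x

lemma algebraMap_ringEquiv (x : 𝓞 F) : algebraMap ZB F (ringEquiv x) = x := by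
  rw [← coe_ringEquiv_symm, RingEquiv.symm_apply_apply]

/-- An integral basis of `F`. -/
def integralBasisF : Module.Basis (Fin 2 × Fin 2) ℤ (𝓞 F) :=
  ZB.intBasis.map ringEquiv.symm.toAddEquiv.toIntLinearEquiv

lemma discr_F : NumberField.discr F = 364 ^ 2 := by
  rw [← NumberField.discr_eq_discr F integralBasisF, ← ZB.discr_intBasis,
    Algebra.discr_eq_discr_of_algEquiv ZB.intBasis
      (AlgEquiv.ofRingEquiv (f := ringEquiv.symm) fun n => by simp)]
  rfl

lemma finrank_F : Module.finrank ℚ F = 4 := by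
  rw [← RingOfIntegers.rank, Module.finrank_eq_card_basis integralBasisF]
  rfl

instance : IsTotallyReal F where
  isReal v := by
    rw [InfinitePlace.isReal_iff, ComplexEmbedding.isReal_iff]
    ext z
    rw [ComplexEmbedding.conjugate_coe_eq]
    generalize v.embedding = τ
    obtain ⟨x, n, hn, rfl⟩ := exists_eq_div_intCast z
    have sq_real : ∀ (c : ℂ) (r : ℝ), 0 ≤ r → c * c = r → (starRingEnd ℂ) c = c := by
      intro c r hr hc
      have h1 : (c - (√r : ℝ)) * (c + (√r : ℝ)) = 0 := by
        have : ((√r : ℝ) : ℂ) * (√r : ℝ) = r := by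
          rw [← Complex.ofReal_mul, Real.mul_self_sqrt hr]
        linear_combination hc - this
      rcases mul_eq_zero.1 h1 with h | h
      · rw [sub_eq_zero.1 h, Complex.conj_ofReal]
      · rw [eq_neg_of_add_eq_zero_left h, map_neg, Complex.conj_ofReal]
    have h7 : (starRingEnd ℂ) (τ s7F) = τ s7F := sq_real _ 7 (by norm_num) (by
      rw [← map_mul, s7F_sq, map_ofNat]; norm_num)
    have h13 : (starRingEnd ℂ) (τ s13F) = τ s13F := sq_real _ 13 (by norm_num) (by
      rw [← map_mul, s13F_sq, map_ofNat]; norm_num)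
    have h2 : (starRingEnd ℂ) (τ 2) = τ 2 := by rw [map_ofNat, map_ofNat]
    rw [algebraMap_F_apply]
    simp [h7, h13, h2]

/-- F is totally real of degree 4 with discriminant 364², so the Minkowski bound is (4!/4⁴) · 364 =
34.125. -/
instance : IsPrincipalIdealRing (𝓞 F) := by
  refine RingOfIntegers.isPrincipalIdealRing_of_isPrincipal_of_norm_le_of_isPrime ?_
  intro I hI hle
  rw [IsTotallyReal.nrComplexPlaces_eq_zero, finrank_F, discr_F] at hle
  have h1 : √|((364 ^ 2 : ℤ) : ℝ)| = 364 := by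
    rw [Int.cast_pow, abs_of_nonneg (by positivity), Real.sqrt_sq (by norm_num)]
    norm_num
  rw [h1] at hle
  norm_num [Nat.factorial] at hle
  have h2 : Ideal.absNorm (I : Ideal (𝓞 F)) < 35 := by
    have : (Ideal.absNorm (I : Ideal (𝓞 F)) : ℝ) < 35 := by linarith
    exact_mod_cast this
  have h3 : Ideal.absNorm ((I : Ideal (𝓞 F)).map ringEquiv) = Ideal.absNorm (I : Ideal (𝓞 F)) := by
    exact (Nat.card_congr (Ideal.quotientEquiv _ _ ringEquiv rfl).toEquiv).symm
  have : ((I : Ideal (𝓞 F)).map ringEquiv).IsPrime := Ideal.map_isPrime_of_equiv _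
  obtain ⟨⟨x, hx⟩⟩ := ZB.isPrincipal_of_absNorm_le ((I : Ideal (𝓞 F)).map ringEquiv)
    (by rw [h3]; exact Ideal.absNorm_ne_zero_of_nonZeroDivisors I) (by omega)
  refine ⟨ringEquiv.symm x, ?_⟩
  have h4 := congrArg (Ideal.map ringEquiv.symm) hx
  rw [Ideal.map_symm, Ideal.comap_map_of_bijective _ ringEquiv.bijective] at h4
  rw [h4]
  change Ideal.map _ (Ideal.span {x}) = Ideal.span _
  rw [Ideal.map_span, Set.image_singleton]

end Example256

/-! ### Multiquadratic extensions -/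

set_option linter.unusedSectionVars false

namespace Multiquadratic

section Field

variable {K L ι : Type*} [Field K] [Field L] [CharZero K] [Algebra K L] {r : ι → L} {d : ι → K}

lemma isGalois (h : ∀ i, r i ^ 2 = algebraMap K L (d i))
    (htop : IntermediateField.adjoin K (Set.range r) = ⊤) : IsGalois K L := by
  have hspl : ∀ x ∈ Set.range r, IsIntegral K x ∧
      ((minpoly K x).map (algebraMap K L)).Splits := by
    rintro _ ⟨i, rfl⟩
    have hev : Polynomial.aeval (r i) (Polynomial.X ^ 2 - Polynomial.C (d i)) = 0 := by
      simp [h i]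
    have hmon : (Polynomial.X ^ 2 - Polynomial.C (d i)).Monic :=
      Polynomial.monic_X_pow_sub_C _ two_ne_zero
    refine ⟨⟨_, hmon, hev⟩, ?_⟩
    have hsp : ((Polynomial.X ^ 2 - Polynomial.C (d i)).map (algebraMap K L)).Splits := by
      have : (Polynomial.X ^ 2 - Polynomial.C (d i)).map (algebraMap K L) =
          (Polynomial.X - Polynomial.C (r i)) * (Polynomial.X + Polynomial.C (r i)) := by
        simp only [Polynomial.map_sub, Polynomial.map_pow, Polynomial.map_X, Polynomial.map_C, ← h i,
          Polynomial.C_pow]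
        ring
      rw [this]
      exact (Polynomial.Splits.X_sub_C _).mul (Polynomial.Splits.X_add_C _)
    exact hsp.of_dvd (Polynomial.map_ne_zero hmon.ne_zero)
      (Polynomial.map_dvd _ (minpoly.dvd K _ hev))
  have halg : Algebra.IsIntegral K L := ⟨fun x => by
    have hx : x ∈ IntermediateField.adjoin K (Set.range r) := by rw [htop]; trivial
    have h1 := IntermediateField.isAlgebraic_adjoin (K := K) (S := Set.range r)
      (fun x hx => (hspl x hx).1)
    exact ((h1.isAlgebraic ⟨x, hx⟩).isIntegral).map (IntermediateField.val _)⟩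
  have : Normal K L := normal_iff.2 fun x => ⟨Algebra.IsIntegral.isIntegral x,
    IntermediateField.splits_of_mem_adjoin K L (S := Set.range r) hspl (by rw [htop]; trivial)⟩
  exact { }

lemma apply_eq_or (h : ∀ i, r i ^ 2 = algebraMap K L (d i)) (g : Gal(L/K)) (i : ι) :
    g (r i) = r i ∨ g (r i) = - r i := by
  rw [← sq_eq_sq_iff_eq_or_eq_neg, ← map_pow, h, AlgEquiv.commutes]

variable (r) in
open Classical in
/-- The signs by which an automorphism acts on the given square roots. -/
def sign (g : Gal(L/K)) (i : ι) : ℤˣ := if g (r i) = r i then 1 else -1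

lemma apply_eq (h : ∀ i, r i ^ 2 = algebraMap K L (d i)) (g : Gal(L/K)) (i : ι) :
    g (r i) = ((sign r g i : ℤ) : L) * r i := by
  unfold sign
  split_ifs with h1
  · simp [h1]
  · rw [(apply_eq_or h g i).resolve_left h1]; simp

lemma sign_eq_of_apply_eq (h0 : ∀ i, r i ≠ 0) (h : ∀ i, r i ^ 2 = algebraMap K L (d i))
    {g : Gal(L/K)} {i : ι} {u : ℤˣ} (hu : g (r i) = ((u : ℤ) : L) * r i) : sign r g i = u := by
  have : CharZero L := charZero_of_injective_algebraMap (algebraMap K L).injective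
  rw [apply_eq h] at hu
  have h1 := mul_right_cancel₀ (h0 i) hu
  exact Units.ext (by exact_mod_cast h1)

lemma sign_mul (h0 : ∀ i, r i ≠ 0) (h : ∀ i, r i ^ 2 = algebraMap K L (d i)) (g g' : Gal(L/K)) :
    sign r (g * g') = sign r g * sign r g' := by
  ext1 i
  refine sign_eq_of_apply_eq h0 h ?_
  rw [AlgEquiv.mul_apply, apply_eq h g', map_mul, apply_eq h g, map_intCast, Pi.mul_apply]
  push_cast
  ring

/-- The signs, as a group homomorphism. -/
def signHom (h0 : ∀ i, r i ≠ 0) (h : ∀ i, r i ^ 2 = algebraMap K L (d i)) :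
    Gal(L/K) →* (ι → ℤˣ) :=
  MonoidHom.mk' (sign r) (sign_mul h0 h)

lemma sign_injective (h : ∀ i, r i ^ 2 = algebraMap K L (d i))
    (htop : IntermediateField.adjoin K (Set.range r) = ⊤) :
    Function.Injective (sign r : Gal(L/K) → ι → ℤˣ) := by
  intro g g' hgg
  have h1 : ∀ x ∈ IntermediateField.adjoin K (Set.range r), g x = g' x := by
    intro x hx
    induction hx using IntermediateField.adjoin_induction with
    | mem x hx =>
      obtain ⟨i, rfl⟩ := hx
      rw [apply_eq h, apply_eq h, hgg]
    | algebraMap x => rw [AlgEquiv.commutes, AlgEquiv.commutes]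
    | add x y _ _ hx hy => rw [map_add, map_add, hx, hy]
    | mul x y _ _ hx hy => rw [map_mul, map_mul, hx, hy]
    | inv x _ hx => rw [map_inv₀, map_inv₀, hx]
  ext x
  exact h1 x (by rw [htop]; trivial)

lemma isAbelianGalois (h0 : ∀ i, r i ≠ 0) (h : ∀ i, r i ^ 2 = algebraMap K L (d i))
    (htop : IntermediateField.adjoin K (Set.range r) = ⊤) : IsAbelianGalois K L := by
  have := isGalois h htop
  have : IsMulCommutative Gal(L/K) := ⟨⟨fun a b => sign_injective h htop (by
    rw [sign_mul h0 h, sign_mul h0 h, mul_comm])⟩⟩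
  exact { }

end Field

section NumberField

variable {K L ι : Type*} [Field K] [NumberField K] [Field L] [NumberField L] [Algebra K L]
  {r : ι → 𝓞 L} {d : ι → 𝓞 K}

/-- Modulo P, Frobenius sends r to r^q = d^((q-1)/2) · r, and Euler's criterion identifies the
factor. Since 2 is not in P, the congruence of signs is an equality. -/
lemma sign_eq_leg (h : ∀ i, r i ^ 2 = algebraMap (𝓞 K) (𝓞 L) (d i))
    {v : HeightOneSpectrum (𝓞 K)} (h2 : (2 : 𝓞 K) ∉ v.asIdeal) {i : ι} (hd : d i ∉ v.asIdeal)
    {P : Ideal (𝓞 L)} [P.IsPrime] [hP : P.LiesOver v.asIdeal] {σ : Gal(L/K)}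
    (hσ : (RingOfIntegers.mapAlgHom (σ : L ≃ₐ[K] L)).IsArithFrobAt P) :
    (sign (fun i => (r i : L)) σ i : ℤ) = leg v.asIdeal (d i) := by
  have hover : P.under (𝓞 K) = v.asIdeal := hP.over.symm
  have hmem : ∀ x : 𝓞 K, algebraMap (𝓞 K) (𝓞 L) x ∈ P ↔ x ∈ v.asIdeal := fun x => by
    rw [← hover]; rfl
  have hr : r i ∉ P := fun hr => hd ((hmem _).1 (by rw [← h i]; exact P.pow_mem_of_mem hr 2 two_pos))
  have h2P : (2 : 𝓞 L) ∉ P := fun hr => h2 ((hmem 2).1 (by rwa [map_ofNat]))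
  have : Finite (𝓞 K ⧸ v.asIdeal) := Ring.HasFiniteQuotients.finiteQuotient v.ne_bot
  set q := Nat.card (𝓞 K ⧸ v.asIdeal) with hq
  have hqodd : q % 2 = 1 := by
    have := Fintype.ofFinite (𝓞 K ⧸ v.asIdeal)
    let _ := Ideal.Quotient.field v.asIdeal
    rw [hq, Nat.card_eq_fintype_card]
    refine FiniteField.odd_card_of_char_ne_two fun hc => h2 ?_
    have := CharP.cast_eq_zero (𝓞 K ⧸ v.asIdeal) (ringChar (𝓞 K ⧸ v.asIdeal))
    rw [hc] at this
    rw [← Ideal.Quotient.eq_zero_iff_mem, map_ofNat]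
    simpa using this
  have h1 := hσ (r i)
  have h3 : RingOfIntegers.mapAlgHom (σ : L ≃ₐ[K] L) (r i) =
      ((sign (fun i => (r i : L)) σ i : ℤ) : 𝓞 L) * r i := by
    apply RingOfIntegers.ext
    have := apply_eq (r := fun i => (r i : L)) (d := fun i => (d i : K))
      (fun i => congrArg (algebraMap (𝓞 L) L) (h i)) σ i
    push_cast
    exact this
  rw [hover, ← hq, h3] at h1
  have h4 : r i ^ q = algebraMap (𝓞 K) (𝓞 L) (d i ^ (q / 2)) * r i := by
    conv_lhs => rw [← Nat.div_add_mod q 2, hqodd, pow_add, pow_mul, h i, pow_one, ← map_pow]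
  have h5 := (hmem _).2 (leg_euler v.asIdeal h2 (d i))
  rw [map_sub, map_intCast] at h5
  have h6 : (((sign (fun i => (r i : L)) σ i : ℤ) : 𝓞 L) - (leg v.asIdeal (d i) : 𝓞 L)) ∈ P := by
    refine (Ideal.IsPrime.mem_or_mem ‹_› ?_).resolve_right hr
    have : (((sign (fun i => (r i : L)) σ i : ℤ) : 𝓞 L) - (leg v.asIdeal (d i) : 𝓞 L)) * r i =
        (((sign (fun i => (r i : L)) σ i : ℤ) : 𝓞 L) * r i - r i ^ q) -
          ((leg v.asIdeal (d i) : 𝓞 L) - algebraMap (𝓞 K) (𝓞 L) (d i ^ (q / 2))) * r i := by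
      rw [h4]; ring
    rw [this]
    exact P.sub_mem h1 (P.mul_mem_right _ h5)
  exact eq_of_int_sub_mem h2P (Int.isUnit_iff.1 (Units.isUnit _)) (leg_eq_one_or hd) h6

lemma exists_isArithFrobAt [IsGalois K L] (P : Ideal (𝓞 L)) [P.IsPrime] (hP : P ≠ ⊥) :
    ∃ σ : Gal(L/K), (RingOfIntegers.mapAlgHom (σ : L ≃ₐ[K] L)).IsArithFrobAt P := by
  have : Finite (𝓞 L ⧸ P) := Ring.HasFiniteQuotients.finiteQuotient hP
  obtain ⟨σ, hσ⟩ := IsArithFrobAt.exists_of_isInvariant (𝓞 K) Gal(L/K) P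
  exact ⟨σ, hσ⟩

end NumberField

end Multiquadratic

namespace Example256

/-! ### `N'` as a multiquadratic extension of `F` -/

/-- The embedding of `ℤ[ω, √7]` in the complex numbers. -/
def toComplex : ZB →+* ℂ := (algebraMap F ℂ).comp (algebraMap ZB F)

lemma toComplex_injective : Function.Injective toComplex :=
  (algebraMap F ℂ).injective.comp algebraMap_F_injective

lemma toComplex_apply (x : ZB) : toComplex x =
    x.re.re + x.re.im * ((1 + s13) / 2) + (x.im.re + x.im.im * ((1 + s13) / 2)) * s7 := by
  rw [toComplex, RingHom.comp_apply, algebraMap_F_apply]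
  rfl

lemma nu_one_one : nu 1 1 = toComplex (ZB.mk (-21) 16 (-8) 6) := by
  rw [toComplex_apply, nu]; push_cast; ring

lemma nu_two_one : nu 2 1 = toComplex (ZB.mk (-21) 16 8 (-6)) := by
  rw [toComplex_apply, nu]; push_cast; ring

lemma nu_one_two : nu 1 2 = toComplex (ZB.mk (-5) (-16) (-2) (-6)) := by
  rw [toComplex_apply, nu]; push_cast; ring

lemma nu_two_two : nu 2 2 = toComplex (ZB.mk (-5) (-16) 2 6) := by
  rw [toComplex_apply, nu]; push_cast; ring

/-- Two elements of C are squares in F, and each of the others is some `ZB.d i` times an explicit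
square; this permits replacing the ν by the much simpler conjugates of n₁. -/
lemma exists_of_mem_C {c : ℂ} (hc : c ∈ C) :
    ∃ y : ZB, c = toComplex y ^ 2 ∨ ∃ i, c = toComplex (ZB.d i * y ^ 2) := by
  rcases hc with (rfl | rfl | rfl | rfl) | (rfl | rfl | rfl | rfl)
  · refine ⟨ZB.mk 0 0 1 0, Or.inl ?_⟩
    rw [← map_pow, show ZB.mk 0 0 1 0 ^ 2 = 7 by decide, map_ofNat]
  · refine ⟨ZB.mk (-1) 2 0 0, Or.inl ?_⟩
    rw [← map_pow, show ZB.mk (-1) 2 0 0 ^ 2 = 13 by decide, map_ofNat]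
  · refine ⟨1, Or.inr ⟨0, ?_⟩⟩
    rw [show ZB.d 0 * 1 ^ 2 = -1 by decide, map_neg, map_one]
  · refine ⟨1, Or.inr ⟨1, ?_⟩⟩
    rw [show ZB.d 1 * 1 ^ 2 = ZB.mk 1 1 0 0 by decide, toComplex_apply]; push_cast; ring
  · exact ⟨ZB.mk 8 8 3 3, Or.inr ⟨3, by rw [nu_one_one]; exact congrArg _ (by decide)⟩⟩
  · exact ⟨ZB.mk 16 (-8) 6 (-3), Or.inr ⟨5, by rw [nu_one_two]; exact congrArg _ (by decide)⟩⟩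
  · exact ⟨ZB.mk 8 8 (-3) (-3), Or.inr ⟨2, by rw [nu_two_one]; exact congrArg _ (by decide)⟩⟩
  · exact ⟨ZB.mk 16 (-8) (-6) 3, Or.inr ⟨4, by rw [nu_two_two]; exact congrArg _ (by decide)⟩⟩

lemma exists_mem_C (i : Fin 6) : ∃ y : ZB, y ≠ 0 ∧ toComplex (ZB.d i * y ^ 2) ∈ C := by
  fin_cases i
  · refine ⟨1, one_ne_zero, Or.inl (Or.inr (Or.inr (Or.inl ?_)))⟩
    rw [show ZB.d _ * 1 ^ 2 = -1 by decide, map_neg, map_one]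
  · refine ⟨1, one_ne_zero, Or.inl (Or.inr (Or.inr (Or.inr ?_)))⟩
    rw [show ZB.d _ * 1 ^ 2 = ZB.mk 1 1 0 0 by decide, toComplex_apply]; push_cast; ring_nf; rfl
  · exact ⟨ZB.mk 8 8 (-3) (-3), by decide, Or.inr (Or.inr (Or.inr (Or.inl
      (by rw [nu_two_one]; exact congrArg _ (by decide)))))⟩
  · exact ⟨ZB.mk 8 8 3 3, by decide, Or.inr (Or.inl
      (by rw [nu_one_one]; exact congrArg _ (by decide)))⟩
  · exact ⟨ZB.mk 16 (-8) (-6) 3, by decide, Or.inr (Or.inr (Or.inr (Or.inr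
      (by rw [Set.mem_singleton_iff, nu_two_two]; exact congrArg _ (by decide)))))⟩
  · exact ⟨ZB.mk 16 (-8) 6 (-3), by decide, Or.inr (Or.inr (Or.inl
      (by rw [nu_one_two]; exact congrArg _ (by decide))))⟩

lemma exists_sqrt (i : Fin 6) : ∃ z ∈ N', z ^ 2 = toComplex (ZB.d i) := by
  obtain ⟨y, hy, hC⟩ := exists_mem_C i
  obtain ⟨z, hz⟩ := IsAlgClosed.exists_pow_nat_eq (toComplex (ZB.d i)) two_pos
  have hyc : toComplex y ≠ 0 := by rwa [Ne, map_eq_zero_iff _ toComplex_injective]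
  have h1 : z * toComplex y ∈ N' := IntermediateField.subset_adjoin ℚ _ (by
    rw [Set.mem_ofPred_eq, mul_pow, hz, ← map_pow, ← map_mul]; exact hC)
  have h2 : toComplex y ∈ N' := F_le_N' (algebraMap ZB F y).2
  refine ⟨z, ?_, hz⟩
  rw [← mul_div_cancel_right₀ z hyc]
  exact div_mem h1 h2

/-- A square root of `ZB.d i` in `N'`. -/
def sqrtN (i : Fin 6) : N' := ⟨(exists_sqrt i).choose, (exists_sqrt i).choose_spec.1⟩

lemma sqrtN_sq (i : Fin 6) : sqrtN i ^ 2 = algebraMap F N' (algebraMap ZB F (ZB.d i)) :=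
  Subtype.ext (exists_sqrt i).choose_spec.2

lemma d_ne_zero (i : Fin 6) : ZB.d i ≠ 0 := by
  fin_cases i <;> decide

lemma sqrtN_ne_zero (i : Fin 6) : sqrtN i ≠ 0 := by
  have := sqrtN_sq i
  intro h
  rw [h, zero_pow two_ne_zero, eq_comm, map_eq_zero, map_eq_zero_iff _ algebraMap_F_injective] at this
  exact d_ne_zero i this

lemma adjoin_sqrtN : IntermediateField.adjoin F (Set.range sqrtN) = ⊤ := by
  rw [eq_top_iff]
  rintro ⟨z, hz⟩ -
  induction hz using IntermediateField.adjoin_induction with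
  | mem z hz' =>
    obtain ⟨y, hy⟩ := exists_of_mem_C hz'
    have key : ∀ w : N', w ∈ IntermediateField.adjoin F (Set.range sqrtN) → z ^ 2 = (w : ℂ) ^ 2 →
        ∀ h, (⟨z, h⟩ : N') ∈ IntermediateField.adjoin F (Set.range sqrtN) := by
      intro w hw hzw h
      rcases sq_eq_sq_iff_eq_or_eq_neg.1 hzw with h1 | h1
      · rwa [show (⟨z, h⟩ : N') = w from Subtype.ext h1]
      · rw [show (⟨z, h⟩ : N') = -w from Subtype.ext h1]
        exact neg_mem hw
    have hmem := (IntermediateField.adjoin F (Set.range sqrtN)).algebraMap_mem (algebraMap ZB F y)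
    rcases hy with hy | ⟨i, hy⟩
    · exact key _ hmem hy _
    · refine key _ (mul_mem (IntermediateField.subset_adjoin F _ ⟨i, rfl⟩) hmem) ?_ _
      rw [hy, MulMemClass.coe_mul, mul_pow, ← SubmonoidClass.coe_pow, sqrtN_sq, map_mul, map_pow]
      rfl
  | algebraMap q =>
    exact (IntermediateField.adjoin F (Set.range sqrtN)).algebraMap_mem (algebraMap ℚ F q)
  | add x y hx hy h1 h2 => exact add_mem h1 h2
  | mul x y hx hy h1 h2 => exact mul_mem h1 h2
  | inv x hx h1 => exact inv_mem h1

instance : IsAbelianGalois F N' :=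
  Multiquadratic.isAbelianGalois sqrtN_ne_zero sqrtN_sq adjoin_sqrtN

instance : IsScalarTower ℚ F N' := IsScalarTower.of_algebraMap_eq' (Subsingleton.elim _ _)

/-- `ZB.d i` as an integer of `F`. -/
def dF (i : Fin 6) : 𝓞 F := ringEquiv.symm (ZB.d i)

lemma coe_dF (i : Fin 6) : (dF i : F) = algebraMap ZB F (ZB.d i) := coe_ringEquiv_symm _

lemma isIntegral_sqrtN (i : Fin 6) : IsIntegral ℤ (sqrtN i) :=
  IsIntegral.of_pow two_pos (by rw [sqrtN_sq]; exact (isIntegral_algebraMap_F _).algebraMap)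

/-- The square root of `dF i` as an integer of `N'`. -/
def sqrtO (i : Fin 6) : 𝓞 N' := ⟨sqrtN i, isIntegral_sqrtN i⟩

lemma sqrtO_sq (i : Fin 6) : sqrtO i ^ 2 = algebraMap (𝓞 F) (𝓞 N') (dF i) := by
  apply RingOfIntegers.ext
  have : ((algebraMap (𝓞 F) (𝓞 N') (dF i) : 𝓞 N') : N') = algebraMap F N' (dF i) := rfl
  rw [this, coe_dF, ← sqrtN_sq]
  rfl

end Example256

/-! ### The ray classes of `ℤ[ω, √7]` modulo `6∞` -/

/-- A vector of signs can be corrected one sign at a time. -/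
lemma exists_mul_prod_pow_eq_one {n : ℕ} (A : Fin n → Fin n → SignType) (h1 : ∀ j, A j j = -1)
    (h2 : ∀ i j, i < j → A i j = 1) (h3 : ∀ i j, A i j ≠ 0) (c : Fin n → SignType)
    (hc : ∀ i, c i ≠ 0) : ∃ f : Fin n → Fin 2, ∀ i, c i * ∏ j, A i j ^ (f j : ℕ) = 1 := by
  have key : ∀ m ≤ n, ∃ f : Fin n → Fin 2, (∀ j : Fin n, m ≤ (j : ℕ) → f j = 0) ∧
      ∀ i : Fin n, (i : ℕ) < m → c i * ∏ j, A i j ^ (f j : ℕ) = 1 := by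
    intro m
    induction m with
    | zero => exact fun _ => ⟨0, fun _ _ => rfl, fun i hi => absurd hi (by omega)⟩
    | succ m ih =>
      intro hm
      obtain ⟨f, hf, hf'⟩ := ih (by omega)
      let k : Fin n := ⟨m, by omega⟩
      have hprod : ∀ i, ∏ j, A i j ^ (Function.update f k 1 j : ℕ) =
          (∏ j, A i j ^ (f j : ℕ)) * A i k := by
        intro i
        rw [← Finset.prod_erase_mul _ _ (Finset.mem_univ k),
          ← Finset.prod_erase_mul _ (fun j => A i j ^ (f j : ℕ)) (Finset.mem_univ k), hf k le_rfl,
          Function.update_self]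
        simp only [Fin.val_zero, Fin.val_one, pow_zero, pow_one, mul_one]
        congr 1
        refine Finset.prod_congr rfl fun j hj => ?_
        rw [Function.update_of_ne (Finset.ne_of_mem_erase hj)]
      have hk : c k * ∏ j, A k j ^ (f j : ℕ) = 1 ∨ c k * ∏ j, A k j ^ (f j : ℕ) = -1 := by
        have : c k * ∏ j, A k j ^ (f j : ℕ) ≠ 0 :=
          mul_ne_zero (hc k) (Finset.prod_ne_zero_iff.2 fun j _ => pow_ne_zero _ (h3 k j))
        revert this
        generalize c k * _ = x
        revert x
        decide
      -- The k-th column is used only if the k-th sign is still wrong; its entries in earlier rows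
      -- are 1, so the signs already corrected stay correct.
      rcases hk with hk | hk
      · refine ⟨f, fun j hj => hf j (by omega), fun i hi => ?_⟩
        rcases Nat.lt_succ_iff_lt_or_eq.1 hi with h4 | h4
        · exact hf' i h4
        · rwa [show i = k from Fin.ext h4]
      · refine ⟨Function.update f k 1, fun j hj => ?_, fun i hi => ?_⟩
        · rw [Function.update_of_ne (fun hjk => by rw [hjk] at hj; simp [k] at hj)]
          exact hf j (by omega)
        · rw [hprod, ← mul_assoc]
          rcases Nat.lt_succ_iff_lt_or_eq.1 hi with h4 | h4
          · rw [hf' i h4, h2 i k h4, one_mul]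
          · rw [show i = k from Fin.ext h4, hk, h1]
            decide
  obtain ⟨f, -, hf⟩ := key n le_rfl
  exact ⟨f, fun i => hf i i.2⟩

namespace ZB

/-- The isomorphism of the monoids `𝔽₃` and `{0, ±1}`. -/
def signThree : ZMod 3 →* SignType where
  toFun := ![0, 1, -1]
  map_one' := by decide
  map_mul' := by decide

/-- The real embeddings of `ℤ[ω, √7]`. -/
def real : Fin 4 → ZB →+* ℝ :=
  ![lift _ _ sq_φ₁ sqrt_seven_sq, lift _ _ sq_φ₁ neg_sqrt_seven_sq,
    lift _ _ sq_φ₂ sqrt_seven_sq, lift _ _ sq_φ₂ neg_sqrt_seven_sq]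

lemma eq_real (φ : ZB →+* ℝ) : ∃ i, φ = real i := by
  obtain ⟨hw, hs⟩ := hom_sq φ
  have h1 : φ (mk 0 1 0 0) = (1 + √13) / 2 ∨ φ (mk 0 1 0 0) = (1 - √13) / 2 := by
    have := Real.mul_self_sqrt (show (0 : ℝ) ≤ 13 by norm_num)
    rw [← sub_eq_zero, ← sub_eq_zero (b := (1 - √13) / 2), ← mul_eq_zero]
    linear_combination hw - this / 4
  have h2 : φ (mk 0 0 1 0) = √7 ∨ φ (mk 0 0 1 0) = -√7 := by
    rw [← sq_eq_sq_iff_eq_or_eq_neg, sq, sq, hs, sqrt_seven_sq]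
  rcases h1 with h1 | h1 <;> rcases h2 with h2 | h2
  · exact ⟨0, RingHom.ext fun x => (by rw [hom_apply φ, h1, h2] : φ x = _).trans
      (lift_apply sq_φ₁ sqrt_seven_sq x).symm⟩
  · exact ⟨1, RingHom.ext fun x => (by rw [hom_apply φ, h1, h2] : φ x = _).trans
      (lift_apply sq_φ₁ neg_sqrt_seven_sq x).symm⟩
  · exact ⟨2, RingHom.ext fun x => (by rw [hom_apply φ, h1, h2] : φ x = _).trans
      (lift_apply sq_φ₂ sqrt_seven_sq x).symm⟩
  · exact ⟨3, RingHom.ext fun x => (by rw [hom_apply φ, h1, h2] : φ x = _).trans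
      (lift_apply sq_φ₂ neg_sqrt_seven_sq x).symm⟩

/-- The homomorphisms from `ℤ[ω, √7]` to `𝔽₃`. -/
def modThree : Fin 4 → ZB →+* ZMod 3 :=
  ![lift 0 1 (by decide) (by decide), lift 0 2 (by decide) (by decide),
    lift 1 1 (by decide) (by decide), lift 1 2 (by decide) (by decide)]

/-- The signs at a real place. -/
def realSign (i : Fin 4) : ZB →* SignType := ((signHom : ℝ →*₀ SignType) : ℝ →* SignType).comp (real i : ZB →* ℝ)

/-- The signs modulo a prime over `3`. -/
def threeSign (i : Fin 4) : ZB →* SignType := signThree.comp (modThree i : ZB →* ZMod 3)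

/-- The signs at the real places and the places over `3`. -/
def rayChar : Fin 8 → ZB →* SignType :=
  ![realSign 0, realSign 2, threeSign 2, realSign 1, threeSign 1, threeSign 0, threeSign 3,
    realSign 3]

/-- Six prime elements. -/
def g : Fin 6 → ZB := ![mk 4 (-7) 0 2, mk 6 (-5) (-2) 2, mk 12 7 4 2, mk (-3) 7 2 (-2),
  mk 1 5 0 (-2), mk 19 15 (-6) (-6)]

/-- Representatives for the signs. -/
def signRep : Fin 8 → ZB := Fin.cons (-1) (Fin.cons (mk 1 1 0 0) g)

lemma threeSign_apply (i : Fin 4) (x : ZB) : threeSign i x =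
    signThree (x.re.re + x.re.im * ![0, 0, 1, 1] i +
      (x.im.re + x.im.im * ![0, 0, 1, 1] i) * ![1, 2, 1, 2] i) := by
  have h : modThree i (mk 0 1 0 0) = ![0, 0, 1, 1] i ∧ modThree i (mk 0 0 1 0) = ![1, 2, 1, 2] i := by
    revert i; decide
  rw [← h.1, ← h.2, ← hom_apply]
  rfl

lemma realSign_pos {i : Fin 4} {x : ZB} : realSign i x = 1 ↔ 0 < real i x := sign_eq_one_iff

lemma realSign_neg {i : Fin 4} {x : ZB} : realSign i x = -1 ↔ real i x < 0 := sign_eq_neg_one_iff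

lemma real_apply (i : Fin 4) (x : ZB) : real i x =
    x.re.re + x.im.re * (![1, -1, 1, -1] i * √7) + x.re.im / 2 * (1 + ![1, 1, -1, -1] i * √13) + 
      x.im.im / 2 * (![1, -1, 1, -1] i * √7 + ![1, -1, -1, 1] i * (√7 * √13)) := by
  fin_cases i
  · refine (lift_apply sq_φ₁ sqrt_seven_sq x).trans ?_; simp; ring
  · refine (lift_apply sq_φ₁ neg_sqrt_seven_sq x).trans ?_; simp; ring
  · refine (lift_apply sq_φ₂ sqrt_seven_sq x).trans ?_; simp; ring
  · refine (lift_apply sq_φ₂ neg_sqrt_seven_sq x).trans ?_; simp; ring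

lemma sqrt_bounds : (2.64575 < √7 ∧ √7 < 2.64576) ∧ (3.60555 < √13 ∧ √13 < 3.60556) ∧
    (9.53939 < √7 * √13 ∧ √7 * √13 < 9.53940) := by
  rw [← Real.sqrt_mul (by norm_num)]
  refine ⟨⟨?_, ?_⟩, ⟨?_, ?_⟩, ⟨?_, ?_⟩⟩
  all_goals first
    | exact Real.lt_sqrt_of_sq_lt (by norm_num)
    | (rw [Real.sqrt_lt' (by norm_num)]; norm_num)

/-- The elements of `signRep` and the order of the places in `rayChar` are chosen so that the 8 × 8
matrix of signs is triangular, ready for `exists_mul_prod_pow_eq_one`. -/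
lemma rayChar_signRep_self (j : Fin 8) : rayChar j (signRep j) = -1 := by
  obtain ⟨⟨h1, h2⟩, ⟨h3, h4⟩, ⟨h5, h6⟩⟩ := sqrt_bounds
  fin_cases j
  · refine realSign_neg.2 ?_
    change real 0 (-1) < 0
    rw [map_neg, map_one]
    norm_num
  all_goals first
    | exact (threeSign_apply _ _).trans (by decide)
    | (refine realSign_neg.2 ?_
       rw [real_apply]
       simp [signRep, g]
       linarith)

lemma rayChar_signRep_of_lt (i j : Fin 8) (hij : i < j) : rayChar i (signRep j) = 1 := by
  obtain ⟨⟨h1, h2⟩, ⟨h3, h4⟩, ⟨h5, h6⟩⟩ := sqrt_bounds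
  fin_cases j <;> fin_cases i <;> first
    | exact absurd hij (by decide)
    | exact (threeSign_apply _ _).trans (by decide)
    | (refine realSign_pos.2 ?_
       rw [real_apply]
       simp [signRep, g]
       linarith)

end ZB

namespace ZB

lemma mul_star_norm (x : ZB) : x * (star x * algebraMap ZW ZB (star x.norm)) = (x.norm.norm : ZB) := by
  have h1 : x * star x = algebraMap ZW ZB x.norm :=
    (QuadraticAlgebra.algebraMap_norm_eq_mul_star x).symm
  have h2 : x.norm * star x.norm = algebraMap ℤ ZW x.norm.norm :=
    (QuadraticAlgebra.algebraMap_norm_eq_mul_star x.norm).symm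
  rw [← mul_assoc, h1, ← map_mul, h2, eq_intCast, map_intCast]

lemma isCoprime_intCast_of_norm {x : ZB} {n : ℤ} (h : IsCoprime x.norm.norm n) :
    IsCoprime x (n : ZB) := by
  have h1 := h.map (Int.castRingHom ZB)
  simp only [eq_intCast] at h1
  rw [← mul_star_norm] at h1
  exact h1.of_mul_left_left

lemma natCast_dvd_sub_one {n : ℕ} {x : ZB} (h1 : (x.re.re : ZMod n) = 1)
    (h2 : (x.re.im : ZMod n) = 0) (h3 : (x.im.re : ZMod n) = 0) (h4 : (x.im.im : ZMod n) = 0) :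
    (n : ZB) ∣ x - 1 := by
  replace h1 : ((x.re.re - 1 : ℤ) : ZMod n) = 0 := by push_cast; rw [h1, sub_self]
  rw [ZMod.intCast_zmod_eq_zero_iff_dvd] at h1 h2 h3 h4
  obtain ⟨a, ha⟩ := h1
  obtain ⟨b, hb⟩ := h2
  obtain ⟨c, hc⟩ := h3
  obtain ⟨d, hd⟩ := h4
  refine ⟨mk a b c d, ?_⟩
  rw [sub_eq_iff_eq_add] at ha ⊢
  have hone : (1 : ZB) = mk 1 0 0 0 := rfl
  rw [hone]
  ext <;> simp [ha, hb, hc, hd]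

lemma hom_ne_zero {R : Type*} [CommRing R] [IsDomain R] [CharZero R] (φ : ZB →+* R) {x : ZB}
    (hx : x ≠ 0) : φ x ≠ 0 := by
  intro h
  have h3 := congrArg φ (mul_star_norm x)
  rw [map_mul, h, zero_mul, map_intCast, eq_comm, Int.cast_eq_zero, ZW.norm_eq_zero,
    norm_eq_zero] at h3
  exact hx h3

lemma modThree_apply (i : Fin 4) (x : ZB) : modThree i x =
    x.re.re + x.re.im * ![0, 0, 1, 1] i + (x.im.re + x.im.im * ![0, 0, 1, 1] i) * ![1, 2, 1, 2] i := by
  have h : modThree i (mk 0 1 0 0) = ![0, 0, 1, 1] i ∧ modThree i (mk 0 0 1 0) = ![1, 2, 1, 2] i := by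
    revert i; decide
  rw [← h.1, ← h.2, ← hom_apply]

lemma modThree_ne_zero {γ : ZB} (h3 : IsCoprime γ 3) (i : Fin 4) : modThree i γ ≠ 0 := by
  obtain ⟨a, b, hab⟩ := h3
  intro h
  have := congrArg (modThree i) hab
  rw [map_add, map_mul, map_mul, h, map_ofNat, map_one, mul_zero, zero_add] at this
  revert this
  generalize modThree i b = c
  revert c
  decide

lemma rayChar_ne_zero {γ : ZB} (h0 : γ ≠ 0) (h3 : IsCoprime γ 3) (i : Fin 8) :
    rayChar i γ ≠ 0 := by
  have hreal : ∀ i, realSign i γ ≠ 0 := fun i => sign_ne_zero.2 (hom_ne_zero _ h0)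
  have hthree : ∀ i, threeSign i γ ≠ 0 := by
    intro i
    have h1 := modThree_ne_zero h3 i
    change signThree (modThree i γ) ≠ 0
    revert h1
    generalize modThree i γ = c
    revert c
    decide
  fin_cases i
  exacts [hreal 0, hreal 2, hthree 2, hreal 1, hthree 1, hthree 0, hthree 3, hreal 3]

lemma isCoprime_signRep_six (j : Fin 8) : IsCoprime (signRep j) 6 := by
  refine isCoprime_intCast_of_norm (n := 6) ?_
  rw [Int.isCoprime_iff_gcd_eq_one]
  revert j
  decide

lemma rayChar_signRep_ne_zero (i j : Fin 8) : rayChar i (signRep j) ≠ 0 := by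
  refine rayChar_ne_zero ?_ ?_ i
  · revert j; decide
  · exact (isCoprime_signRep_six j).of_isCoprime_of_dvd_right ⟨2, by norm_num⟩

lemma isTotPos_of_rayChar {γ : ZB} (h : ∀ i, rayChar i γ = 1) : IsTotPos γ := by
  intro φ
  obtain ⟨i, rfl⟩ := eq_real φ
  rw [← realSign_pos]
  fin_cases i
  exacts [h 0, h 3, h 1, h 7]

lemma three_dvd_of_modThree {γ : ZB} (h1 : ∀ i, modThree i γ = 1) : 3 ∣ γ - 1 := by
  have key : ∀ a b c d : ZMod 3, a + b * 0 + (c + d * 0) * 1 = 1 → a + b * 0 + (c + d * 0) * 2 = 1 →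
      a + b * 1 + (c + d * 1) * 1 = 1 → a + b * 1 + (c + d * 1) * 2 = 1 →
      a = 1 ∧ b = 0 ∧ c = 0 ∧ d = 0 := by decide
  have h2 : ∀ i, (γ.re.re + γ.re.im * (![0, 0, 1, 1] : Fin 4 → ZMod 3) i +
      (γ.im.re + γ.im.im * (![0, 0, 1, 1] : Fin 4 → ZMod 3) i) * ![1, 2, 1, 2] i : ZMod 3) = 1 := by
    intro i
    exact (modThree_apply i γ).symm.trans (h1 i)
  obtain ⟨ha, hb, hc, hd⟩ := key _ _ _ _ (h2 0) (h2 1) (h2 2) (h2 3)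
  exact natCast_dvd_sub_one (n := 3) ha hb hc hd

lemma three_dvd_of_rayChar {γ : ZB} (h : ∀ i, rayChar i γ = 1) : 3 ∣ γ - 1 := by
  refine three_dvd_of_modThree fun i => ?_
  have : threeSign i γ = 1 := by
    fin_cases i
    exacts [h 5, h 4, h 2, h 6]
  change signThree (modThree i γ) = 1 at this
  revert this
  generalize modThree i γ = c
  revert c
  decide

/-- Reduction modulo `2`. -/
def modTwo : ZB →+* QuadraticAlgebra (QuadraticAlgebra (ZMod 2) 1 1) 1 0 :=
  lift ⟨⟨0, 1⟩, 0⟩ ⟨0, 1⟩ (by decide) (by decide)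

lemma modTwo_apply (x : ZB) : modTwo x = ⟨⟨x.re.re, x.re.im⟩, ⟨x.im.re, x.im.im⟩⟩ := by
  refine (lift_apply _ _ x).trans ?_
  ext <;> simp

lemma modTwo_im_mul {x y : ZB} (hx : (modTwo x).im = 0) (hy : (modTwo y).im = 0) :
    (modTwo (x * y)).im = 0 := by
  rw [map_mul, QuadraticAlgebra.im_mul, hx, hy]
  simp

lemma two_dvd_of_modTwo {x : ZB} (h : modTwo x = 1) : 2 ∣ x - 1 := by
  rw [modTwo_apply] at h
  exact natCast_dvd_sub_one (n := 2) (congrArg (fun z => z.re.re) h)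
    (congrArg (fun z => z.re.im) h) (congrArg (fun z => z.im.re) h) (congrArg (fun z => z.im.im) h)

lemma isUnit_of_norm {x : ZB} (h : IsUnit x.norm.norm) : IsUnit x := by
  have h1 := h.map (Int.castRingHom ZB)
  rw [eq_intCast, ← mul_star_norm] at h1
  exact isUnit_of_mul_isUnit_left h1

lemma exists_modTwo_mul_eq_one {γ : ZB} (h6 : IsCoprime γ 6) : ∃ y, modTwo γ * y = 1 := by
  obtain ⟨a, b, hab⟩ := h6
  refine ⟨modTwo a, ?_⟩
  rw [← map_mul, mul_comm, ← map_one modTwo, ← hab, map_add, map_mul modTwo b, map_ofNat,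
    show (6 : QuadraticAlgebra (QuadraticAlgebra (ZMod 2) 1 1) 1 0) = 0 by decide, mul_zero,
    add_zero]

/-- The quotient by 2 is 𝔽₄[s] with s² = 1. The units 8 + 3√7 ≡ s and 30 - 3ω + 5√7 - 6ω√7 ≡ ω + s
suffice to move any invertible class into 𝔽₄. -/
lemma exists_modTwo_im_eq_zero {γ : ZB} (h6 : IsCoprime γ 6) : ∃ i j : Fin 2,
    (modTwo (γ * (mk 8 0 3 0 ^ (i : ℕ) * mk 30 (-3) 5 (-6) ^ (j : ℕ)))).im = 0 := by
  obtain ⟨y, hy⟩ := exists_modTwo_mul_eq_one h6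
  simp only [map_mul, map_pow]
  revert hy
  generalize modTwo γ = x
  obtain ⟨⟨a, b⟩, ⟨c, d⟩⟩ := x
  obtain ⟨⟨a', b'⟩, ⟨c', d'⟩⟩ := y
  rw [show modTwo (mk 8 0 3 0) = ⟨⟨0, 0⟩, ⟨1, 0⟩⟩ by decide,
    show modTwo (mk 30 (-3) 5 (-6)) = ⟨⟨0, 1⟩, ⟨1, 0⟩⟩ by decide]
  revert a b c d a' b' c' d'
  decide

/-- ε⁴ generates the cyclic group 𝔽₄ˣ of order 3. A fourth power is taken because it leaves every
sign character unchanged. -/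
lemma exists_modTwo_eq_one {γ : ZB} (h6 : IsCoprime γ 6) (h0 : (modTwo γ).im = 0) :
    ∃ k : Fin 3, modTwo (γ * (mk 1 1 0 0 ^ 4) ^ (k : ℕ)) = 1 := by
  obtain ⟨y, hy⟩ := exists_modTwo_mul_eq_one h6
  simp only [map_mul, map_pow]
  revert hy h0
  generalize modTwo γ = x
  obtain ⟨⟨a, b⟩, ⟨c, d⟩⟩ := x
  obtain ⟨⟨a', b'⟩, ⟨c', d'⟩⟩ := y
  rw [show modTwo (mk 1 1 0 0) ^ 4 = ⟨⟨1, 1⟩, ⟨0, 0⟩⟩ by decide]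
  revert a b c d a' b' c' d'
  decide

lemma prod_signRep_pow (f : Fin 8 → ℕ) : ∏ j, signRep j ^ f j =
    (-1) ^ f 0 * mk 1 1 0 0 ^ f (Fin.succ 0) * ∏ j, g j ^ f j.succ.succ := by
  have h0 : signRep 0 = -1 := rfl
  have h1 : signRep (Fin.succ 0) = mk 1 1 0 0 := rfl
  have h2 : ∀ j : Fin 6, signRep j.succ.succ = g j := fun _ => rfl
  rw [Fin.prod_univ_succ, Fin.prod_univ_succ, mul_assoc, h0, h1]
  simp only [h2]

lemma modTwo_im_prod_signRep (f : Fin 8 → Fin 2) :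
    (modTwo (∏ j, signRep j ^ (f j : ℕ))).im = 0 := by
  have key := Finset.prod_induction (s := Finset.univ) (fun j => signRep j ^ (f j : ℕ))
    (fun x => (modTwo x).im = 0) (fun _ _ => modTwo_im_mul) (by rw [map_one]; rfl)
  refine key ?_
  intro j _
  have h : (modTwo (signRep j)).im = 0 := by revert j; decide
  generalize f j = e
  fin_cases e
  · rw [pow_zero, map_one]; rfl
  · rwa [pow_one]


end ZB

namespace ZB

lemma ne_zero_of_isCoprime_six {γ : ZB} (h : IsCoprime γ 6) : γ ≠ 0 := by
  rintro rfl
  obtain ⟨a, b, hab⟩ := h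
  have h1 := congrArg (modThree 0) hab
  rw [mul_zero, zero_add, map_mul, map_ofNat, map_one,
    show (OfNat.ofNat 6 : ZMod 3) = 0 by decide, mul_zero] at h1
  exact zero_ne_one h1

/-- Every element prime to `6` becomes totally positive and congruent to `1` modulo `6` after
multiplication by a unit and some of the elements `g j`. -/
theorem exists_isUnit_mul_prod {γ : ZB} (h6 : IsCoprime γ 6) :
    ∃ u : ZB, IsUnit u ∧ ∃ f : Fin 6 → Fin 2,
      6 ∣ u * γ * ∏ j, g j ^ (f j : ℕ) - 1 ∧ IsTotPos (u * γ * ∏ j, g j ^ (f j : ℕ)) := by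
  have hu : IsUnit (mk 8 0 3 0) ∧ IsUnit (mk 30 (-3) 5 (-6)) ∧ IsUnit (mk 1 1 0 0) :=
    ⟨isUnit_of_norm (by decide), isUnit_of_norm (by decide), isUnit_of_norm (by decide)⟩
  -- The order matters: units bring the class modulo 2 into 𝔽₄, then the representatives, whose
  -- classes also lie in 𝔽₄, correct the eight signs, and finally a power of ε⁴ trivializes the
  -- class modulo 2 without altering signs.
  obtain ⟨i, j, hij⟩ := exists_modTwo_im_eq_zero h6
  obtain ⟨u₁, hu₁⟩ : ∃ u, u = mk 8 0 3 0 ^ (i : ℕ) * mk 30 (-3) 5 (-6) ^ (j : ℕ) := ⟨_, rfl⟩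
  have hu₁' : IsUnit u₁ := hu₁ ▸ (hu.1.pow _).mul (hu.2.1.pow _)
  have hcop : IsCoprime (γ * u₁) 6 := (isCoprime_mul_unit_right_left hu₁' _ _).2 h6
  have hne := rayChar_ne_zero (ne_zero_of_isCoprime_six hcop)
    (hcop.of_isCoprime_of_dvd_right ⟨2, by norm_num⟩)
  obtain ⟨f, hf⟩ := exists_mul_prod_pow_eq_one _ rayChar_signRep_self rayChar_signRep_of_lt
    rayChar_signRep_ne_zero _ hne
  obtain ⟨γ₂, hγ₂⟩ : ∃ x, x = γ * u₁ * ∏ j, signRep j ^ (f j : ℕ) := ⟨_, rfl⟩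
  have hf₂ : ∀ i, rayChar i γ₂ = 1 := fun i => by
    rw [hγ₂, map_mul, map_prod, ← hf i]
    simp only [map_pow]
  have hcop₂ : IsCoprime γ₂ 6 := by
    rw [hγ₂]
    exact hcop.mul_left (IsCoprime.prod_left fun j _ => (isCoprime_signRep_six j).pow_left)
  have him : (modTwo γ₂).im = 0 := by
    rw [hγ₂]
    exact modTwo_im_mul (hu₁ ▸ hij) (modTwo_im_prod_signRep f)
  obtain ⟨k, hk⟩ := exists_modTwo_eq_one hcop₂ him
  refine ⟨u₁ * ((-1) ^ (f 0 : ℕ) * mk 1 1 0 0 ^ (f (Fin.succ 0) : ℕ)) * (mk 1 1 0 0 ^ 4) ^ (k : ℕ),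
    (hu₁'.mul ((isUnit_one.neg.pow _).mul (hu.2.2.pow _))).mul ((hu.2.2.pow _).pow _),
    fun j => f j.succ.succ, ?_⟩
  have heq : u₁ * ((-1) ^ (f 0 : ℕ) * mk 1 1 0 0 ^ (f (Fin.succ 0) : ℕ)) * (mk 1 1 0 0 ^ 4) ^ (k : ℕ) * γ *
      ∏ j, g j ^ (f j.succ.succ : ℕ) = γ₂ * (mk 1 1 0 0 ^ 4) ^ (k : ℕ) := by
    rw [hγ₂, prod_signRep_pow]
    generalize mk 1 1 0 0 = e
    generalize ∏ j, g j ^ (f j.succ.succ : ℕ) = q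
    ring
  have hfour : ∀ s : SignType, s ≠ 0 → s ^ 4 = 1 := by decide
  have hchar : ∀ i, rayChar i (γ₂ * (mk 1 1 0 0 ^ 4) ^ (k : ℕ)) = 1 := by
    intro i
    rw [map_mul, hf₂, one_mul, map_pow, map_pow, hfour _ (show rayChar i (mk 1 1 0 0) ≠ 0 from
      rayChar_signRep_ne_zero i 1), one_pow]
  rw [heq]
  refine ⟨?_, isTotPos_of_rayChar hchar⟩
  have h23 : IsCoprime (2 : ZB) 3 := ⟨-1, 1, by norm_num⟩
  have := h23.mul_dvd (two_dvd_of_modTwo hk) (three_dvd_of_rayChar hchar)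
  rwa [show (2 : ZB) * 3 = 6 by norm_num] at this

lemma six_dvd_of_mod {x : ZB} (h2 : modTwo x = 1) (h3 : ∀ i, modThree i x = 1) : 6 ∣ x - 1 := by
  have h23 : IsCoprime (2 : ZB) 3 := ⟨-1, 1, by norm_num⟩
  have := h23.mul_dvd (two_dvd_of_modTwo h2) (three_dvd_of_modThree h3)
  rwa [show (2 : ZB) * 3 = 6 by norm_num] at this

/-- The unit groups modulo 2 and 3 have exponents dividing 6. This allows a fraction a/b to be
replaced by the integer ab⁵, which differs from it by the square b⁶ ≡ 1 mod 6. -/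
lemma six_dvd_pow_six_sub_one {x : ZB} (h : IsCoprime x 6) : 6 ∣ x ^ 6 - 1 := by
  refine six_dvd_of_mod ?_ fun i => ?_
  · obtain ⟨y, hy⟩ := exists_modTwo_mul_eq_one h
    rw [map_pow]
    revert hy
    generalize modTwo x = z
    obtain ⟨⟨a, b⟩, ⟨c, d⟩⟩ := z
    obtain ⟨⟨a', b'⟩, ⟨c', d'⟩⟩ := y
    revert a b c d a' b' c' d'
    decide
  · have h3 := modThree_ne_zero (h.of_isCoprime_of_dvd_right ⟨2, by norm_num⟩) i
    rw [map_pow]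
    revert h3
    generalize modThree i x = c
    revert c
    decide

end ZB

/-! ### The matrix of symbols of d_i modulo g_j -/

namespace ZB

/-- The quadratic residue symbol modulo a prime element `x` of degree one with `ω ≡ w` and
`√7 ≡ s` modulo `x`. -/
lemma leg_span_eq {x : ZB} {p : ℕ} (hp : p.Prime) (h2 : p ≠ 2) (hn : x.norm.norm.natAbs = p)
    (w s : ℤ) (hw : (p : ℤ) ∣ w * w - (w + 3)) (hs : (p : ℤ) ∣ s * s - 7)
    (hx : (p : ℤ) ∣ x.re.re + x.re.im * w + (x.im.re + x.im.im * w) * s) {y : ZB} {n : ℕ}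
    (hy : (p : ℤ) ∣ y.re.re + y.re.im * w + (y.im.re + y.im.im * w) * s - n) {e : ℤ}
    (he : e = 1 ∨ e = -1) (hpow : (p : ℤ) ∣ (n ^ (p / 2) % p : ℕ) - e) :
    leg (Ideal.span {x}) y = e := by
  have := Fact.mk hp
  have cast : ∀ a b : ℤ, (p : ℤ) ∣ a - b → (a : ZMod p) = b := fun a b h => by
    rwa [← sub_eq_zero, ← Int.cast_sub, ZMod.intCast_zmod_eq_zero_iff_dvd]
  have hw' : (w : ZMod p) * w = w + 3 := by exact_mod_cast cast _ _ hw
  have hs' : (s : ZMod p) * s = 7 := by exact_mod_cast cast _ _ hs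
  set τ := lift (w : ZMod p) s hw' hs' with hτ
  have hsurj : Function.Surjective τ := fun a => ⟨(a.val : ZB), by simp⟩
  have hcard : Nat.card (ZB ⧸ RingHom.ker τ) = p := by
    rw [Nat.card_congr (RingHom.quotientKerEquivOfSurjective hsurj).toEquiv, Nat.card_zmod]
  have habs : Ideal.absNorm (RingHom.ker τ) = p := hcard
  have hxP : x ∈ RingHom.ker τ := by
    rw [RingHom.mem_ker, hτ, lift_apply]
    exact_mod_cast (ZMod.intCast_zmod_eq_zero_iff_dvd _ p).2 hx
  have hP : RingHom.ker τ = Ideal.span {x} :=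
    eq_span_of_absNorm hxP (by rw [habs]; exact hp.ne_zero) (by rw [habs, hn])
  have hmax : (RingHom.ker τ).IsMaximal := RingHom.ker_isMaximal_of_surjective τ hsurj
  have hfin : Finite (ZB ⧸ RingHom.ker τ) :=
    Nat.finite_of_card_ne_zero (by rw [hcard]; exact hp.ne_zero)
  have h2' : (2 : ZB) ∉ RingHom.ker τ := by
    rw [RingHom.mem_ker, map_ofNat]
    have : ((2 : ℕ) : ZMod p) ≠ 0 := by
      rw [Ne, ZMod.natCast_eq_zero_iff, Nat.prime_dvd_prime_iff_eq hp Nat.prime_two]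
      exact h2
    exact_mod_cast this
  have hτy : τ y = n := by
    rw [hτ, lift_apply]
    exact_mod_cast cast _ n hy
  have hpow' : (n : ZMod p) ^ (p / 2) = e := by
    rw [← Nat.cast_pow, ← ZMod.natCast_mod]
    exact_mod_cast cast _ _ hpow
  have hyP : y ∉ RingHom.ker τ := by
    intro h
    have hp2 := hp.two_le
    rw [RingHom.mem_ker, hτy] at h
    rw [h, zero_pow (by omega)] at hpow'
    rcases he with rfl | rfl <;> simp at hpow'
  rw [← hP]
  refine eq_of_int_sub_mem h2' (leg_eq_one_or hyP) he ?_
  have h := leg_euler (RingHom.ker τ) h2' y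
  rw [hcard] at h
  have h' : ((e : ZB) - y ^ (p / 2)) ∈ RingHom.ker τ := by
    rw [RingHom.mem_ker, map_sub, map_intCast, map_pow, hτy, hpow', sub_self]
  have := sub_mem h h'
  rwa [sub_sub_sub_cancel_right] at this

/-- The quadratic residue symbols of the `d i` modulo the `g j`. -/
def legMatrix : Fin 6 → Fin 6 → ℤˣ :=
  ![![-1, 1, -1, 1, -1, 1], ![-1, 1, 1, 1, -1, -1], ![-1, -1, -1, 1, 1, -1],
    ![-1, -1, -1, 1, -1, 1], ![-1, -1, -1, -1, 1, 1], ![-1, -1, -1, 1, 1, 1]]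

/-- In each case the two numerals after the prime p are the residues of ω and √7 modulo `g j`, and
the list `n` gives the residues of the six `d i`. -/
lemma leg_g_d (j i : Fin 6) : leg (Ideal.span {g j}) (d i) = legMatrix j i := by
  have he : ∀ u : ℤˣ, (u : ℤ) = 1 ∨ (u : ℤ) = -1 := fun u => Int.isUnit_iff.1 u.isUnit
  fin_cases j
  · refine leg_span_eq (p := 199) (by norm_num) (by norm_num) (by decide) 25 87 (by decide)
      (by decide) (by decide) (n := ![198, 26, 3, 53, 153, 4] i) (by revert i; decide) (he _) ?_
    fin_cases i <;> norm_num [legMatrix]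
  · refine leg_span_eq (p := 139) (by norm_num) (by norm_num) (by decide) 119 29 (by decide)
      (by decide) (by decide) (n := ![138, 120, 41, 64, 82, 105] i) (by revert i; decide) (he _) ?_
    fin_cases i <;> norm_num [legMatrix]
  · refine leg_span_eq (p := 1447) (by norm_num) (by norm_num) (by decide) 882 427 (by decide)
      (by decide) (by decide) (n := ![1446, 883, 292, 31, 1423, 1162] i) (by revert i; decide)
      (he _) ?_
    revert i; decide +kernel
  · refine leg_span_eq (p := 199) (by norm_num) (by norm_num) (by decide) 175 87 (by decide)
      (by decide) (by decide) (n := ![198, 176, 153, 4, 3, 53] i) (by revert i; decide) (he _) ?_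
    fin_cases i <;> norm_num [legMatrix]
  · refine leg_span_eq (p := 139) (by norm_num) (by norm_num) (by decide) 21 29 (by decide)
      (by decide) (by decide) (n := ![138, 22, 82, 105, 41, 64] i) (by revert i; decide) (he _) ?_
    fin_cases i <;> norm_num [legMatrix]
  · refine leg_span_eq (p := 2687) (by norm_num) (by norm_num) (by decide) 2204 127 (by decide)
      (by decide) (by decide) (n := ![2686, 2205, 2461, 1953, 741, 233] i) (by revert i; decide)
      (he _) ?_
    revert i; decide +kernel

/-- Independence of the rows over 𝔽₂: this bounds the kernel of the Artin map. -/
lemma eq_zero_of_prod_legMatrix (f : Fin 6 → Fin 2)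
    (h : ∀ i, ∏ j, legMatrix j i ^ (f j : ℕ) = 1) : f = 0 := by
  have key : ∀ a b c d e k : Fin 2, (∀ i, legMatrix 0 i ^ (a : ℕ) * legMatrix 1 i ^ (b : ℕ) *
      legMatrix 2 i ^ (c : ℕ) * legMatrix 3 i ^ (d : ℕ) * legMatrix 4 i ^ (e : ℕ) *
      legMatrix 5 i ^ (k : ℕ) = 1) → a = 0 ∧ b = 0 ∧ c = 0 ∧ d = 0 ∧ e = 0 ∧ k = 0 := by
    decide
  simp only [Fin.prod_univ_six] at h
  obtain ⟨h0, h1, h2, h3, h4, h5⟩ := key _ _ _ _ _ _ h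
  ext1 i
  fin_cases i
  exacts [h0, h1, h2, h3, h4, h5]

lemma eq_top_of_legMatrix_mem {H : Subgroup (Fin 6 → ℤˣ)} (h : ∀ j, legMatrix j ∈ H) : H = ⊤ := by
  have h1 : ∀ i, Pi.mulSingle i (-1) ∈ H := by
    -- The inverse over 𝔽₂ of the exponent matrix of `legMatrix`.
    let M : Fin 6 → Fin 6 → ℕ := ![![0, 1, 1, 1, 0, 0], ![1, 0, 0, 1, 0, 0], ![1, 1, 1, 0, 0, 1], ![0, 0, 0, 0, 1, 1], ![0, 0, 0, 1, 0, 1], ![0, 0, 1, 0, 0, 1]]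
    have h2 : ∀ i, ∏ j, legMatrix j ^ M i j = Pi.mulSingle i (-1) := by decide
    exact fun i => h2 i ▸ prod_mem fun j _ => pow_mem (h j) _
  rw [eq_top_iff]
  rintro v -
  rw [← Finset.univ_prod_mulSingle v]
  refine prod_mem fun i _ => ?_
  rcases Int.units_eq_one_or (v i) with h2 | h2 <;> rw [h2]
  · rw [Pi.mulSingle_one]
    exact one_mem _
  · exact h1 i

end ZB

/-! ### Homomorphisms from the group of fractional ideals -/

namespace FractionalIdeal

variable {R : Type*} [CommRing R] [IsDedekindDomain R] (K : Type*) [Field K] [Algebra R K]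
  [IsFractionRing R K] {G : Type*} [CommGroup G]

/-- A nonzero ideal as an invertible fractional ideal. -/
def unitOfNeBot {I : Ideal R} (h : I ≠ ⊥) : (FractionalIdeal R⁰ K)ˣ :=
  Units.mk0 I (coeIdeal_ne_zero.2 h)

lemma unitOfNeBot_mul {I J : Ideal R} (hI : I ≠ ⊥) (hJ : J ≠ ⊥) :
    unitOfNeBot K (mul_ne_zero hI hJ : I * J ≠ ⊥) = unitOfNeBot K hI * unitOfNeBot K hJ :=
  Units.ext (coeIdeal_mul I J)

lemma unitOfNeBot_span {a : R} (h : Ideal.span {a} ≠ ⊥) {α : Kˣ} (hα : (α : K) = algebraMap R K a) :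
    unitOfNeBot K h = toPrincipalIdeal R K α := by
  rw [eq_comm, toPrincipalIdeal_eq_iff, hα]
  exact (coeIdeal_span_singleton a).symm

variable {K}

lemma finite_mulSupport_zpow_count (χ : HeightOneSpectrum R → G) (I : FractionalIdeal R⁰ K) :
    (Function.mulSupport fun v => χ v ^ count K v I).Finite := by
  refine Set.Finite.subset (finite_factors I) fun v hv h => hv ?_
  change χ v ^ count K v I = 1
  rw [show count K v I = 0 from h, zpow_zero]

/-- The homomorphism from the group of fractional ideals with given values at the primes. -/
def liftHom (χ : HeightOneSpectrum R → G) : (FractionalIdeal R⁰ K)ˣ →* G where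
  toFun I := ∏ᶠ v, χ v ^ count K v (I : FractionalIdeal R⁰ K)
  map_one' := by simp [count_one]
  map_mul' I J := by
    rw [← finprod_mul_distrib (finite_mulSupport_zpow_count χ _)
      (finite_mulSupport_zpow_count χ _)]
    refine finprod_congr fun v => ?_
    rw [Units.val_mul, count_mul K v I.ne_zero J.ne_zero, zpow_add]

lemma liftHom_prime (χ : HeightOneSpectrum R → G) {I : (FractionalIdeal R⁰ K)ˣ}
    {v : HeightOneSpectrum R} (h : (I : FractionalIdeal R⁰ K) = v.asIdeal) :
    liftHom χ I = χ v := by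
  change ∏ᶠ w, χ w ^ count K w (I : FractionalIdeal R⁰ K) = _
  rw [finprod_eq_single _ v, h, count_self, zpow_one]
  intro w hw
  rw [h, count_maximal_coprime K w hw.symm, zpow_zero]

end FractionalIdeal

section

variable {R ι : Type*} [CommRing R] [IsDedekindDomain R] {K : Type*} [Field K] [Algebra R K]
  [IsFractionRing R K]

set_option linter.unusedSectionVars false

open Classical in
/-- The quadratic residue symbols as units. -/
def legUnit (d : ι → R) (v : HeightOneSpectrum R) (i : ι) : ℤˣ :=
  -- The value 1 is also taken when the symbol is 0, so the homomorphism is defined on all ideals;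
  -- only primes not containing `d i` matter.
  if leg v.asIdeal (d i) = -1 then -1 else 1

lemma legUnit_eq {d : ι → R} {v : HeightOneSpectrum R} {i : ι} (h : d i ∉ v.asIdeal) :
    (legUnit d v i : ℤ) = leg v.asIdeal (d i) := by
  unfold legUnit
  rcases leg_eq_one_or h with h1 | h1 <;> simp [h1]

lemma liftHom_legUnit_eq_jac {d : ι → R} {i : ι} {I : Ideal R} (hI : I ≠ ⊥)
    (hd : Ideal.span {d i} ⊔ I = ⊤) :
    (FractionalIdeal.liftHom (legUnit d) (FractionalIdeal.unitOfNeBot K hI) i : ℤ) =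
      jac I (d i) := by
  have key : ∀ (hI : I ≠ ⊥), Ideal.span {d i} ⊔ I = ⊤ →
      (FractionalIdeal.liftHom (legUnit d) (FractionalIdeal.unitOfNeBot K hI) i : ℤ) =
        jac I (d i) := by
    refine jac_induction (p := fun I => ∀ (hI : I ≠ ⊥), Ideal.span {d i} ⊔ I = ⊤ →
      (FractionalIdeal.liftHom (legUnit d) (FractionalIdeal.unitOfNeBot K hI) i : ℤ) =
        jac I (d i)) ?_ ?_ hI
    · intro h _
      have : FractionalIdeal.unitOfNeBot K h = 1 := Units.ext (FractionalIdeal.coeIdeal_top _)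
      rw [this, map_one, jac_top]
      rfl
    · intro P I hP hP0 hI0 ih h hd
      have h1 : Ideal.span {d i} ⊔ P = ⊤ := top_le_iff.1 (hd ▸ sup_le_sup_left Ideal.mul_le_left _)
      have h2 : Ideal.span {d i} ⊔ I = ⊤ := top_le_iff.1 (hd ▸ sup_le_sup_left Ideal.mul_le_right _)
      have h3 : d i ∉ P := fun hc => hP.ne_top (by
        rwa [sup_eq_right.2 ((Ideal.span_singleton_le_iff_mem P).2 hc)] at h1)
      rw [FractionalIdeal.unitOfNeBot_mul K hP0 hI0, map_mul, Pi.mul_apply, Units.val_mul,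
        ih hI0 h2, jac_mul_ideal hP0 hI0, jac_of_isPrime hP0]
      congr 1
      have h4 := FractionalIdeal.liftHom_prime (K := K) (legUnit d)
        (I := FractionalIdeal.unitOfNeBot K hP0) (v := ⟨P, hP.isPrime, hP0⟩) rfl
      rw [h4]
      exact legUnit_eq (v := ⟨P, hP.isPrime, hP0⟩) h3
  exact key hI hd

end

namespace Example256

/-! ### The Artin map of `N' / F` -/

lemma d_dvd_six (i : Fin 6) : ZB.d i ∣ 6 := by
  have h : ∀ i, ZB.d i * ![-6, ZB.mk (-12) 6 0 0, ZB.mk 96 74 (-36) (-28), ZB.mk 96 74 36 28,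
      ZB.mk 170 (-74) (-64) 28, ZB.mk 170 (-74) 64 (-28)] i = 6 := by decide
  exact Dvd.intro _ (h i)

lemma dF_dvd_six (i : Fin 6) : dF i ∣ 6 := by
  have := map_dvd ringEquiv.symm (d_dvd_six i)
  rwa [map_ofNat] at this

lemma leg_map (x y : ZB) :
    leg (Ideal.span {ringEquiv.symm x}) (ringEquiv.symm y) = leg (Ideal.span {x}) y := by
  rw [← leg_map_ringEquiv ringEquiv.symm, Ideal.map_span, Set.image_singleton]

lemma jac_map {x : ZB} (hx : x ≠ 0) (y : ZB) :
    jac (Ideal.span {ringEquiv.symm x}) (ringEquiv.symm y) = jac (Ideal.span {x}) y := by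
  rw [← jac_map_ringEquiv ringEquiv.symm (by simpa using hx), Ideal.map_span, Set.image_singleton]

/-- The signs by which an automorphism of `N' / F` acts on the six square roots. -/
def signN : Gal(N'/F) →* (Fin 6 → ℤˣ) :=
  Multiquadratic.signHom (d := fun i => algebraMap ZB F (ZB.d i)) sqrtN_ne_zero sqrtN_sq

lemma signN_injective : Function.Injective signN :=
  Multiquadratic.sign_injective sqrtN_sq adjoin_sqrtN

lemma two_notMem {v : HeightOneSpectrum (𝓞 F)} (hv : (6 : 𝓞 F) ∉ v.asIdeal) : (2 : 𝓞 F) ∉ v.asIdeal :=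
  fun h => hv (by
    have := v.asIdeal.mul_mem_right 3 h
    norm_num at this
    exact this)

lemma dF_notMem {v : HeightOneSpectrum (𝓞 F)} (hv : (6 : 𝓞 F) ∉ v.asIdeal) (i : Fin 6) :
    dF i ∉ v.asIdeal := fun h => hv (Ideal.mem_of_dvd _ (dF_dvd_six i) h)

lemma signN_eq_legUnit {v : HeightOneSpectrum (𝓞 F)} (hv : (6 : 𝓞 F) ∉ v.asIdeal)
    {P : Ideal (𝓞 N')} [P.IsPrime] [P.LiesOver v.asIdeal] {σ : Gal(N'/F)}
    (hσ : (RingOfIntegers.mapAlgHom (σ : N' ≃ₐ[F] N')).IsArithFrobAt P) :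
    signN σ = legUnit dF v := by
  ext i
  rw [legUnit_eq (dF_notMem hv i)]
  exact Multiquadratic.sign_eq_leg sqrtO_sq (two_notMem hv) (dF_notMem hv i) hσ

lemma ne_bot_of_liesOver {v : HeightOneSpectrum (𝓞 F)} {P : Ideal (𝓞 N')}
    (hP : P.LiesOver v.asIdeal) : P ≠ ⊥ := by
  rintro rfl
  refine v.ne_bot (hP.over.trans ?_)
  rw [Ideal.under_def]
  exact (RingHom.injective_iff_ker_eq_bot _).1 (FaithfulSMul.algebraMap_injective (𝓞 F) (𝓞 N'))

lemma span_g_isPrime (j : Fin 6) : (Ideal.span {ZB.g j}).IsPrime := by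
  refine Ideal.isPrime_of_irreducible_absNorm ?_
  rw [ZB.absNorm_span]
  refine Nat.Prime.prime ?_ |>.irreducible
  rw [show (ZB.g j).norm.norm.natAbs = ![199, 139, 1447, 199, 139, 2687] j by revert j; decide]
  fin_cases j <;> norm_num

lemma exists_prime_g (j : Fin 6) : ∃ v : HeightOneSpectrum (𝓞 F),
    v.asIdeal = Ideal.span {ringEquiv.symm (ZB.g j)} ∧ (6 : 𝓞 F) ∉ v.asIdeal := by
  have hp := span_g_isPrime j
  have h1 : Ideal.span {ringEquiv.symm (ZB.g j)} = (Ideal.span {ZB.g j}).map ringEquiv.symm := by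
    rw [Ideal.map_span, Set.image_singleton]
  have h2 : (Ideal.span {ringEquiv.symm (ZB.g j)}).IsPrime := by
    rw [h1]; exact Ideal.map_isPrime_of_equiv ringEquiv.symm
  refine ⟨⟨_, h2, ?_⟩, rfl, ?_⟩
  · rw [Ne, Ideal.span_singleton_eq_bot, map_eq_zero_iff _ ringEquiv.symm.injective]
    clear h1 h2 hp
    revert j; decide
  · intro h
    have h3 : ZB.g j ∣ 6 := by
      have := map_dvd ringEquiv (Ideal.mem_span_singleton.1 h)
      rwa [RingEquiv.apply_symm_apply, map_ofNat] at this
    refine hp.ne_top (Ideal.span_singleton_eq_top.2 ?_)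
    exact (ZB.isCoprime_signRep_six j.succ.succ).isUnit_of_dvd h3

/-- Frobenius elements above the primes generated by `ZB.g j` have the rows of `ZB.legMatrix` as
sign vectors, and these generate {±1}⁶. -/
lemma signN_surjective : Function.Surjective signN := by
  rw [← MonoidHom.range_eq_top]
  refine ZB.eq_top_of_legMatrix_mem fun j => ?_
  obtain ⟨v, hv, h6⟩ := exists_prime_g j
  have := v.isMaximal
  obtain ⟨P, hP, hPv⟩ := Ideal.exists_maximal_ideal_liesOver_of_isIntegral (S := 𝓞 N') v.asIdeal
  have := hP.isPrime
  obtain ⟨σ, hσ⟩ := Multiquadratic.exists_isArithFrobAt (K := F) P (ne_bot_of_liesOver hPv)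
  refine ⟨σ, ?_⟩
  rw [signN_eq_legUnit h6 hσ]
  ext i
  rw [legUnit_eq (dF_notMem h6 i), hv, dF, leg_map, ZB.leg_g_d]

/-- The automorphisms of `N' / F` correspond to the vectors of signs. -/
def signEquiv : Gal(N'/F) ≃* (Fin 6 → ℤˣ) :=
  MulEquiv.ofBijective signN ⟨signN_injective, signN_surjective⟩

lemma finrank_F_N : Module.finrank F N' = 64 := by
  rw [← IsGalois.card_aut_eq_finrank, Nat.card_congr signEquiv.toEquiv, Nat.card_eq_fintype_card]
  rfl

theorem finrank_N : Module.finrank ℚ N' = 256 := by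
  rw [← Module.finrank_mul_finrank ℚ F N', finrank_F, finrank_F_N]

/-- The Artin map, on all fractional ideals. -/
def artin : (FractionalIdeal (𝓞 F)⁰ F)ˣ →* Gal(N'/F) :=
  signEquiv.symm.toMonoidHom.comp (FractionalIdeal.liftHom (legUnit dF))

lemma artin_eq_iff {I : (FractionalIdeal (𝓞 F)⁰ F)ˣ} {σ : Gal(N'/F)} :
    artin I = σ ↔ FractionalIdeal.liftHom (legUnit dF) I = signN σ := by
  change signEquiv.symm _ = σ ↔ _
  rw [MulEquiv.symm_apply_eq]
  rfl

/-- A Frobenius at P exists, its sign vector is the vector of residue symbols at v, and an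
automorphism is determined by its signs. -/
lemma isArithFrobAt_artin {I : (FractionalIdeal (𝓞 F)⁰ F)ˣ} {v : HeightOneSpectrum (𝓞 F)}
    (h6 : (6 : 𝓞 F) ∉ v.asIdeal) (hI : (I : FractionalIdeal (𝓞 F)⁰ F) = v.asIdeal)
    {P : Ideal (𝓞 N')} (hP : P.IsPrime) (hPv : P.LiesOver v.asIdeal) :
    (RingOfIntegers.mapAlgHom (artin I : N' ≃ₐ[F] N')).IsArithFrobAt P := by
  obtain ⟨σ, hσ⟩ := Multiquadratic.exists_isArithFrobAt (K := F) P (ne_bot_of_liesOver hPv)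
  have : artin I = σ := by
    rw [artin_eq_iff, signN_eq_legUnit h6 hσ, FractionalIdeal.liftHom_prime _ hI]
  rwa [this]

end Example256

namespace ZB

lemma jac_span_prod_pow {ι : Type*} (s : Finset ι) {x : ι → ZB} (hx : ∀ i, x i ≠ 0) (f : ι → ℕ)
    (z : ZB) : jac (Ideal.span {∏ i ∈ s, x i ^ f i}) z =
      ∏ i ∈ s, jac (Ideal.span {x i}) z ^ f i := by
  classical
  have hpow : ∀ i n, jac (Ideal.span {x i ^ n}) z = jac (Ideal.span {x i}) z ^ n := by
    intro i n
    induction n with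
    | zero => rw [pow_zero, pow_zero, Ideal.span_singleton_one, jac_top]
    | succ n ih => rw [pow_succ, jac_mul_span (pow_ne_zero _ (hx i)) (hx i), ih, pow_succ]
  induction s using Finset.induction_on with
  | empty => rw [Finset.prod_empty, Finset.prod_empty, Ideal.span_singleton_one, jac_top]
  | insert i s hi ih =>
    rw [Finset.prod_insert hi, Finset.prod_insert hi, jac_mul_span (pow_ne_zero _ (hx i))
      (Finset.prod_ne_zero_iff.2 fun j _ => pow_ne_zero _ (hx j)), ih, hpow]

lemma g_ne_zero (j : Fin 6) : g j ≠ 0 := by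
  revert j; decide

end ZB

namespace Example256

/-! ### The kernel of the Artin map -/

lemma isCoprime_ringEquiv {x : 𝓞 F} (h : IsCoprime x 6) : IsCoprime (ringEquiv x) 6 := by
  have := h.map (ringEquiv : 𝓞 F →+* ZB)
  rwa [map_ofNat] at this

lemma artin_principal {γ : 𝓞 F} (h0 : Ideal.span {γ} ≠ ⊥) (h6 : IsCoprime γ 6) (i : Fin 6) :
    (FractionalIdeal.liftHom (legUnit dF) (FractionalIdeal.unitOfNeBot F h0) i : ℤ) =
      jac (Ideal.span {ringEquiv γ}) (ZB.d i) := by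
  have hγ : ringEquiv γ ≠ 0 := by
    rwa [Ne, map_eq_zero_iff _ ringEquiv.injective, ← Ideal.span_singleton_eq_bot]
  rw [liftHom_legUnit_eq_jac h0, ← jac_map hγ, RingEquiv.symm_apply_apply, dF]
  rw [← Ideal.isCoprime_iff_sup_eq, Ideal.isCoprime_span_singleton_iff]
  exact (h6.of_isCoprime_of_dvd_right (dF_dvd_six i)).symm

lemma isTotPos_iff {γ : 𝓞 F} {α : Fˣ} (h : (α : F) = γ) :
    ZB.IsTotPos (ringEquiv γ) ↔ RayClass.IsTotallyPositive α := by
  constructor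
  · intro h1 φ
    have := h1 (φ.comp (algebraMap ZB F))
    rwa [RingHom.comp_apply, algebraMap_ringEquiv, ← h] at this
  · intro h1 φ
    have hφ : Function.Injective φ :=
      (injective_iff_map_eq_zero φ).2 fun x hx => by_contra fun h0 => ZB.hom_ne_zero φ h0 hx
    have := h1 (IsFractionRing.lift hφ)
    rwa [h, ← algebraMap_ringEquiv, IsFractionRing.lift_algebraMap] at this

lemma liftHom_eq_one_of_ray {γ : 𝓞 F} (h0 : Ideal.span {γ} ≠ ⊥) (h6 : 6 ∣ ringEquiv γ - 1)
    (hp : ZB.IsTotPos (ringEquiv γ)) :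
    FractionalIdeal.liftHom (legUnit dF) (FractionalIdeal.unitOfNeBot F h0) = 1 := by
  have hc : IsCoprime (ringEquiv γ) 6 := by
    obtain ⟨c, hc⟩ := h6
    exact ⟨1, -c, by linear_combination hc⟩
  have hc' : IsCoprime γ 6 := by
    have := hc.map (ringEquiv.symm : ZB →+* 𝓞 F)
    rwa [map_ofNat, RingEquiv.coe_toRingHom, RingEquiv.symm_apply_apply] at this
  ext i
  rw [artin_principal h0 hc']
  refine ZB.jac_d_eq_one h6 hp ?_ i
  rwa [Ne, map_eq_zero_iff _ ringEquiv.injective, ← Ideal.span_singleton_eq_bot]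

lemma liftHom_pow_two (I : (FractionalIdeal (𝓞 F)⁰ F)ˣ) :
    FractionalIdeal.liftHom (legUnit dF) (I ^ 2) = 1 := by
  ext i
  rw [map_pow, Pi.pow_apply, Int.units_sq]
  rfl

lemma isCoprime_iff_sup {x : 𝓞 F} :
    Ideal.span {x} ⊔ Ideal.span {(6 : 𝓞 F)} = ⊤ ↔ IsCoprime x 6 := by
  rw [← Ideal.isCoprime_iff_sup_eq, Ideal.isCoprime_span_singleton_iff]

lemma span_ne_bot_of_isCoprime {x : 𝓞 F} (h : IsCoprime x 6) : Ideal.span {x} ≠ ⊥ := by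
  rw [Ne, Ideal.span_singleton_eq_bot]
  rintro rfl
  have := ZB.ne_zero_of_isCoprime_six (isCoprime_ringEquiv h)
  exact this (map_zero _)

/-- For α = a/b the integer ab⁵ = αb⁶ is totally positive and 1 modulo 6, and the square b⁶ does not
change the symbols. -/
lemma artin_eq_one_of_ray {α : Fˣ} (h1 : RayClass.IsOneMod (Ideal.span {(6 : 𝓞 F)}) α)
    (hp : RayClass.IsTotallyPositive α) : artin (toPrincipalIdeal (𝓞 F) F α) = 1 := by
  obtain ⟨a, b, hb0, ha, hb, hab, hα⟩ := h1
  rw [isCoprime_iff_sup] at ha hb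
  have hb' : (b : F) ≠ 0 := by exact_mod_cast hb0
  have hγ : IsCoprime (a * b ^ 5) 6 := ha.mul_left hb.pow_left
  set β : Fˣ := Units.mk0 (b : F) hb' with hβ
  have heq : ((α * β ^ 6 : Fˣ) : F) = (a * b ^ 5 : 𝓞 F) := by
    push_cast
    rw [hα, hβ, Units.val_mk0]
    field_simp
  rw [artin_eq_iff, map_one]
  have h2 : FractionalIdeal.liftHom (legUnit dF) (toPrincipalIdeal (𝓞 F) F (α * β ^ 6)) = 1 := by
    rw [← FractionalIdeal.unitOfNeBot_span F (span_ne_bot_of_isCoprime hγ) heq]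
    refine liftHom_eq_one_of_ray _ ?_ ((isTotPos_iff heq).2 fun φ => ?_)
    · obtain ⟨c, hc⟩ := ZB.six_dvd_pow_six_sub_one (isCoprime_ringEquiv hb)
      obtain ⟨e, he⟩ := map_dvd ringEquiv (Ideal.mem_span_singleton.1 hab)
      rw [map_sub, map_ofNat] at he
      refine ⟨e * ringEquiv b ^ 5 + c, ?_⟩
      rw [map_mul, map_pow]
      linear_combination hc + ringEquiv b ^ 5 * he
    · have := hp φ
      push_cast
      rw [map_mul, map_pow]
      have h3 : φ β ≠ 0 := (map_ne_zero φ).2 β.ne_zero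
      positivity
  rw [map_mul, map_mul, show β ^ 6 = (β ^ 3) ^ 2 by rw [← pow_mul], map_pow, liftHom_pow_two,
    mul_one] at h2
  exact h2

/-- The ideal is generated by a reduced fraction a/b. At a prime above 6 the numerator and
denominator have equal valuation, and by coprimality it is 0. -/
lemma exists_eq_div_of_mem {I : (FractionalIdeal (𝓞 F)⁰ F)ˣ}
    (hI : I ∈ RayClass.idealsPrimeTo (Ideal.span {(6 : 𝓞 F)})) :
    ∃ a b : 𝓞 F, ∃ α : Fˣ, IsCoprime a 6 ∧ IsCoprime b 6 ∧ (α : F) = a / b ∧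
      I = toPrincipalIdeal (𝓞 F) F α := by
  obtain ⟨x, hx⟩ := (FractionalIdeal.isPrincipal_iff _).1
    (FractionalIdeal.isPrincipal (I : FractionalIdeal (𝓞 F)⁰ F))
  have hx0 : x ≠ 0 := by
    rintro rfl
    rw [FractionalIdeal.spanSingleton_zero] at hx
    exact I.ne_zero hx
  obtain ⟨a, ⟨b, hb⟩, hab, hxab⟩ := IsFractionRing.exists_reduced_fraction (A := 𝓞 F) x
  rw [IsFractionRing.mk'_eq_div] at hxab
  have hb0 : b ≠ 0 := nonZeroDivisors.ne_zero hb
  have hb' : algebraMap (𝓞 F) F b ≠ 0 := by rwa [Ne, FaithfulSMul.algebraMap_eq_zero_iff]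
  have ha0 : a ≠ 0 := by
    rintro rfl
    rw [map_zero, zero_div] at hxab
    exact hx0 hxab.symm
  have hspan : ∀ {y : 𝓞 F}, y ≠ 0 → Ideal.span {y} ≠ ⊥ := fun hy => by
    rwa [Ne, Ideal.span_singleton_eq_bot]
  have hIab : (I : FractionalIdeal (𝓞 F)⁰ F) * (Ideal.span {b} : Ideal (𝓞 F)) =
      (Ideal.span {a} : Ideal (𝓞 F)) := by
    rw [hx, FractionalIdeal.coeIdeal_span_singleton, FractionalIdeal.coeIdeal_span_singleton,
      FractionalIdeal.spanSingleton_mul_spanSingleton, ← hxab, div_mul_cancel₀ _ hb']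
  have hcount : ∀ v : HeightOneSpectrum (𝓞 F), (6 : 𝓞 F) ∈ v.asIdeal →
      (a ∈ v.asIdeal ↔ b ∈ v.asIdeal) := by
    intro v hv
    have h1 := hI v (Ideal.dvd_span_singleton.2 hv)
    have h2 := congrArg (FractionalIdeal.count F v) hIab
    rw [FractionalIdeal.count_mul F v I.ne_zero (FractionalIdeal.coeIdeal_ne_zero.2 (hspan hb0)), h1,
      zero_add, FractionalIdeal.count_coe F v (hspan hb0),
      FractionalIdeal.count_coe F v (hspan ha0), Nat.cast_inj] at h2
    rw [← Ideal.dvd_span_singleton, ← Ideal.dvd_span_singleton,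
      ← Associates.count_ne_zero_iff_dvd (hspan ha0) v.irreducible, ← h2,
      Associates.count_ne_zero_iff_dvd (hspan hb0) v.irreducible]
  have hnot : ∀ v : HeightOneSpectrum (𝓞 F), (6 : 𝓞 F) ∈ v.asIdeal →
      a ∉ v.asIdeal ∧ b ∉ v.asIdeal := by
    intro v hv
    have key : ¬ (a ∈ v.asIdeal ∧ b ∈ v.asIdeal) := by
      rintro ⟨h1, h2⟩
      obtain ⟨p, q, hpq⟩ := hab.isCoprime
      exact v.isPrime.ne_top ((Ideal.eq_top_iff_one _).2 (hpq ▸ add_mem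
        (v.asIdeal.mul_mem_left _ h1) (v.asIdeal.mul_mem_left _ h2)))
    have := hcount v hv
    tauto
  have hcop : ∀ y : 𝓞 F, (∀ v : HeightOneSpectrum (𝓞 F), (6 : 𝓞 F) ∈ v.asIdeal → y ∉ v.asIdeal) →
      IsCoprime y 6 := by
    intro y hy
    rw [← isCoprime_iff_sup]
    by_contra hne
    obtain ⟨M, hM, hle⟩ := Ideal.exists_le_maximal _ hne
    have h6 : (6 : 𝓞 F) ∈ M := hle (Ideal.mem_sup_right (Ideal.mem_span_singleton_self _))
    refine hy ⟨M, hM.isPrime, ?_⟩ h6 (hle (Ideal.mem_sup_left (Ideal.mem_span_singleton_self _)))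
    rintro rfl
    rw [Ideal.mem_bot] at h6
    norm_num at h6
  refine ⟨a, b, Units.mk0 x hx0, hcop a fun v hv => (hnot v hv).1, hcop b fun v hv => (hnot v hv).2,
    hxab.symm, ?_⟩
  rw [eq_comm, toPrincipalIdeal_eq_iff]
  exact hx.symm

/-- A generator is moved into the ray by a unit and a subproduct of the primes `ZB.g j`. Its symbols
and those of the result are trivial, so those of the subproduct are too; hence the subproduct is
empty, and a unit suffices. -/
lemma exists_ray_of_artin_eq_one {I : (FractionalIdeal (𝓞 F)⁰ F)ˣ}
    (hI : I ∈ RayClass.idealsPrimeTo (Ideal.span {(6 : 𝓞 F)})) (h1 : artin I = 1) :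
    ∃ α : Fˣ, RayClass.IsOneMod (Ideal.span {(6 : 𝓞 F)}) α ∧ RayClass.IsTotallyPositive α ∧
      I = toPrincipalIdeal (𝓞 F) F α := by
  obtain ⟨a, b, α, ha, hb, hα, rfl⟩ := exists_eq_div_of_mem hI
  rw [artin_eq_iff, map_one] at h1
  have hb0 : b ≠ 0 := by
    rw [Ne, ← Ideal.span_singleton_eq_bot]; exact span_ne_bot_of_isCoprime hb
  have hb' : (b : F) ≠ 0 := by exact_mod_cast hb0
  have hγ : IsCoprime (a * b ^ 5) 6 := ha.mul_left hb.pow_left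
  set β : Fˣ := Units.mk0 (b : F) hb' with hβ
  have heq : ((α * β ^ 6 : Fˣ) : F) = (a * b ^ 5 : 𝓞 F) := by
    push_cast
    rw [hα, hβ, Units.val_mk0]
    field_simp
  obtain ⟨u, hu, f, h6, hp⟩ := ZB.exists_isUnit_mul_prod (isCoprime_ringEquiv hγ)
  have hf : f = 0 := by
    refine ZB.eq_zero_of_prod_legMatrix f fun i => Units.ext ?_
    have hγ0 := span_ne_bot_of_isCoprime hγ
    have hγ0' : ringEquiv (a * b ^ 5) ≠ 0 := ZB.ne_zero_of_isCoprime_six (isCoprime_ringEquiv hγ)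
    have h2 := artin_principal hγ0 hγ i
    rw [FractionalIdeal.unitOfNeBot_span F hγ0 heq, map_mul, map_mul, h1,
      show β ^ 6 = (β ^ 3) ^ 2 by rw [← pow_mul], map_pow, liftHom_pow_two, mul_one] at h2
    have hprod : ∏ j, ZB.g j ^ (f j : ℕ) ≠ 0 :=
      Finset.prod_ne_zero_iff.2 fun j _ => pow_ne_zero _ (ZB.g_ne_zero j)
    have hu0 := mul_ne_zero hu.ne_zero hγ0'
    have h4 := ZB.jac_d_eq_one h6 hp (mul_ne_zero hu0 hprod) i
    rw [ZB.jac_mul_span hu0 hprod, Ideal.span_singleton_mul_left_unit hu, ← h2,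
      ZB.jac_span_prod_pow _ ZB.g_ne_zero] at h4
    have hj : ∀ j, jac (Ideal.span {ZB.g j}) (ZB.d i) = ZB.legMatrix j i := fun j => by
      have := span_g_isPrime j
      rw [jac_of_isPrime (ZB.span_ne_bot (ZB.g_ne_zero j)), ZB.leg_g_d]
    simp only [hj] at h4
    push_cast
    simpa using h4
  rw [hf] at h6 hp
  simp only [Pi.zero_apply, Fin.val_zero, pow_zero, Finset.prod_const_one, mul_one] at h6 hp
  obtain ⟨w, rfl⟩ := ringEquiv.surjective u
  have hw : IsUnit w := (MulEquiv.isUnit_map ringEquiv).1 hu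
  rw [← map_mul] at h6 hp
  have hw' : IsUnit (w : F) := hw.map (algebraMap (𝓞 F) F)
  -- This way of writing the fraction is chosen because numerator and denominator are both 1 modulo
  -- 6.
  have hα' : ((hw'.unit * α : Fˣ) : F) = ((w * (a * b ^ 5) : 𝓞 F) : F) / ((b ^ 6 : 𝓞 F) : F) := by
    push_cast
    rw [hα, IsUnit.unit_spec]
    field_simp
  have heq' : ((hw'.unit * (α * β ^ 6) : Fˣ) : F) = (w * (a * b ^ 5) : 𝓞 F) := by
    rw [Units.val_mul, heq, IsUnit.unit_spec]
    rfl
  refine ⟨hw'.unit * α, ⟨_, b ^ 6, pow_ne_zero _ hb0, ?_, ?_, ?_, hα'⟩, fun φ => ?_, ?_⟩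
  · rw [isCoprime_iff_sup]
    exact (isCoprime_mul_unit_left_left hw _ _).2 hγ
  · rw [isCoprime_iff_sup]
    exact hb.pow_left
  · rw [Ideal.mem_span_singleton]
    have h7 := dvd_sub h6 (ZB.six_dvd_pow_six_sub_one (isCoprime_ringEquiv hb))
    rw [sub_sub_sub_cancel_right, ← map_pow, ← map_sub] at h7
    have h8 := map_dvd ringEquiv.symm h7
    rwa [map_ofNat, RingEquiv.symm_apply_apply] at h8
  · have h7 := (isTotPos_iff heq').1 hp φ
    rw [← mul_assoc, Units.val_mul, map_mul, Units.val_pow_eq_pow_val, map_pow] at h7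
    have h8 : φ β ≠ 0 := (map_ne_zero φ).2 β.ne_zero
    exact pos_of_mul_pos_left h7 (by positivity)
  · rw [map_mul, eq_comm]
    convert one_mul _
    rw [toPrincipalIdeal_eq_iff, IsUnit.unit_spec]
    have := FractionalIdeal.coeIdeal_span_singleton (S := (𝓞 F)⁰) (P := F) w
    rw [Ideal.span_singleton_eq_top.2 hw, FractionalIdeal.coeIdeal_top] at this
    exact this.symm

end Example256

set_option linter.unusedSectionVars false

/-! ### Elements and multiples of the different -/

section Different

variable {K L : Type*} [Field K] [NumberField K] [Field L] [NumberField L] [Algebra K L]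

lemma mem_differentIdeal_iff_forall_dual {z : 𝓞 L} :
    z ∈ differentIdeal (𝓞 K) (𝓞 L) ↔ ∀ y ∈ FractionalIdeal.dual (𝓞 K) K (1 : FractionalIdeal (𝓞 L)⁰ L),
      IsIntegral ℤ ((z : L) * y) := by
  have hz : z ∈ differentIdeal (𝓞 K) (𝓞 L) ↔
      (z : L) ∈ (differentIdeal (𝓞 K) (𝓞 L) : FractionalIdeal (𝓞 L)⁰ L) := by
    rw [FractionalIdeal.mem_coeIdeal]
    refine ⟨fun h => ⟨z, h, rfl⟩, ?_⟩
    rintro ⟨x, hx, h⟩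
    rwa [← RingOfIntegers.ext h]
  rw [hz, coeIdeal_differentIdeal (𝓞 K) K, FractionalIdeal.mem_inv_iff (by simp)]
  refine forall₂_congr fun y _ => ?_
  rw [FractionalIdeal.mem_one_iff]
  refine ⟨?_, fun h => ⟨⟨_, h⟩, rfl⟩⟩
  rintro ⟨x, hx⟩
  exact hx ▸ x.isIntegral_coe

lemma mem_dual_one_iff {y : L} :
    y ∈ FractionalIdeal.dual (𝓞 K) K (1 : FractionalIdeal (𝓞 L)⁰ L) ↔
      ∀ x : 𝓞 L, ∃ t : 𝓞 K, (t : K) = Algebra.trace K L (y * x) := by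
  rw [FractionalIdeal.mem_dual (one_ne_zero (α := FractionalIdeal (𝓞 L)⁰ L))]
  refine ⟨fun h x => ?_, fun h a ha => ?_⟩
  · obtain ⟨t, ht⟩ := h x (FractionalIdeal.mem_one_iff _ |>.2 ⟨x, rfl⟩)
    exact ⟨t, ht⟩
  · obtain ⟨x, rfl⟩ := (FractionalIdeal.mem_one_iff _).1 ha
    obtain ⟨t, ht⟩ := h x
    exact ⟨t, ht⟩

/-- If for every `σ ≠ 1` one of the sums `a i + σ (b i)` vanishes, then the product of all
`a i + b i` lies in the different. -/
theorem prod_mem_differentIdeal [IsGalois K L] {ι : Type*} (s : Finset ι) (a b : ι → 𝓞 L)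
    (h : ∀ σ : Gal(L/K), σ ≠ 1 → ∃ i ∈ s, a i + σ • b i = 0) :
    ∏ i ∈ s, (a i + b i) ∈ differentIdeal (𝓞 K) (𝓞 L) := by
  classical
  -- Splitting off one factor writes the sum for y as `a i` times the shorter sum for y plus the
  -- shorter sum for `b i * y`, which is again in the dual; the empty product gives the trace.
  have key : ∀ y ∈ FractionalIdeal.dual (𝓞 K) K (1 : FractionalIdeal (𝓞 L)⁰ L),
      IsIntegral ℤ (∑ σ : Gal(L/K), (∏ i ∈ s, ((a i : L) + σ (b i))) * σ y) := by
    clear h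
    induction s using Finset.induction_on with
    | empty =>
      intro y hy
      obtain ⟨t, ht⟩ := mem_dual_one_iff.1 hy 1
      have := trace_eq_sum_automorphisms (K := K) y
      simp only [Finset.prod_empty, one_mul]
      rw [← this, ← mul_one y, ← map_one (algebraMap (𝓞 L) L), ← ht]
      exact t.isIntegral_coe.algebraMap
    | insert i s hi ih =>
      intro y hy
      have h2 := ih (b i * y) ((Submodule.smul_mem (FractionalIdeal.dual (𝓞 K) K
        (1 : FractionalIdeal (𝓞 L)⁰ L) : Submodule (𝓞 L) L) (b i) hy))
      refine (congrArg (IsIntegral ℤ) ?_).mp (((a i).isIntegral_coe.mul (ih y hy)).add h2)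
      rw [Finset.mul_sum, ← Finset.sum_add_distrib]
      refine Finset.sum_congr rfl fun σ _ => ?_
      rw [Finset.prod_insert hi, map_mul]
      ring
  rw [mem_differentIdeal_iff_forall_dual (K := K)]
  intro y hy
  convert key y hy
  -- By hypothesis every term with σ ≠ 1 contains a zero factor.
  rw [Finset.sum_eq_single 1]
  · simp
  · intro σ _ hσ
    obtain ⟨i, hi, h0⟩ := h σ hσ
    have h0' : (a i : L) + σ (b i) = 0 := congrArg (algebraMap (𝓞 L) L) h0
    rw [Finset.prod_eq_zero hi h0', zero_mul]
  · simp

/-- The trace condition puts θ/c in the dual of the ring of integers, and δ multiplies the dual into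
the integers. -/
lemma dvd_mul_of_mem_differentIdeal {θ δ : 𝓞 L} {c : 𝓞 K} (hc : c ≠ 0)
    (h : ∀ y : 𝓞 L, ∃ t : 𝓞 K, Algebra.trace K L ((y * θ : 𝓞 L) : L) = (c * t : 𝓞 K))
    (hδ : δ ∈ differentIdeal (𝓞 K) (𝓞 L)) : algebraMap (𝓞 K) (𝓞 L) c ∣ δ * θ := by
  have hc' : (c : K) ≠ 0 := by simpa using hc
  have hcL : algebraMap K L c ≠ 0 := by simpa using hc
  have hm : (algebraMap K L c)⁻¹ * θ ∈
      FractionalIdeal.dual (𝓞 K) K (1 : FractionalIdeal (𝓞 L)⁰ L) := by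
    rw [mem_dual_one_iff]
    intro x
    obtain ⟨t, ht⟩ := h x
    refine ⟨t, ?_⟩
    rw [← map_inv₀, mul_assoc, ← Algebra.smul_def, map_smul, mul_comm (θ : L)]
    change Algebra.trace K L ((x : L) * θ) = (c : K) * t at ht
    rw [ht, smul_eq_mul, inv_mul_cancel_left₀ hc']
  refine ⟨⟨_, mem_differentIdeal_iff_forall_dual.1 hδ _ hm⟩, RingOfIntegers.ext ?_⟩
  change (δ : L) * θ = algebraMap K L c * (δ * ((algebraMap K L c)⁻¹ * θ))
  field_simp

lemma algebraMap_ringOfIntegers_dvd_iff {a b : 𝓞 K} :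
    algebraMap (𝓞 K) (𝓞 L) a ∣ algebraMap (𝓞 K) (𝓞 L) b ↔ a ∣ b := by
  refine ⟨?_, map_dvd _⟩
  rintro ⟨x, hx⟩
  rcases eq_or_ne a 0 with rfl | ha
  · rw [map_zero, zero_mul] at hx
    have : b = 0 := FaithfulSMul.algebraMap_injective (𝓞 K) (𝓞 L) (by rw [hx, map_zero])
    rw [this]
  have ha' : (a : K) ≠ 0 := by simpa using ha
  have hx' : algebraMap K L b = algebraMap K L a * x := by
    have := congrArg (algebraMap (𝓞 L) L) hx
    rw [map_mul] at this
    exact this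
  have h2 : algebraMap K L (b / a) = x := by
    rw [map_div₀, hx', mul_div_cancel_left₀]
    simpa using ha
  have hi : IsIntegral ℤ ((b : K) / a) := by
    rw [← isIntegral_algebraMap_iff (algebraMap K L).injective, h2]
    exact x.isIntegral_coe
  refine ⟨⟨_, hi⟩, RingOfIntegers.ext ?_⟩
  change (b : K) = a * (b / a)
  field_simp

end Different

/-! ### Integers of N' and the Galois action on them -/

namespace Example256

/-- The embedding of `ZB` into the integers of `N'`. -/
def toO : ZB →+* 𝓞 N' := (algebraMap (𝓞 F) (𝓞 N')).comp (ringEquiv.symm : ZB →+* 𝓞 F)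

lemma toO_apply (x : ZB) : toO x = algebraMap (𝓞 F) (𝓞 N') (ringEquiv.symm x) := rfl

lemma toO_injective : Function.Injective toO :=
  (FaithfulSMul.algebraMap_injective (𝓞 F) (𝓞 N')).comp ringEquiv.symm.injective

/-- `(1 + √13) / 2` as an integer of `N'`. -/
def wO : 𝓞 N' := toO (ZB.mk 0 1 0 0)

/-- `√7` as an integer of `N'`. -/
def sO : 𝓞 N' := toO (ZB.mk 0 0 1 0)

lemma wO_sq : wO ^ 2 = wO + 3 := by
  rw [wO, ← map_pow, show (ZB.mk 0 1 0 0) ^ 2 = ZB.mk 0 1 0 0 + 3 by decide, map_add, map_ofNat]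

lemma sO_sq : sO ^ 2 = 7 := by
  rw [sO, ← map_pow, show (ZB.mk 0 0 1 0) ^ 2 = 7 by decide, map_ofNat]

lemma ZB.mk_eq (a b c d : ℤ) : ZB.mk a b c d =
    (a : ZB) + b * ZB.mk 0 1 0 0 + (c + d * ZB.mk 0 1 0 0) * ZB.mk 0 0 1 0 := by
  ext <;> simp [ZB.mk]

lemma toO_mk (a b c d : ℤ) : toO (ZB.mk a b c d) = a + b * wO + (c + d * wO) * sO := by
  rw [ZB.mk_eq, map_add, map_add, map_mul, map_mul, map_add, map_mul]
  simp only [map_intCast]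
  rfl

lemma sqrtO_sq' (i : Fin 6) : sqrtO i ^ 2 = toO (ZB.d i) := sqrtO_sq i

lemma sqrtO_zero_sq : sqrtO 0 ^ 2 = -1 := by
  rw [sqrtO_sq', show ZB.d 0 = -1 from rfl, map_neg, map_one]

lemma sqrtO_one_sq : sqrtO 1 ^ 2 = 1 + wO := by
  rw [sqrtO_sq', show ZB.d 1 = ZB.mk 1 1 0 0 from rfl, toO_mk]
  push_cast; ring

lemma sqrtO_two_sq : sqrtO 2 ^ 2 = 3 + wO + 2 * sO := by
  rw [sqrtO_sq', show ZB.d 2 = ZB.mk 3 1 2 0 from rfl, toO_mk]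
  push_cast; ring

lemma sqrtO_three_sq : sqrtO 3 ^ 2 = 3 + wO - 2 * sO := by
  rw [sqrtO_sq', show ZB.d 3 = ZB.mk 3 1 (-2) 0 by decide, toO_mk]
  push_cast; ring

lemma sqrtO_four_sq : sqrtO 4 ^ 2 = 4 - wO + 2 * sO := by
  rw [sqrtO_sq', show ZB.d 4 = ZB.mk 4 (-1) 2 0 by decide, toO_mk]
  push_cast; ring

lemma sqrtO_five_sq : sqrtO 5 ^ 2 = 4 - wO - 2 * sO := by
  rw [sqrtO_sq', show ZB.d 5 = ZB.mk 4 (-1) (-2) 0 by decide, toO_mk]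
  push_cast; ring

section Action

variable (σ : Gal(N'/F))

lemma smul_toO (x : ZB) : σ • toO x = toO x :=
  RingOfIntegers.ext (σ.commutes ((ringEquiv.symm x : 𝓞 F) : F))

lemma smul_wO : σ • wO = wO := smul_toO σ _

lemma smul_sO : σ • sO = sO := smul_toO σ _

lemma smul_sqrtO (i : Fin 6) : σ • sqrtO i = sqrtO i ∨ σ • sqrtO i = -sqrtO i := by
  rcases Multiquadratic.apply_eq_or sqrtN_sq σ i with h | h
  · exact Or.inl (RingOfIntegers.ext h)
  · exact Or.inr (RingOfIntegers.ext h)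

lemma smul_eq_self_iff (i : Fin 6) : σ • sqrtO i = sqrtO i ↔ signN σ i = 1 := by
  have h : σ • sqrtO i = sqrtO i ↔ σ (sqrtN i) = sqrtN i :=
    ⟨fun h => congrArg (algebraMap (𝓞 N') N') h, fun h => RingOfIntegers.ext h⟩
  change _ ↔ Multiquadratic.sign sqrtN σ i = 1
  rw [h, Multiquadratic.sign]
  split_ifs with h1 <;> simp [h1]

lemma eq_one_of_forall_smul {σ : Gal(N'/F)} (h : ∀ i, σ • sqrtO i = sqrtO i) : σ = 1 :=
  signN_injective (by rw [map_one]; exact funext fun i => (smul_eq_self_iff σ i).1 (h i))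

end Action

/-- A root of a quadratic polynomial divisible by `c` in the appropriate sense is divisible
by `c`. -/
lemma exists_mul_eq_of_sq_add {L : Type*} [Field L] [NumberField L] {c a p q : 𝓞 L} (hc : c ≠ 0)
    (h : a ^ 2 + c * p * a + c ^ 2 * q = 0) : ∃ x, c * x = a ∧ x ^ 2 + p * x + q = 0 := by
  have hc' : (c : L) ≠ 0 := by simpa using hc
  have h' : ((a / c : L)) ^ 2 + p * (a / c) + q = 0 := by
    have := congrArg (algebraMap (𝓞 L) L) h
    simp only [map_add, map_mul, map_pow, map_zero] at this
    field_simp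
    linear_combination this
  have hi : IsIntegral (𝓞 L) (a / c : L) :=
    ⟨Polynomial.X ^ 2 + Polynomial.C p * Polynomial.X + Polynomial.C q, by monicity!, by
      simpa using h'⟩
  have hi' : IsIntegral ℤ (a / c : L) := isIntegral_trans (R := ℤ) (A := 𝓞 L) _ hi
  refine ⟨⟨_, hi'⟩, RingOfIntegers.ext ?_, RingOfIntegers.ext ?_⟩
  · change (c : L) * (a / c) = a
    field_simp
  · exact h'

end Example256

namespace Example256

/-! ### Integers of `N'` that generate it at `2` -/

lemma toO_ne_zero {x : ZB} (hx : x ≠ 0) : toO x ≠ 0 := by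
  rwa [Ne, map_eq_zero_iff _ toO_injective]

lemma three_add_sO_ne_zero : 3 + sO ≠ 0 := by
  have := toO_ne_zero (x := ZB.mk 3 0 1 0) (by decide)
  rw [toO_mk] at this
  simpa using this

lemma three_sub_sO_ne_zero : 3 - sO ≠ 0 := by
  have := toO_ne_zero (x := ZB.mk 3 0 (-1) 0) (by decide)
  rw [toO_mk] at this
  simpa [sub_eq_add_neg] using this

/-- ω + 3 + √7 is a square root of n₁ modulo (3 + √7)³. The resulting equation for x has lower
coefficients divisible by 3 - √7, as in Eisenstein's criterion at the prime above 2. -/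
lemma exists_sqrtO_two_sub : ∃ x, (3 + sO) * x = sqrtO 2 - (wO + 3 + sO) ∧
    x ^ 2 + (3 - sO) * (wO + 3 + sO) * x + (3 - sO) * (wO + 5 - sO) = 0 :=
  exists_mul_eq_of_sq_add three_add_sO_ne_zero (by
    grind [sqrtO_two_sq, wO_sq, sO_sq])

lemma exists_neg_sqrtO_two_sub : ∃ x, (3 + sO) * x = -sqrtO 2 - (wO + 3 + sO) ∧
    x ^ 2 + (3 - sO) * (wO + 3 + sO) * x + (3 - sO) * (wO + 5 - sO) = 0 :=
  exists_mul_eq_of_sq_add three_add_sO_ne_zero (by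
    grind [sqrtO_two_sq, wO_sq, sO_sq])

lemma exists_sqrtO_four_sub : ∃ x, (3 + sO) * x = sqrtO 4 - (4 - wO + sO) ∧
    x ^ 2 + (3 - sO) * (4 - wO + sO) * x + (3 - sO) * (6 - wO - sO) = 0 :=
  exists_mul_eq_of_sq_add three_add_sO_ne_zero (by
    grind [sqrtO_four_sq, wO_sq, sO_sq])

lemma exists_neg_sqrtO_four_sub : ∃ x, (3 + sO) * x = -sqrtO 4 - (4 - wO + sO) ∧
    x ^ 2 + (3 - sO) * (4 - wO + sO) * x + (3 - sO) * (6 - wO - sO) = 0 :=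
  exists_mul_eq_of_sq_add three_add_sO_ne_zero (by
    grind [sqrtO_four_sq, wO_sq, sO_sq])

/-- The product d_2 d_3 = ω⁴ - 28 is a square modulo 4, so its square root contributes no
ramification at 2; the next three lemmas are similar. -/
lemma exists_sqrtO_two_mul : ∃ u, 2 * u = sqrtO 2 * sqrtO 3 + wO ^ 2 := by
  obtain ⟨u, hu, -⟩ := exists_mul_eq_of_sq_add (a := sqrtO 2 * sqrtO 3 + wO ^ 2) (p := -wO ^ 2)
    (q := 7) two_ne_zero (by grind [sqrtO_two_sq, sqrtO_three_sq, wO_sq, sO_sq])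
  exact ⟨u, hu⟩

lemma exists_sqrtO_four_mul : ∃ u, 2 * u = sqrtO 4 * sqrtO 5 + (1 - wO) ^ 2 := by
  obtain ⟨u, hu, -⟩ := exists_mul_eq_of_sq_add (a := sqrtO 4 * sqrtO 5 + (1 - wO) ^ 2)
    (p := -(1 - wO) ^ 2) (q := 7) two_ne_zero
    (by grind [sqrtO_four_sq, sqrtO_five_sq, wO_sq, sO_sq])
  exact ⟨u, hu⟩

lemma exists_sqrtO_one_mul :
    ∃ u, 2 * u = sqrtO 1 * sqrtO 2 * sqrtO 4 - (1 + sO + wO * sO) := by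
  obtain ⟨u, hu, -⟩ := exists_mul_eq_of_sq_add
    (a := sqrtO 1 * sqrtO 2 * sqrtO 4 - (1 + sO + wO * sO))
    (p := 1 + sO + wO * sO) (q := -2 - 4 * wO - 3 * sO - 3 * wO * sO) two_ne_zero
    (by grind [sqrtO_one_sq, sqrtO_two_sq, sqrtO_four_sq, wO_sq, sO_sq])
  exact ⟨u, hu⟩

lemma exists_sqrtO_zero_mul : ∃ u, 2 * u = 1 + sqrtO 0 * sO := by
  obtain ⟨u, hu, -⟩ := exists_mul_eq_of_sq_add (a := 1 + sqrtO 0 * sO) (p := -1) (q := 2)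
    two_ne_zero (by grind [sqrtO_zero_sq, sO_sq])
  exact ⟨u, hu⟩

/-- A product of six differences of conjugate integers, one for each step of a tower of quadratic
extensions from `F` to `N'`, that lies in the different. -/
theorem exists_mem_differentIdeal : ∃ x : 𝓞 N',
    x ^ 2 + (3 - sO) * (wO + 3 + sO) * x + (3 - sO) * (wO + 5 - sO) = 0 ∧
    (3 - sO) * sqrtO 2 * (sqrtO 4 * x) * (sqrtO 2 * sqrtO 3) * (sqrtO 4 * sqrtO 5) *
      (sqrtO 1 * sqrtO 2 * sqrtO 4) * (sqrtO 0 * sO) ∈ differentIdeal (𝓞 F) (𝓞 N') := by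
  obtain ⟨x, hx, hx2⟩ := exists_sqrtO_two_sub
  obtain ⟨x', hx', hx2'⟩ := exists_neg_sqrtO_two_sub
  obtain ⟨y, hy, hy2⟩ := exists_sqrtO_four_sub
  obtain ⟨y', hy', hy2'⟩ := exists_neg_sqrtO_four_sub
  have h2 : (2 : 𝓞 N') ≠ 0 := two_ne_zero
  have hs := three_sub_sO_ne_zero
  have hs' := three_add_sO_ne_zero
  -- The squares of y and x' are both divisible by 3 - √7, so yx'/(3 - √7) is integral. Over the
  -- field containing x' it has a difference smaller at 2 than that of y, as needed for the exact
  -- power of 2.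
  obtain ⟨z, hz, -⟩ := exists_mul_eq_of_sq_add (c := 3 - sO) (a := y * x') (p := 0)
    (q := -(((4 - wO + sO) * y + (6 - wO - sO)) * ((wO + 3 + sO) * x' + (wO + 5 - sO)))) hs (by
      linear_combination x' ^ 2 * hy2 - (3 - sO) * ((4 - wO + sO) * y + (6 - wO - sO)) * hx2')
  obtain ⟨z', hz', -⟩ := exists_mul_eq_of_sq_add (c := 3 - sO) (a := y' * x') (p := 0)
    (q := -(((4 - wO + sO) * y' + (6 - wO - sO)) * ((wO + 3 + sO) * x' + (wO + 5 - sO)))) hs (by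
      linear_combination x' ^ 2 * hy2' - (3 - sO) * ((4 - wO + sO) * y' + (6 - wO - sO)) * hx2')
  obtain ⟨u, hu⟩ := exists_sqrtO_two_mul
  obtain ⟨v, hv⟩ := exists_sqrtO_four_mul
  obtain ⟨t, ht⟩ := exists_sqrtO_one_mul
  obtain ⟨c, hc⟩ := exists_sqrtO_zero_mul
  -- For σ ≠ 1, the first √d_i that σ moves in the order 2, 4, 3, 5, 1, 0 selects the vanishing
  -- factor; the roots before it are fixed, so each factor may use them.
  have key := prod_mem_differentIdeal (K := F) Finset.univ
    ![x', z', wO ^ 2 - u, (1 - wO) ^ 2 - v, -(1 + sO + wO * sO) - t, 1 - c]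
    ![-x, -z, -u, -v, -t, -c] (fun σ hσ => by
      have h (i : Fin 6) := smul_sqrtO σ i
      have hw := smul_wO σ
      have hs := smul_sO σ
      have h1 := mt (eq_one_of_forall_smul (σ := σ)) hσ
      obtain ⟨g, hg⟩ : ∃ g : 𝓞 N' →+* 𝓞 N', ∀ x, σ • x = g x :=
        ⟨MulSemiringAction.toRingHom _ _ σ, fun _ => rfl⟩
      simp only [hg] at h hw hs h1 ⊢
      rcases (h 2).symm with e2 | e2
      · refine ⟨0, Finset.mem_univ _, mul_left_cancel₀ hs' ?_⟩
        have := congrArg g hx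
        simp only [map_mul, map_add, map_sub, map_ofNat, hw, hs, e2] at this
        simp only [Matrix.cons_val, map_neg]
        linear_combination hx' - this
      have ex' : g x' = x' := by
        have := congrArg g hx'
        simp only [map_mul, map_add, map_sub, map_ofNat, map_neg, hw, hs, e2] at this
        exact mul_left_cancel₀ hs' (this.trans hx'.symm)
      rcases (h 4).symm with e4 | e4
      · have ey : g y = y' := by
          have := congrArg g hy
          simp only [map_mul, map_add, map_sub, map_ofNat, hw, hs, e4] at this
          exact mul_left_cancel₀ hs' (this.trans hy'.symm)
        refine ⟨1, Finset.mem_univ _, mul_left_cancel₀ three_sub_sO_ne_zero ?_⟩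
        have := congrArg g hz
        simp only [map_mul, map_sub, map_ofNat, hs, ex', ey] at this
        simp only [Matrix.cons_val, map_neg]
        linear_combination hz' - this
      rcases (h 3).symm with e3 | e3
      · refine ⟨2, Finset.mem_univ _, mul_left_cancel₀ h2 ?_⟩
        have := congrArg g hu
        simp only [map_mul, map_add, map_pow, map_ofNat, hw, e2, e3] at this
        simp only [Matrix.cons_val, map_neg]
        linear_combination - hu - this
      rcases (h 5).symm with e5 | e5
      · refine ⟨3, Finset.mem_univ _, mul_left_cancel₀ h2 ?_⟩
        have := congrArg g hv
        simp only [map_mul, map_add, map_sub, map_one, map_pow, map_ofNat, hw, e4, e5] at this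
        simp only [Matrix.cons_val, map_neg]
        linear_combination - hv - this
      rcases (h 1).symm with e1 | e1
      · refine ⟨4, Finset.mem_univ _, mul_left_cancel₀ h2 ?_⟩
        have := congrArg g ht
        simp only [map_mul, map_add, map_sub, map_one, map_ofNat, hw, hs, e1, e2, e4] at this
        simp only [Matrix.cons_val, map_neg]
        linear_combination - ht - this
      rcases (h 0).symm with e0 | e0
      · refine ⟨5, Finset.mem_univ _, mul_left_cancel₀ h2 ?_⟩
        have := congrArg g hc
        simp only [map_mul, map_add, map_one, map_ofNat, hs, e0] at this
        simp only [Matrix.cons_val, map_neg]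
        linear_combination - hc - this
      refine absurd (fun i => ?_) h1
      fin_cases i
      exacts [e0, e1, e2, e3, e4, e5])
  refine ⟨x', hx2', ?_⟩
  convert key using 1
  have d1 : x' - x = -((3 - sO) * sqrtO 2) := mul_left_cancel₀ h2 (by
    linear_combination (3 - sO) * (hx' - hx) + (x' - x) * sO_sq)
  have d2 : y' - y = -((3 - sO) * sqrtO 4) := mul_left_cancel₀ h2 (by
    linear_combination (3 - sO) * (hy' - hy) + (y' - y) * sO_sq)
  have d3 : z' - z = -(sqrtO 4 * x') := mul_left_cancel₀ hs (by
    linear_combination hz' - hz + x' * d2)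
  have d4 : wO ^ 2 - u - u = -(sqrtO 2 * sqrtO 3) := by linear_combination - hu
  have d5 : (1 - wO) ^ 2 - v - v = -(sqrtO 4 * sqrtO 5) := by linear_combination - hv
  have d6 : -(1 + sO + wO * sO) - t - t = -(sqrtO 1 * sqrtO 2 * sqrtO 4) := by
    linear_combination - ht
  have d7 : 1 - c - c = -(sqrtO 0 * sO) := by linear_combination - hc
  simp only [Fin.prod_univ_six, Matrix.cons_val, ← sub_eq_add_neg]
  rw [d1, d3, d4, d5, d6, d7]
  ring

end Example256

/-! ### An upper bound for the different, and unramifiedness outside 6 -/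

namespace Example256

lemma isCoprime_toO_two {x : ZB} (h : IsCoprime x.norm.norm 2) : IsCoprime (toO x) 2 := by
  have := (ZB.isCoprime_intCast_of_norm h).map toO
  rwa [map_intCast] at this

lemma isCoprime_sqrtO_sq_two (i : Fin 6) : IsCoprime (sqrtO i ^ 2) 2 := by
  rw [sqrtO_sq']
  refine isCoprime_toO_two ?_
  rw [Int.isCoprime_iff_gcd_eq_one]
  revert i
  decide

lemma isCoprime_two_of_sq_eq {x : 𝓞 N'}
    (hx : x ^ 2 + (3 - sO) * (wO + 3 + sO) * x + (3 - sO) * (wO + 5 - sO) = 0) :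
    IsCoprime ((wO + 3 + sO) * x + (wO + 5 - sO)) 2 := by
  have h1 : IsCoprime ((wO + 5 - sO) ^ 2) 2 := by
    have h2 : IsCoprime (toO (ZB.mk 5 1 (-1) 0)) 2 := isCoprime_toO_two (by
      rw [Int.isCoprime_iff_gcd_eq_one]
      decide)
    rw [toO_mk] at h2
    refine IsCoprime.pow_left ?_
    convert h2 using 1
    push_cast; ring
  refine h1.of_isCoprime_of_dvd_left ?_
  refine ⟨-(wO + 3 + sO) ^ 2 * (3 - sO) + 2 * (wO + 5 - sO) -
    ((wO + 3 + sO) * x + (wO + 5 - sO)), ?_⟩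
  linear_combination (wO + 3 + sO) ^ 2 * hx

/-- A cruder element of the different, with the right valuation at the odd primes. -/
lemma prod_two_mul_sqrtO_mem :
    ∏ i, (sqrtO i + sqrtO i) ∈ differentIdeal (𝓞 F) (𝓞 N') :=
  prod_mem_differentIdeal (K := F) Finset.univ sqrtO sqrtO fun σ hσ => by
    by_contra! h
    refine hσ (eq_one_of_forall_smul fun i => (smul_sqrtO σ i).resolve_right fun h1 => ?_)
    exact h i (Finset.mem_univ _) (by rw [h1, add_neg_cancel])

lemma prod_d_sq : (ZB.d 2 * ZB.d 3 * ZB.d 4 * ZB.d 5) ^ 2 = 9 := by decide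

/-- The fourth powers of the two known elements of the different are 8 times something prime to 2,
and 2²⁴ · 9 times a unit; a combination of them is 8 · 9. -/
theorem seventy_two_mem : (72 : 𝓞 N') ∈ differentIdeal (𝓞 F) (𝓞 N') ^ 4 := by
  obtain ⟨x, hx, hxD⟩ := exists_mem_differentIdeal
  have h1 := Ideal.pow_mem_pow hxD 4
  have h2 := Ideal.pow_mem_pow prod_two_mul_sqrtO_mem 4
  have e2 : (∏ i, (sqrtO i + sqrtO i)) ^ 4 = 2 ^ 24 * 9 * (1 + wO) ^ 2 := by
    have := congrArg toO prod_d_sq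
    simp only [map_pow, map_mul, map_ofNat, ← sqrtO_sq'] at this
    calc _ = 2 ^ 24 * (sqrtO 2 ^ 2 * sqrtO 3 ^ 2 * sqrtO 4 ^ 2 * sqrtO 5 ^ 2) ^ 2 *
          ((sqrtO 0 ^ 2) ^ 2 * (sqrtO 1 ^ 2) ^ 2) := by rw [Fin.prod_univ_six]; ring
      _ = _ := by rw [this, sqrtO_zero_sq, sqrtO_one_sq]; ring
  have e1 : ((3 - sO) * sqrtO 2 * (sqrtO 4 * x) * (sqrtO 2 * sqrtO 3) * (sqrtO 4 * sqrtO 5) *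
      (sqrtO 1 * sqrtO 2 * sqrtO 4) * (sqrtO 0 * sO)) ^ 4 =
      8 * ((8 - 3 * sO) ^ 3 * ((wO + 3 + sO) * x + (wO + 5 - sO)) ^ 2 * (sqrtO 2 ^ 2) ^ 6 *
        (sqrtO 4 ^ 2) ^ 6 * (sqrtO 3 ^ 2) ^ 2 * (sqrtO 5 ^ 2) ^ 2 * (sqrtO 1 ^ 2) ^ 2 *
        (sqrtO 0 ^ 2) ^ 2 * 49) := by
    have e : (3 - sO) ^ 2 = 2 * (8 - 3 * sO) := by linear_combination sO_sq
    calc _ = ((3 - sO) ^ 2) ^ 2 * (x ^ 2) ^ 2 * (sqrtO 2 ^ 2) ^ 6 *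
        (sqrtO 4 ^ 2) ^ 6 * (sqrtO 3 ^ 2) ^ 2 * (sqrtO 5 ^ 2) ^ 2 * (sqrtO 1 ^ 2) ^ 2 *
        (sqrtO 0 ^ 2) ^ 2 * (sO ^ 2) ^ 2 := by ring
      _ = _ := by
        rw [show x ^ 2 = -(3 - sO) * ((wO + 3 + sO) * x + (wO + 5 - sO)) by
          linear_combination hx, mul_pow (-(3 - sO)), neg_sq, e, sO_sq]
        ring
  rw [e1] at h1
  rw [e2] at h2
  generalize ho : (8 - 3 * sO) ^ 3 * ((wO + 3 + sO) * x + (wO + 5 - sO)) ^ 2 * (sqrtO 2 ^ 2) ^ 6 *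
        (sqrtO 4 ^ 2) ^ 6 * (sqrtO 3 ^ 2) ^ 2 * (sqrtO 5 ^ 2) ^ 2 * (sqrtO 1 ^ 2) ^ 2 *
        (sqrtO 0 ^ 2) ^ 2 * 49 = o at h1
  have hw : (1 + wO) * (wO - 2) = 1 := by linear_combination wO_sq
  have hco : IsCoprime o (2 ^ 21) := by
    rw [← ho]
    refine IsCoprime.pow_right ?_
    have h8 : IsCoprime (8 - 3 * sO) 2 := ⟨8 + 3 * sO, 0, by linear_combination (-9) * sO_sq⟩
    have h49 : IsCoprime (49 : 𝓞 N') 2 := ⟨1, -24, by norm_num⟩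
    have h := isCoprime_sqrtO_sq_two
    exact (((((((h8.pow_left.mul_left (isCoprime_two_of_sq_eq hx).pow_left).mul_left
      (h 2).pow_left).mul_left (h 4).pow_left).mul_left (h 3).pow_left).mul_left
      (h 5).pow_left).mul_left (h 1).pow_left).mul_left (h 0).pow_left).mul_left h49
  obtain ⟨a, b, hab⟩ := hco
  have := Ideal.add_mem _ (Ideal.mul_mem_left _ (9 * a) h1)
    (Ideal.mul_mem_left _ (b * (wO - 2) ^ 2) h2)
  convert this using 1
  linear_combination (-72) * hab - 2 ^ 24 * 9 * b * ((1 + wO) * (wO - 2) + 1) * hw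

/-- `N' / F` is unramified outside `6`. -/
theorem isUnramifiedAt_of_six_notMem {P : Ideal (𝓞 N')} [P.IsPrime]
    (h6 : (6 : 𝓞 N') ∉ P) : Algebra.IsUnramifiedAt (𝓞 F) P := by
  rw [← not_dvd_differentIdeal_iff]
  intro h
  have h1 : (72 : 𝓞 N') ∈ P := Ideal.pow_le_self (n := 4) (by norm_num) |>.trans
    (Ideal.dvd_iff_le.1 h) seventy_two_mem
  refine h6 (Ideal.IsPrime.mem_of_pow_mem inferInstance 3 ?_)
  have := P.mul_mem_left 3 h1
  norm_num at this ⊢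
  exact this

end Example256

lemma exists_trace_eq_sum_smul {K L : Type*} [Field K] [NumberField K] [Field L] [NumberField L]
    [Algebra K L] [IsGalois K L] (y : 𝓞 L) : ∃ t : 𝓞 K, (t : K) = Algebra.trace K L y ∧
      algebraMap (𝓞 K) (𝓞 L) t = ∑ σ : Gal(L/K), σ • y := by
  have h : IsIntegral ℤ (Algebra.trace K L (y : L)) := Algebra.isIntegral_trace y.isIntegral_coe
  refine ⟨⟨_, h⟩, rfl, RingOfIntegers.ext ?_⟩
  have h1 : algebraMap (𝓞 L) L (∑ σ : Gal(L/K), σ • y) = ∑ σ : Gal(L/K), σ (y : L) := by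
    rw [map_sum]
    rfl
  exact (trace_eq_sum_automorphisms (K := K) (y : L)).trans h1.symm

lemma succ_dvd_or_succ_dvd_of_succ_add_dvd_mul {R : Type*} [CommMonoidWithZero R]
    [IsCancelMulZero R] {p : R} (hp : Prime p) {a b : R} {m n : ℕ} (h : p ^ (m + n + 1) ∣ a * b) :
    p ^ (m + 1) ∣ a ∨ p ^ (n + 1) ∣ b := by
  rw [pow_dvd_iff_le_emultiplicity, emultiplicity_mul hp] at h
  simp only [pow_dvd_iff_le_emultiplicity]
  generalize emultiplicity p a = x at *
  generalize emultiplicity p b = y at *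
  cases x with
  | top => simp
  | coe x =>
    cases y with
    | top => simp
    | coe y => norm_cast at *; omega

lemma Ideal.mem_pow_or_mem_pow_of_mul_mem {R : Type*} [CommRing R] [IsDedekindDomain R] {P : Ideal R}
    [P.IsPrime] (hP : P ≠ ⊥) {a b : R} {m n : ℕ} (h : a * b ∈ P ^ (m + n + 1)) :
    a ∈ P ^ (m + 1) ∨ b ∈ P ^ (n + 1) := by
  have hp : Prime P := Ideal.prime_of_isPrime hP inferInstance
  simp only [← Ideal.dvd_span_singleton] at *
  rw [← Ideal.span_singleton_mul_span_singleton] at h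
  exact succ_dvd_or_succ_dvd_of_succ_add_dvd_mul hp h

namespace Example256

/-! ### The different of `N' / F` at `3` -/

lemma toO_dvd_iff {x y : ZB} : toO x ∣ toO y ↔ x ∣ y := by
  rw [toO_apply, toO_apply, algebraMap_ringOfIntegers_dvd_iff]
  refine ⟨fun h => ?_, map_dvd _⟩
  simpa using map_dvd ringEquiv h

lemma algebraMap_eq_toO (t : 𝓞 F) : algebraMap (𝓞 F) (𝓞 N') t = toO (ringEquiv t) := by
  rw [toO_apply, RingEquiv.symm_apply_apply]

lemma exists_trace_eq_toO (y : 𝓞 N') : ∃ t : ZB,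
    Algebra.trace F N' y = (ringEquiv.symm t : 𝓞 F) ∧ toO t = ∑ σ : Gal(N'/F), σ • y := by
  obtain ⟨t, ht, h⟩ := exists_trace_eq_sum_smul (K := F) y
  refine ⟨ringEquiv t, ?_, ?_⟩
  · rw [RingEquiv.symm_apply_apply, ht]
  · rw [← h, algebraMap_eq_toO]

lemma toO_dvd_mul_of_mem_differentIdeal {θ δ : 𝓞 N'} {c : ZB} (hc : c ≠ 0)
    (h : ∀ y t, toO t = ∑ σ : Gal(N'/F), σ • (y * θ) → c ∣ t)
    (hδ : δ ∈ differentIdeal (𝓞 F) (𝓞 N')) : toO c ∣ δ * θ := by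
  refine dvd_mul_of_mem_differentIdeal (K := F) (c := ringEquiv.symm c) (by simpa using hc)
    (fun y => ?_) hδ
  obtain ⟨t, ht, h1⟩ := exists_trace_eq_toO (y * θ)
  obtain ⟨k, rfl⟩ := h y t h1
  refine ⟨ringEquiv.symm k, ?_⟩
  rw [ht, map_mul]

lemma absNorm_span_d (i : Fin 4) : Ideal.absNorm (Ideal.span {ZB.d (i.natAdd 2)}) = 3 := by
  rw [ZB.absNorm_span]
  revert i
  decide

lemma prime_d (i : Fin 4) : Prime (ZB.d (i.natAdd 2)) := by
  rw [← Ideal.span_singleton_prime (d_ne_zero _)]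
  exact Ideal.isPrime_of_irreducible_absNorm (by rw [absNorm_span_d]; exact Nat.prime_three)

/-- Every conjugate of y√d_i is divisible by √d_i, so its trace lies in F and is divisible by √d_i,
hence by the prime d_i. Thus d_i divides δ√d_i. -/
lemma sqrtO_dvd_of_mem_differentIdeal (i : Fin 4) {δ : 𝓞 N'}
    (hδ : δ ∈ differentIdeal (𝓞 F) (𝓞 N')) : sqrtO (i.natAdd 2) ∣ δ := by
  have h0 : sqrtO (i.natAdd 2) ≠ 0 := fun h => by
    have := sqrtO_sq' (i.natAdd 2)
    rw [h, zero_pow two_ne_zero] at this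
    exact toO_ne_zero (d_ne_zero _) this.symm
  refine (mul_dvd_mul_iff_right h0).1 ?_
  rw [← pow_two, sqrtO_sq']
  refine toO_dvd_mul_of_mem_differentIdeal (d_ne_zero _) (fun y t ht => ?_) hδ
  refine (prime_d i).dvd_of_dvd_pow (n := 2) ?_
  rw [← toO_dvd_iff, map_pow, ← sqrtO_sq']
  refine pow_dvd_pow_of_dvd ?_ 2
  rw [ht]
  refine Finset.dvd_sum fun σ _ => ?_
  rw [smul_mul']
  refine Dvd.dvd.mul_left ?_ _
  rcases smul_sqrtO σ (i.natAdd 2) with h | h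
  · rw [h]
  · rw [h, dvd_neg]

lemma isCoprime_d_d {i j : Fin 4} (hij : i ≠ j) :
    IsCoprime (ZB.d (i.natAdd 2)) (ZB.d (j.natAdd 2)) := by
  have h3 (i : Fin 4) : ZB.d (i.natAdd 2) ∣ 3 := by
    have h2 : IsCoprime (ZB.d (i.natAdd 2)) (2 : ℤ) := ZB.isCoprime_intCast_of_norm (by
      rw [Int.isCoprime_iff_gcd_eq_one]
      revert i
      decide)
    exact h2.dvd_of_dvd_mul_left (by convert d_dvd_six (i.natAdd 2); norm_num)
  have h : IsCoprime (ZB.d (i.natAdd 2) + ZB.d (j.natAdd 2)).norm.norm 3 ∨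
      IsCoprime (ZB.d (i.natAdd 2) - ZB.d (j.natAdd 2)).norm.norm 3 := by
    simp only [Int.isCoprime_iff_gcd_eq_one]
    revert i j
    decide
  rcases h with h | h
  · have := (ZB.isCoprime_intCast_of_norm h)
    have := this.of_isCoprime_of_dvd_right (h3 i)
    rw [isCoprime_comm]
    simpa using this.add_mul_left_left (-1)
  · have := (ZB.isCoprime_intCast_of_norm h)
    have := (this.of_isCoprime_of_dvd_right (h3 i)).neg_left
    rw [isCoprime_comm]
    simpa using this.add_mul_left_left 1

theorem differentIdeal_le_three : differentIdeal (𝓞 F) (𝓞 N') ^ 4 ≤ Ideal.span {9} := by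
  have h1 : differentIdeal (𝓞 F) (𝓞 N') ≤ Ideal.span {∏ i : Fin 4, sqrtO (i.natAdd 2)} := by
    intro δ hδ
    rw [Ideal.mem_span_singleton]
    refine Finset.prod_dvd_of_coprime (fun i _ j _ hij => ?_)
      fun i _ => sqrtO_dvd_of_mem_differentIdeal i hδ
    have := (isCoprime_d_d hij).map toO
    rw [← sqrtO_sq', ← sqrtO_sq'] at this
    exact (IsCoprime.pow_iff two_pos two_pos).1 this
  refine (Ideal.pow_right_mono h1 4).trans (le_of_eq ?_)
  rw [Ideal.span_singleton_pow]
  congr 2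
  have := congrArg toO prod_d_sq
  simp only [map_pow, map_mul, map_ofNat, ← sqrtO_sq'] at this
  rw [← this, Fin.prod_univ_four]
  change (sqrtO 2 * sqrtO 3 * sqrtO 4 * sqrtO 5) ^ 4 = _
  ring

end Example256

namespace Example256

/-! ### The prime above `2` and its ramification in `N' / F` -/

/-- The prime element `3 + √7` of `ZB`, which divides `2`. -/
def primeTwo : ZB := ZB.mk 3 0 1 0

lemma toO_primeTwo : toO primeTwo = 3 + sO := by
  rw [primeTwo, toO_mk]; push_cast; ring

lemma two_eq_mul : (2 : 𝓞 N') = (3 + sO) * (3 - sO) := by linear_combination sO_sq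

lemma three_sub_sO_dvd : 3 - sO ∣ 3 + sO := ⟨8 + 3 * sO, by linear_combination 3 * sO_sq⟩

lemma eq_two_mul_add (p q : ℤ) (h : 2 ∣ p ^ 2 + p * q - 3 * q ^ 2) : 2 ∣ p ∧ 2 ∣ q := by
  rcases Int.even_or_odd' p with ⟨a, rfl | rfl⟩ <;> rcases Int.even_or_odd' q with ⟨b, rfl | rfl⟩ <;>
    ring_nf at h <;> omega

variable {P : Ideal (𝓞 N')} [hP : P.IsPrime] (h2 : (2 : 𝓞 N') ∈ P)

include h2

lemma three_sub_sO_mem : 3 - sO ∈ P := by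
  refine hP.mem_of_pow_mem 2 ?_
  rw [show (3 - sO) ^ 2 = 2 * (8 - 3 * sO) by linear_combination sO_sq]
  exact P.mul_mem_right _ h2

lemma three_add_sO_mem : 3 + sO ∈ P := P.mem_of_dvd three_sub_sO_dvd (three_sub_sO_mem h2)

/-- Modulo 3 + √7 the element becomes p + qω with p, q rational; its norm p² + pq - 3q² lies in P
and is therefore even. This form is anisotropic modulo 2, so p and q are even. -/
lemma primeTwo_dvd_of_toO_mem {x : ZB} (hx : toO x ∈ P) : primeTwo ∣ x := by
  obtain ⟨a, b, c, d, rfl⟩ : ∃ a b c d, x = ZB.mk a b c d :=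
    ⟨x.re.re, x.re.im, x.im.re, x.im.im, rfl⟩
  have h1 : ((a - 3 * c : ℤ) : 𝓞 N') + (b - 3 * d : ℤ) * wO ∈ P := by
    have := P.sub_mem hx (P.mul_mem_left (c + d * wO) (three_add_sO_mem h2))
    rw [toO_mk] at this
    convert this using 1
    push_cast; ring
  obtain ⟨p, hp⟩ : ∃ p, p = a - 3 * c := ⟨_, rfl⟩
  obtain ⟨q, hq⟩ : ∃ q, q = b - 3 * d := ⟨_, rfl⟩
  rw [← hp, ← hq] at h1
  have h3 : ((p ^ 2 + p * q - 3 * q ^ 2 : ℤ) : 𝓞 N') ∈ P := by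
    have := P.mul_mem_left (p + q - q * wO) h1
    convert this using 1
    push_cast
    linear_combination (q ^ 2 : 𝓞 N') * wO_sq
  have h4 : 2 ∣ p ^ 2 + p * q - 3 * q ^ 2 := by
    by_contra h
    obtain ⟨k, hk⟩ : ∃ k, p ^ 2 + p * q - 3 * q ^ 2 = 2 * k + 1 :=
      Int.not_even_iff_odd.1 (mt even_iff_two_dvd.1 h)
    rw [hk] at h3
    refine hP.ne_top ((Ideal.eq_top_iff_one _).2 ?_)
    have := P.sub_mem h3 (P.mul_mem_right (k : 𝓞 N') h2)
    push_cast at this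
    rwa [add_sub_cancel_left] at this
  obtain ⟨⟨e, he⟩, f, hf⟩ := eq_two_mul_add p q h4
  refine ⟨ZB.mk c d 0 0 + ZB.mk 3 0 (-1) 0 * ZB.mk e f 0 0, toO_injective ?_⟩
  have ha : a = 3 * c + 2 * e := by omega
  have hb : b = 3 * d + 2 * f := by omega
  rw [ha, hb]
  simp only [map_mul, map_add, primeTwo, toO_mk]
  push_cast
  linear_combination (e + f * wO : 𝓞 N') * sO_sq

omit h2 hP

lemma exists_prime_two_mem : ∃ P : Ideal (𝓞 N'), P.IsPrime ∧ (2 : 𝓞 N') ∈ P := by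
  have h : Ideal.span {(2 : 𝓞 N')} ≠ ⊤ := by
    rw [Ne, Ideal.span_singleton_eq_top, isUnit_iff_dvd_one]
    intro h
    rw [← map_ofNat toO 2, ← map_one toO, toO_dvd_iff] at h
    obtain ⟨x, hx⟩ := h
    have := congrArg (fun x : ZB => x.norm.norm) hx
    simp only [map_mul, map_one, show (2 : ZB).norm.norm = 16 by decide] at this
    omega
  obtain ⟨P, hP, hle⟩ := Ideal.exists_le_maximal _ h
  exact ⟨P, hP.isPrime, hle (Ideal.mem_span_singleton_self 2)⟩

lemma primeTwo_ne_zero : primeTwo ≠ 0 := by decide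

lemma prime_primeTwo : Prime primeTwo := by
  obtain ⟨P, hP, h2⟩ := exists_prime_two_mem
  have h3 : toO primeTwo ∈ P := by rw [toO_primeTwo]; exact three_add_sO_mem h2
  refine ⟨primeTwo_ne_zero, fun h => hP.ne_top (Ideal.eq_top_of_isUnit_mem _ h3 (h.map toO)),
    fun x y h => ?_⟩
  have h4 := P.mem_of_dvd (map_dvd toO h) h3
  rw [map_mul] at h4
  exact (hP.mem_or_mem h4).imp (primeTwo_dvd_of_toO_mem h2) (primeTwo_dvd_of_toO_mem h2)

/-- The prime above `2` of `F` is at least triply ramified in `N'`. -/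
theorem three_add_sO_mem_pow_three {P : Ideal (𝓞 N')} [hP : P.IsPrime] (h2 : (2 : 𝓞 N') ∈ P) :
    3 + sO ∈ P ^ 3 := by
  have hP0 : P ≠ ⊥ := by rintro rfl; exact two_ne_zero h2
  refine (P ^ 3).mem_of_dvd three_sub_sO_dvd ?_
  -- If 3 - √7 has valuation at most 2 at P, then x² = (3 - √7) · (prime to P) makes the valuation
  -- exactly 2 and that of x equal to 1. Comparing x with the analogous y for d_4 contradicts this,
  -- by forcing x into P².
  by_contra h
  obtain ⟨x, -, hx⟩ := exists_sqrtO_two_sub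
  obtain ⟨y, -, hy⟩ := exists_sqrtO_four_sub
  have hr := three_sub_sO_mem h2
  have hxP : x ∈ P := hP.mem_of_pow_mem 2 (by
    rw [show x ^ 2 = (3 - sO) * -((wO + 3 + sO) * x + (wO + 5 - sO)) by linear_combination hx]
    exact P.mul_mem_right _ hr)
  have hyP : y ∈ P := hP.mem_of_pow_mem 2 (by
    rw [show y ^ 2 = (3 - sO) * -((4 - wO + sO) * y + (6 - wO - sO)) by linear_combination hy]
    exact P.mul_mem_right _ hr)
  have hodd {a : 𝓞 N'} (ha : IsCoprime a 2) : a ∉ P := fun h => by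
    obtain ⟨u, v, huv⟩ := ha
    exact hP.ne_top ((Ideal.eq_top_iff_one _).2
      (huv ▸ P.add_mem (P.mul_mem_left _ h) (P.mul_mem_left _ h2)))
  have hw := hodd (isCoprime_two_of_sq_eq hx)
  have hmul : (3 - sO) * ((wO + 3 + sO) * x + (wO + 5 - sO)) = -x ^ 2 := by linear_combination hx
  have hr2 : 3 - sO ∈ P ^ 2 := by
    refine (Ideal.IsPrime.mul_mem_pow P (a := (wO + 3 + sO) * x + (wO + 5 - sO)) ?_).resolve_left hw
    rw [mul_comm, hmul]
    exact neg_mem (Ideal.pow_mem_pow hxP 2)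
  have hq2 : 3 + sO ∈ P ^ 2 := (P ^ 2).mem_of_dvd three_sub_sO_dvd hr2
  obtain ⟨k, hk⟩ : ∃ k, k = 16 - 4 * wO + 5 * sO - 2 * wO * sO := ⟨_, rfl⟩
  have hkP : k ∉ P := hodd (by
    have h2 : IsCoprime (toO (ZB.mk 16 (-4) 5 (-2))) 2 := isCoprime_toO_two (by
      rw [Int.isCoprime_iff_gcd_eq_one]
      decide)
    rw [toO_mk] at h2
    convert h2 using 1
    rw [hk]
    push_cast; ring)
  obtain ⟨c, hc⟩ : ∃ c, c = (3 + sO) * ((3 - sO) * (19 - 3 * wO) + wO - 5) := ⟨_, rfl⟩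
  have hcP : c ∈ P ^ 2 := hc ▸ Ideal.mul_mem_right _ _ hq2
  -- The factor 1 - ω makes the leading terms of y² and ((1 - ω)x)² cancel, so z² is (3 - √7) times
  -- an element of P, up to P⁴.
  obtain ⟨z, hz⟩ : ∃ z, z = y - (1 - wO) * x := ⟨_, rfl⟩
  have hzP : z ∈ P := hz ▸ P.sub_mem hyP (P.mul_mem_left _ hxP)
  obtain ⟨b, hb⟩ : ∃ b, b = (4 - wO + sO) * z + k * x + c := ⟨_, rfl⟩
  have hbP : b ∈ P := hb ▸ P.add_mem (P.add_mem (P.mul_mem_left _ hzP) (P.mul_mem_left _ hxP))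
    (Ideal.pow_le_self two_ne_zero hcP)
  have hzb : z ^ 2 + (3 + sO) * (3 - sO) * ((1 - wO) * (x * y)) = -((3 - sO) * b) := by
    have e1 : k = (4 - wO + sO) * (1 - wO) + (1 - wO) ^ 2 * (wO + 3 + sO) := by
      clear * - hk
      grind [wO_sq, sO_sq]
    have e2 : c = 6 - wO - sO + (1 - wO) ^ 2 * (wO + 5 - sO) := by
      clear * - hc
      grind [wO_sq, sO_sq]
    rw [hb, e1, e2, hz]
    linear_combination hy + (1 - wO) ^ 2 * hx - (1 - wO) * (x * y) * sO_sq
  have h4 : (3 + sO) * (3 - sO) * ((1 - wO) * (x * y)) ∈ P ^ 4 :=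
    Ideal.mul_mem_right _ _ (by
      rw [show 4 = 2 + 2 from rfl, pow_add]
      exact Ideal.mul_mem_mul hq2 hr2)
  have hz2 : z ∈ P ^ 2 := by
    have : z * z ∈ P ^ (1 + 1 + 1) := by
      rw [← pow_two, show z ^ 2 = -((3 - sO) * b) - (3 + sO) * (3 - sO) * ((1 - wO) * (x * y)) by
        linear_combination hzb]
      refine sub_mem (neg_mem ?_) (Ideal.pow_le_pow_right (by norm_num) h4)
      rw [pow_succ]
      exact Ideal.mul_mem_mul hr2 hbP
    exact (Ideal.mem_pow_or_mem_pow_of_mul_mem hP0 this).elim id id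
  have hb2 : b ∈ P ^ 2 := by
    have : (3 - sO) * b ∈ P ^ (2 + 1 + 1) := by
      rw [show (3 - sO) * b = -(z ^ 2 + (3 + sO) * (3 - sO) * ((1 - wO) * (x * y))) by
        linear_combination hzb]
      refine neg_mem (add_mem ?_ h4)
      have := Ideal.pow_mem_pow hz2 2
      rwa [← pow_mul] at this
    exact (Ideal.mem_pow_or_mem_pow_of_mul_mem hP0 this).resolve_left h
  have hx2 : x ∈ P ^ 2 := by
    refine (Ideal.IsPrime.mul_mem_pow P (?_ : k * x ∈ _)).resolve_left hkP
    rw [show k * x = b - (4 - wO + sO) * z - c by linear_combination -hb]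
    exact sub_mem (sub_mem hb2 (Ideal.mul_mem_left _ _ hz2)) hcP
  refine h ((Ideal.IsPrime.mul_mem_pow P
    (a := (wO + 3 + sO) * x + (wO + 5 - sO)) ?_).resolve_left hw)
  rw [mul_comm, hmul]
  have := Ideal.pow_mem_pow hx2 2
  rw [← pow_mul] at this
  exact neg_mem (Ideal.pow_le_pow_right (by norm_num) this)

end Example256

namespace Example256

/-- The order of the inertia group is the ramification index, and 3 + √7 generates the prime of F
below P. -/
lemma three_le_card_inertia {P : Ideal (𝓞 N')} [hP : P.IsPrime] (h2 : (2 : 𝓞 N') ∈ P) :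
    3 ≤ Nat.card (P.inertia Gal(N'/F)) := by
  have hP0 : P ≠ ⊥ := by rintro rfl; exact two_ne_zero h2
  obtain ⟨p, hp⟩ : ∃ p, p = P.under (𝓞 F) := ⟨_, rfl⟩
  have hlo : P.LiesOver p := ⟨hp⟩
  have hpp : p.IsPrime := hp ▸ inferInstance
  have hp0 : p ≠ ⊥ := by
    rintro rfl
    have h2' : (2 : 𝓞 F) ∈ P.under (𝓞 F) := by rwa [Ideal.mem_comap, map_ofNat]
    rw [← hp] at h2'
    exact two_ne_zero h2'
  have hmap : p.map (algebraMap (𝓞 F) (𝓞 N')) ≠ ⊥ := by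
    rwa [Ne, Ideal.map_eq_bot_iff_of_injective (FaithfulSMul.algebraMap_injective (𝓞 F) (𝓞 N'))]
  have hpm : p.IsMaximal := hpp.isMaximal hp0
  have : Finite (𝓞 F ⧸ p) := Ideal.finiteQuotientOfFreeOfNeBot p hp0
  have : Finite p.ResidueField := Finite.of_surjective (algebraMap (𝓞 F ⧸ p) p.ResidueField)
    (Ideal.bijective_algebraMap_quotient_residueField p).2
  have : PerfectField p.ResidueField := inferInstance
  rw [Ideal.card_inertia_eq_ramificationIdxIn (R := 𝓞 F) (G := Gal(N'/F)) p P,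
    Ideal.ramificationIdxIn_eq_ramificationIdx p P Gal(N'/F),
    Ideal.IsDedekindDomain.ramificationIdx_eq_multiplicity p P hmap]
  have hfin : FiniteMultiplicity P (p.map (algebraMap (𝓞 F) (𝓞 N'))) := by
    exact FiniteMultiplicity.of_prime_left (Ideal.prime_of_isPrime hP0 hP) hmap
  rw [← hfin.pow_dvd_iff_le_multiplicity, Ideal.dvd_iff_le, Ideal.map_le_iff_le_comap]
  intro x hx
  rw [hp, Ideal.mem_comap, algebraMap_eq_toO] at hx
  rw [Ideal.mem_comap, algebraMap_eq_toO]
  refine Ideal.mem_of_dvd _ (map_dvd toO (primeTwo_dvd_of_toO_mem h2 hx)) ?_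
  rw [toO_primeTwo]
  exact three_add_sO_mem_pow_three h2

/-- Only two signs are possible on √d_2, so they cannot separate the at least three inertia
elements. -/
lemma exists_inertia {P : Ideal (𝓞 N')} [hP : P.IsPrime] (h2 : (2 : 𝓞 N') ∈ P) :
    ∃ τ : Gal(N'/F), τ ≠ 1 ∧ τ • sqrtO 2 = sqrtO 2 ∧ ∀ x, τ • x - x ∈ P := by
  by_contra! h
  have hinj : Function.Injective (fun τ : P.inertia Gal(N'/F) => signN τ 2) := by
    intro τ₁ τ₂ h12
    by_contra hne
    have hmem : (τ₁⁻¹ * τ₂ : Gal(N'/F)) ∈ P.inertia Gal(N'/F) := (τ₁⁻¹ * τ₂).2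
    obtain ⟨x, hx⟩ := h (τ₁⁻¹ * τ₂) (fun h => hne (Subtype.ext (inv_mul_eq_one.1 h))) (by
      rw [smul_eq_self_iff, map_mul, InvMemClass.coe_inv, map_inv, Pi.mul_apply, Pi.inv_apply,
        inv_mul_eq_one]
      exact h12)
    exact hx (hmem x)
  have := Nat.card_le_card_of_injective _ hinj
  have h3 := three_le_card_inertia h2
  have h4 : Nat.card ℤˣ = 2 := by simp
  omega

/-- Pairing σ with τσ, each pair contributes 2σ(y) ≡ 0 modulo P. -/
lemma sum_smul_mem {P : Ideal (𝓞 N')} (h2 : (2 : 𝓞 N') ∈ P) {τ : Gal(N'/F)}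
    (h1 : τ ≠ 1) (hτ : ∀ x, τ • x - x ∈ P) (s : Finset Gal(N'/F)) (hs : ∀ σ ∈ s, τ * σ ∈ s)
    (y : 𝓞 N') : ∑ σ ∈ s, σ • y ∈ P := by
  have hττ : τ * τ = 1 := signN_injective (by
    rw [map_mul, map_one]
    ext i
    simp)
  rw [← Ideal.Quotient.eq_zero_iff_mem, map_sum]
  refine Finset.sum_involution (fun σ _ => τ * σ) (fun σ hσ => ?_) (fun σ _ _ h => h1 (by simpa using h))
    hs fun σ _ => by rw [← mul_assoc, hττ, one_mul]
  rw [← map_add, Ideal.Quotient.eq_zero_iff_mem, mul_smul]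
  have := P.add_mem (hτ (σ • y)) (P.mul_mem_right (σ • y) h2)
  convert this using 1
  ring

end Example256

namespace Example256

/-! ### The different of `N' / F` at `2` -/

lemma two_eq_primeTwo_sq_mul : (2 : ZB) = primeTwo ^ 2 * ZB.mk 8 0 (-3) 0 := by decide

lemma sq_sub_d_two : ZB.mk 3 1 1 0 ^ 2 - ZB.d 2 =
    primeTwo ^ 3 * (ZB.mk 8 0 (-3) 0 * ZB.mk 5 1 (-1) 0) := by decide

/-- With T = 3 + ω + √7 and p = 3 + √7, T² ≡ d_2 mod p³ and p⁴ divides 4, so p⁵ divides (t₂ -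
Tt₁)(t₂ + Tt₁). One factor is divisible by p³, and so is their difference 2Tt₁. -/
lemma primeTwo_pow_three_dvd_of_sq_sub {t₁ t₂ k : ZB} (h1 : primeTwo ∣ t₁) (hk : primeTwo ∣ k)
    (h : ZB.d 2 * t₁ ^ 2 - t₂ ^ 2 = 4 * ZB.d 2 * k) :
    primeTwo ^ 3 ∣ t₂ - ZB.mk 3 1 1 0 * t₁ := by
  have h4 := two_eq_primeTwo_sq_mul
  have h5 := sq_sub_d_two
  obtain ⟨T, hT⟩ : ∃ T, T = ZB.mk 3 1 1 0 := ⟨_, rfl⟩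
  rw [← hT] at h5 ⊢
  have hp := prime_primeTwo
  generalize primeTwo = p at *
  generalize ZB.mk 8 0 (-3) 0 = e at *
  generalize ZB.mk 5 1 (-1) 0 = v at *
  generalize ZB.d 2 = n at *
  obtain ⟨a, rfl⟩ := h1
  obtain ⟨b, rfl⟩ := hk
  have h6 : p ^ (2 + 2 + 1) ∣ (t₂ - T * (p * a)) * (t₂ + T * (p * a)) := by
    refine ⟨-(n * e ^ 2 * b) - e * v * a ^ 2, ?_⟩
    linear_combination -h - p ^ 2 * a ^ 2 * h5 - n * p * b * (2 + p ^ 2 * e) * h4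
  rcases succ_dvd_or_succ_dvd_of_succ_add_dvd_mul hp h6 with h7 | h7
  · exact h7
  · convert h7.sub (Dvd.intro (e * T * a) rfl : p ^ 3 ∣ p ^ 3 * (e * T * a)) using 1
    linear_combination (-T * p * a) * h4

/-- Let u and u' be the sums of the conjugates of y over the automorphisms fixing and negating √d_2.
Then t₁ = u + u' and t₂ = (u - u')√d_2, so d_2 t₁² - t₂² = 4d_2 uu'. The inertia element fixing √d_2
puts u and t₁ in the prime above 2. -/
lemma primeTwo_pow_three_dvd_trace {y : 𝓞 N'} {t₁ t₂ : ZB}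
    (h1 : toO t₁ = ∑ σ : Gal(N'/F), σ • y) (h2 : toO t₂ = ∑ σ : Gal(N'/F), σ • (y * sqrtO 2)) :
    primeTwo ^ 3 ∣ t₂ - ZB.mk 3 1 1 0 * t₁ := by
  classical
  obtain ⟨P, hP, hP2⟩ := exists_prime_two_mem
  obtain ⟨τ, hτ1, hτ, hτP⟩ := exists_inertia hP2
  have hs (f : Gal(N'/F) → 𝓞 N') := Finset.sum_filter_add_sum_filter_not Finset.univ
    (fun σ : Gal(N'/F) => σ • sqrtO 2 = sqrtO 2) f
  have hu := sum_smul_mem hP2 hτ1 hτP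
    (Finset.univ.filter fun σ : Gal(N'/F) => σ • sqrtO 2 = sqrtO 2) (fun σ hσ => by
      rw [Finset.mem_filter] at hσ ⊢
      exact ⟨Finset.mem_univ _, by rw [mul_smul, hσ.2, hτ]⟩) y
  have htr := sum_smul_mem hP2 hτ1 hτP Finset.univ (fun _ _ => Finset.mem_univ _) y
  rw [← h1] at htr
  rw [← hs] at h1 h2
  have e1 : ∑ σ : Gal(N'/F) with σ • sqrtO 2 = sqrtO 2, σ • (y * sqrtO 2) =
      (∑ σ : Gal(N'/F) with σ • sqrtO 2 = sqrtO 2, σ • y) * sqrtO 2 := by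
    rw [Finset.sum_mul]
    refine Finset.sum_congr rfl fun σ hσ => ?_
    rw [smul_mul', (Finset.mem_filter.1 hσ).2]
  have e2 : ∑ σ : Gal(N'/F) with ¬ σ • sqrtO 2 = sqrtO 2, σ • (y * sqrtO 2) =
      -((∑ σ : Gal(N'/F) with ¬ σ • sqrtO 2 = sqrtO 2, σ • y) * sqrtO 2) := by
    rw [Finset.sum_mul, ← Finset.sum_neg_distrib]
    refine Finset.sum_congr rfl fun σ hσ => ?_
    rw [smul_mul', (smul_sqrtO σ 2).resolve_left (Finset.mem_filter.1 hσ).2, mul_neg]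
  rw [e1, e2] at h2
  generalize ∑ σ : Gal(N'/F) with σ • sqrtO 2 = sqrtO 2, σ • y = u at *
  generalize ∑ σ : Gal(N'/F) with ¬ σ • sqrtO 2 = sqrtO 2, σ • y = u' at *
  have huu : toO (ZB.d 2 * t₁ ^ 2 - t₂ ^ 2) = toO (4 * ZB.d 2) * (u * u') := by
    simp only [map_sub, map_mul, map_pow, map_ofNat, ← sqrtO_sq', h1, h2]
    ring
  obtain ⟨k, hk⟩ := toO_dvd_iff.1 (Dvd.intro _ huu.symm)
  have h0 : toO (4 * ZB.d 2) ≠ 0 := toO_ne_zero (by decide)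
  have hk' : toO k = u * u' := mul_left_cancel₀ h0 (by rw [← huu, hk, map_mul toO (4 * ZB.d 2) k])
  exact primeTwo_pow_three_dvd_of_sq_sub (primeTwo_dvd_of_toO_mem hP2 htr)
    (primeTwo_dvd_of_toO_mem hP2 (hk' ▸ P.mul_mem_right _ hu)) hk

lemma pow_three_dvd_mul {δ : 𝓞 N'} (hδ : δ ∈ differentIdeal (𝓞 F) (𝓞 N')) :
    (3 + sO) ^ 3 ∣ δ * (sqrtO 2 - (wO + 3 + sO)) := by
  have hT : wO + 3 + sO = toO (ZB.mk 3 1 1 0) := by rw [toO_mk]; push_cast; ring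
  rw [← toO_primeTwo, ← map_pow]
  refine toO_dvd_mul_of_mem_differentIdeal (pow_ne_zero _ primeTwo_ne_zero) (fun y t ht => ?_) hδ
  obtain ⟨t₁, -, h1⟩ := exists_trace_eq_toO y
  obtain ⟨t₂, -, h2⟩ := exists_trace_eq_toO (y * sqrtO 2)
  have : t = t₂ - ZB.mk 3 1 1 0 * t₁ := toO_injective (by
    rw [map_sub, map_mul, ht, h1, h2, Finset.mul_sum, ← Finset.sum_sub_distrib]
    refine Finset.sum_congr rfl fun σ _ => ?_
    rw [hT, mul_sub, smul_sub, smul_mul' σ y (toO _), smul_toO, mul_comm (toO _)])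
  rw [this]
  exact primeTwo_pow_three_dvd_trace h1 h2

/-- For δ, δ' in the different, (3 + √7)² divides δx and δ'x, where x² is 3 + √7 times a factor
prime to 2. Thus (3 + √7)³ divides δδ', and (3 + √7)⁶ is 8 times a unit. -/
theorem differentIdeal_le_two : differentIdeal (𝓞 F) (𝓞 N') ^ 4 ≤ Ideal.span {8} := by
  obtain ⟨x, hx, hx2⟩ := exists_sqrtO_two_sub
  have hco := isCoprime_two_of_sq_eq hx2
  have hdvd {δ : 𝓞 N'} (hδ : δ ∈ differentIdeal (𝓞 F) (𝓞 N')) : (3 + sO) ^ 2 ∣ δ * x := by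
    refine (mul_dvd_mul_iff_left three_add_sO_ne_zero).1 ?_
    rw [← pow_succ', mul_left_comm, hx]
    exact pow_three_dvd_mul hδ
  have h1 : differentIdeal (𝓞 F) (𝓞 N') * differentIdeal (𝓞 F) (𝓞 N') ≤
      Ideal.span {(3 + sO) ^ 3} := by
    refine Ideal.mul_le.2 fun δ hδ δ' hδ' => ?_
    rw [Ideal.mem_span_singleton]
    have h3 : (3 + sO) * (3 + sO) ^ 3 ∣ (3 + sO) *
        (δ * δ' * ((8 - 3 * sO) * ((wO + 3 + sO) * x + (wO + 5 - sO)))) := by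
      convert (mul_dvd_mul (hdvd hδ) (hdvd hδ')).neg_right using 1
      · ring
      · linear_combination δ * δ' * hx2 -
          3 * δ * δ' * ((wO + 3 + sO) * x + (wO + 5 - sO)) * sO_sq
    have h4 := (mul_dvd_mul_iff_left three_add_sO_ne_zero).1 h3
    refine IsCoprime.dvd_of_dvd_mul_right ?_ h4
    refine IsCoprime.mul_right ?_ ?_
    · exact ⟨0, 8 + 3 * sO, by linear_combination (-9) * sO_sq⟩
    · refine IsCoprime.pow_left (hco.of_isCoprime_of_dvd_right ⟨3 - sO, two_eq_mul⟩).symm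
  have h2 := Ideal.pow_right_mono h1 2
  rw [← pow_two, ← pow_mul, Ideal.span_singleton_pow] at h2
  refine h2.trans ?_
  rw [Ideal.span_singleton_le_span_singleton]
  refine ⟨(8 + 3 * sO) ^ 3, ?_⟩
  have : (3 + sO) ^ 2 = 2 * (8 + 3 * sO) := by linear_combination sO_sq
  calc _ = ((3 + sO) ^ 2) ^ 3 := by ring
    _ = _ := by rw [this]; ring

/-- The fourth power of the different of `N' / F`. -/
theorem differentIdeal_pow_four : differentIdeal (𝓞 F) (𝓞 N') ^ 4 = Ideal.span {72} := by
  refine le_antisymm ?_ ((Ideal.span_singleton_le_iff_mem _).2 seventy_two_mem)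
  intro x hx
  have h8 := Ideal.mem_span_singleton.1 (differentIdeal_le_two hx)
  have h9 := Ideal.mem_span_singleton.1 (differentIdeal_le_three hx)
  rw [Ideal.mem_span_singleton]
  have hco : IsCoprime (8 : 𝓞 N') 9 := ⟨-1, 1, by norm_num⟩
  have := hco.mul_dvd h8 h9
  norm_num at this
  exact this

end Example256

namespace Example256

/-! ### The discriminant of `N'` -/

lemma absNorm_differentIdeal_N : Ideal.absNorm (differentIdeal (𝓞 F) (𝓞 N')) = 72 ^ 64 := by
  refine Nat.pow_left_injective (n := 4) (by norm_num) ?_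
  dsimp only
  rw [← map_pow, differentIdeal_pow_four, Ideal.absNorm_span_singleton,
    show (72 : 𝓞 N') = algebraMap ℤ (𝓞 N') 72 by simp, Algebra.norm_algebraMap,
    RingOfIntegers.rank, finrank_N, Int.natAbs_pow, ← pow_mul]
  rfl

lemma natAbs_discr_N : (discr N').natAbs = (72 * 364 ^ 2) ^ 64 := by
  rw [natAbs_discr_eq_absNorm_differentIdeal_mul_natAbs_discr_pow F (𝓞 F) N' (𝓞 N'),
    absNorm_differentIdeal_N, finrank_F_N, discr_F, mul_pow]
  rfl

lemma rootDiscriminant_nonneg : 0 ≤ rootDiscriminant N' := Real.rpow_nonneg (abs_nonneg _) _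

lemma rootDiscriminant_pow_four : rootDiscriminant N' ^ 4 = 9539712 := by
  have h : |(discr N' : ℝ)| = (9539712 : ℝ) ^ 64 := by
    rw [← Int.cast_abs, Int.abs_eq_natAbs, natAbs_discr_N]
    push_cast
    norm_num
  rw [rootDiscriminant, h, finrank_N, ← Real.rpow_natCast, ← Real.rpow_natCast,
    ← Real.rpow_mul (by norm_num), ← Real.rpow_mul (by norm_num)]
  norm_num

lemma rootDiscriminant_eq : rootDiscriminant N' = 2 ^ (7 / 4 : ℝ) * √(3 * 7 * 13 : ℝ) := by
  refine (pow_left_inj₀ rootDiscriminant_nonneg (by positivity) four_ne_zero).1 ?_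
  have h1 : ((2 : ℝ) ^ (7 / 4 : ℝ)) ^ 4 = 128 := by
    rw [← Real.rpow_natCast, ← Real.rpow_mul (by norm_num)]
    norm_num
  have h2 : √(3 * 7 * 13 : ℝ) ^ 4 = 74529 := by
    rw [show 4 = 2 * 2 from rfl, pow_mul, Real.sq_sqrt (by norm_num)]
    norm_num
  rw [rootDiscriminant_pow_four, mul_pow, h1, h2]
  norm_num

lemma abs_rootDiscriminant_sub_lt : |rootDiscriminant N' - 55.5756| < 0.00005 := by
  have h := rootDiscriminant_pow_four
  have h0 := rootDiscriminant_nonneg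
  have h1 : rootDiscriminant N' < 55.57565 :=
    lt_of_pow_lt_pow_left₀ 4 (by norm_num) (by rw [h]; norm_num)
  have h2 : 55.57555 < rootDiscriminant N' :=
    lt_of_pow_lt_pow_left₀ 4 h0 (by rw [h]; norm_num)
  rw [abs_lt]
  constructor <;> linarith

/-! ### The conjugates of `ν₁₁` -/

/-- The minimal polynomial has integer coefficients, so ring endomorphisms of `ZB` carry roots to
roots. -/
lemma aeval_minpoly_toComplex (φ : ZB →+* ZB) (x : ZB) :
    Polynomial.aeval (toComplex (φ x)) (minpoly ℚ (toComplex x)) = 0 := by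
  have hi : IsIntegral ℤ x := Algebra.IsIntegral.isIntegral x
  have hx : minpoly ℚ (toComplex x) = (minpoly ℤ x).map (algebraMap ℤ ℚ) := by
    rw [← minpoly.algHom_eq toComplex.toIntAlgHom toComplex_injective]
    exact minpoly.isIntegrallyClosed_eq_field_fractions' ℚ (hi.map toComplex.toIntAlgHom)
  rw [hx, Polynomial.aeval_map_algebraMap]
  have h2 := Polynomial.aeval_algHom_apply (toComplex.comp φ).toIntAlgHom x (minpoly ℤ x)
  rw [minpoly.aeval, map_zero] at h2
  exact h2

lemma natDegree_minpoly_toComplex_le (x : ZB) : (minpoly ℚ (toComplex x)).natDegree ≤ 4 := by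
  rw [← finrank_F, toComplex, RingHom.comp_apply,
    minpoly.algebraMap_eq (algebraMap F ℂ).injective]
  exact minpoly.natDegree_le _

/-- The four numbers are distinct images of one element under automorphisms of `ZB`, and the degree
of the minimal polynomial is at most [F : ℚ] = 4. -/
theorem aroots_minpoly_nu_one_one :
    (minpoly ℚ (nu 1 1)).aroots ℂ = {nu 1 1, nu 1 2, nu 2 1, nu 2 2} := by
  obtain ⟨x, hx⟩ : ∃ x, x = ZB.mk (-21) 16 (-8) 6 := ⟨_, rfl⟩
  have h11 : nu 1 1 = toComplex (RingHom.id ZB x) := by rw [hx, nu_one_one]; rfl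
  have h21 : nu 2 1 = toComplex ((conjEquiv ZW 7 0 : ZB →+* ZB) x) := by
    rw [nu_two_one, hx]; exact congrArg _ (by decide)
  have h12 : nu 1 2 = toComplex ((ZB.conjW : ZB →+* ZB) x) := by
    rw [nu_one_two, hx]; exact congrArg _ (by decide)
  have h22 : nu 2 2 = toComplex (((ZB.conjW : ZB →+* ZB).comp (conjEquiv ZW 7 0 : ZB →+* ZB)) x) := by
    rw [nu_two_two, hx]; exact congrArg _ (by decide)
  have hnd : ({nu 1 1, nu 1 2, nu 2 1, nu 2 2} : Multiset ℂ).Nodup := by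
    have : ({nu 1 1, nu 1 2, nu 2 1, nu 2 2} : Multiset ℂ) =
        Multiset.map toComplex {ZB.mk (-21) 16 (-8) 6, ZB.mk (-5) (-16) (-2) (-6),
          ZB.mk (-21) 16 8 (-6), ZB.mk (-5) (-16) 2 6} := by
      rw [nu_one_one, nu_one_two, nu_two_one, nu_two_two]
      rfl
    rw [this]
    exact Multiset.Nodup.map toComplex_injective (by decide)
  have hi : IsIntegral ℚ (toComplex x) :=
    ((Algebra.IsIntegral.isIntegral (R := ℤ) x).map toComplex.toIntAlgHom).tower_top
  have hne := minpoly.ne_zero hi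
  refine (Multiset.eq_of_le_of_card_le ((Multiset.le_iff_subset hnd).2 fun z hz => ?_) ?_).symm
  · rw [Polynomial.mem_aroots, show minpoly ℚ (nu 1 1) = minpoly ℚ (toComplex x) by rw [h11]; rfl]
    refine ⟨hne, ?_⟩
    simp only [Multiset.insert_eq_cons, Multiset.mem_cons, Multiset.mem_singleton] at hz
    rcases hz with rfl | rfl | rfl | rfl
    · rw [h11]; exact aeval_minpoly_toComplex _ x
    · rw [h12]; exact aeval_minpoly_toComplex _ x
    · rw [h21]; exact aeval_minpoly_toComplex _ x
    · rw [h22]; exact aeval_minpoly_toComplex _ x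
  · rw [show minpoly ℚ (nu 1 1) = minpoly ℚ (toComplex x) by rw [h11]; rfl]
    refine (Polynomial.card_roots' _).trans (Polynomial.natDegree_map_le.trans ?_)
    exact natDegree_minpoly_toComplex_le x

/-! ### `N'` as a narrow ray class field -/

theorem isNarrowRayClassField_N :
    RayClass.IsNarrowRayClassField F N' (Ideal.span {(6 : 𝓞 F)}) := by
  have h6 (v : HeightOneSpectrum (𝓞 F)) : v.asIdeal ∣ Ideal.span {6} ↔ 6 ∈ v.asIdeal := by
    rw [Ideal.dvd_span_singleton]
  refine ⟨?_, inferInstance, fun v hv P hP hPv => ?_,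
    artin.comp (RayClass.idealsPrimeTo (Ideal.span {6})).subtype, fun I v hI P hP hPv => ?_,
    fun I => ⟨fun h => ?_, ?_⟩⟩
  · rw [Ne, Ideal.span_singleton_eq_bot]
    exact OfNat.ofNat_ne_zero 6
  · refine isUnramifiedAt_of_six_notMem fun h => hv ((h6 v).2 ?_)
    rw [hPv.over, Ideal.mem_comap, map_ofNat]
    exact h
  · refine isArithFrobAt_artin (fun h => ?_) hI hP hPv
    have h1 := I.2 v ((h6 v).2 h)
    rw [hI, FractionalIdeal.count_self] at h1
    exact one_ne_zero h1
  · exact exists_ray_of_artin_eq_one I.2 h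
  · rintro ⟨α, h1, hp, hI⟩
    change artin I = 1
    rw [hI]
    exact artin_eq_one_of_ray h1 hp

end Example256

end

theorem mainTheorem3 :
    ((minpoly ℚ (Example256.nu 1 1)).aroots ℂ =
      {Example256.nu 1 1, Example256.nu 1 2, Example256.nu 2 1, Example256.nu 2 2}) ∧
    Module.finrank ℚ Example256.N' = 256 ∧
    rootDiscriminant Example256.N' = 2 ^ (7 / 4 : ℝ) * √(3 * 7 * 13 : ℝ) ∧
    |rootDiscriminant Example256.N' - 55.5756| < 0.00005 ∧
    RayClass.IsNarrowRayClassField Example256.F Example256.N'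
      (Ideal.span {(6 : 𝓞 Example256.F)}) :=
  ⟨Example256.aroots_minpoly_nu_one_one, Example256.finrank_N, Example256.rootDiscriminant_eq,
    Example256.abs_rootDiscriminant_sub_lt, Example256.isNarrowRayClassField_N⟩
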